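/- Conventions. Let $\Lambda$ be an even lattice of signature $(1,\ell-1)$ with quadratic form $Q$ and $\langle x,y\rangle = Q(x+y)-Q(x)-Q(y)$; fix a connected component $P$ of $\{y\in\Lambda\otimes\mathbb R : Q(y)>0\}$ and put $\mathbb H_\Lambda=\{x+iy\in\Lambda\otimes\mathbb C : y\in P\}$. Let $\Lambda_1=\Lambda\oplus \mathrm{II}_{1,1}$ with Gram matrix $\begin{pmatrix}0&0&1\\0&\mathbf S&0\\1&0&0\end{pmatrix}$, where $\mathbf S$ is a Gram matrix of $\Lambda$. Let $G_\Lambda=\mathrm{SO}^+(\Lambda_1\otimes\mathbb R)$ be the identity component of the orthogonal group; for $M\in G_\Lambda$ and $z\in\mathbb H_\Lambda$ define $j(M;z)\in\mathbb C^\times$ and $M\cdot z\in\mathbb H_\Lambda$ by $M(-Q(z),z,1)^T=j(M;z)\,(-Q(M\cdot z),M\cdot z,1)^T$, and for $k\in\mathbb Z$ let $(F|_kM)(z)=j(M;z)^{-k}F(M\cdot z)$. Let $\Gamma_\Lambda=\{M\in G_\Lambda : M \text{ acts trivially on }\Lambda_1'/\Lambda_1\}$, and let $\mathrm{SO}^+(\Lambda_1\otimes\mathbb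 Q)$ be the set of elements of $G_\Lambda$ with rational entries. A modular form of weight $k\in\mathbb Z$ on $\mathbb H_\Lambda$ is a holomorphic $F:\mathbb H_\Lambda\to\mathbb C$ with $F|_kM=F$ for all $M\in\Gamma_\Lambda$ such that for all $M\in\mathrm{SO}^+(\Lambda_1\otimes\mathbb Q)$ and $v\in P$ the values $(F|_kM)(x+itv)$ remain bounded as $t\to\infty$, uniformly in $x\in\Lambda\otimes\mathbb R$. It is a cusp form if moreover for all such $M$, $v$, $x$ these values tend to $0$ as $t\to\infty$, and the Fourier expansion of $F|_kM$ is supported on exponents in the open cone $P$. The same definitions apply to $L$ below, with positive cone $P\cap(L\otimes\mathbb R)$. For $s\in\mathbb C$ and $N\in\mathbb N_0$ let $$G_N^s(x,y)=N!\sum_{2n_1+n_2=N}(-1)^{n_1}\frac{\Gamma(s+n_1+n_2)}{\Gamma(s+\lceil N/2\rceil)\,n_1!\,n_2!}\,x^{n_2}y^{n_1},$$ where the quotient of Gamma values is read as the polynomial $\prod_{j=\lceil N/2\rceil}^{n_1+n_2-1}(s+j)$. Statement. Let $\lambda\in\Lambda$ with $Q(\lambda)=-m$, $m>0$, and let $L=\lambda^\perp\subseteq\Lambda$,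 with Gram matrix $\mathbf S_L$ in coordinates $z_1,\dots,z_{\ell-1}$ and Laplace operator $\Delta_L=\frac12\sum_{i,j}(\mathbf S_L^{-1})_{ij}\,\partial_{z_i}\partial_{z_j}$. Let $F$ be a modular form of weight $k$ on $\mathbb H_\Lambda$ and let $N\in\mathbb N_0$. Define, for $z\in\mathbb H_L$, $$P_N^LF(z;\lambda)=(2\pi i)^{-N}\,G_N^{k+(1-\ell)/2}(\partial_w,m\Delta_L)\,F(z+w\lambda)\Big|_{w=0}.$$ (1) $P_N^LF(\,\cdot\,;\lambda)$ is a modular form of weight $k+N$ on $\mathbb H_L$, and it is a cusp form if $N\ge1$. (2) If $F$ has the Fourier expansion $$F(z+w\lambda)=\sum_{r\in L'}\ \sum_{\mu\in(2m)^{-1}\mathbb Z}c(r,\mu)\,\mathbf q^{r}s^{\mu},\qquad \mathbf q^r=e^{2\pi i\langle r,z\rangle},\quad s^{\mu}=e^{2\pi i(2m)\mu w},$$ for all $z+w\lambda\in\mathbb H_\Lambda$, then for every $r$ only finitely many $c(r,\mu)$ are nonzero, and for all $z\in\mathbb H_L$ $$P_N^LF(z;\lambda)=\sum_{r\in L'}\Big(\sum_{\mu\in(2m)^{-1}\mathbb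 Z}c(r,\mu)\,G_N^{k+(1-\ell)/2}\big(2m\mu,\,mQ(r)\big)\Big)\mathbf q^{r}.$$ (3) For every $a\in\mathbb Z$ and $z\in\mathbb H_L$, $P_N^LF(z;a\lambda)=a^N\,P_N^LF(z;\lambda)$. (Here $L$ is kept fixed, and on the left $m$ is replaced by $-Q(a\lambda)=a^2m$.) -/

import Mathlib

namespace HigherPullback

open Matrix Filter Topology

noncomputable section

variable {ι κ : Type*} [Fintype ι] [DecidableEq ι] [Fintype κ] [DecidableEq κ]

/-! A lattice is given by its Gram matrix `S` with respect to a `ℤ`-basis indexed by `ι`.  Thus the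
lattice is `ι → ℤ`, and `ι → ℝ`, `ι → ℂ` are its scalar extensions. -/

/-- The bilinear form `⟨x, y⟩ = xᵀ S y`, extended to the scalars `K`. -/
def bilin {K : Type*} [Field K] (S : Matrix ι ι ℤ) (x y : ι → K) : K :=
  x ⬝ᵥ (S.map (Int.cast : ℤ → K) *ᵥ y)

/-- The quadratic form `Q(x) = xᵀ S x / 2`, extended to the scalars `K`; `Q x` is what is called
the norm of `x`. -/
def quad {K : Type*} [Field K] (S : Matrix ι ι ℤ) (x : ι → K) : K :=
  bilin S x x / 2

/-- The image of an integral vector in a scalar extension. -/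
def ofInt (K : Type*) [Field K] (x : ι → ℤ) : ι → K := fun i => (x i : K)

/-- `S` is the Gram matrix of an even lattice of signature `(1, ℓ - 1)`, where `ℓ = #ι`. -/
structure IsEvenLorentzian (S : Matrix ι ι ℤ) : Prop where
  symm : S.IsSymm
  even_diag : ∀ i, Even (S i i)
  signature : ∃ (i₀ : ι) (A : Matrix ι ι ℝ), IsUnit A.det ∧
    Aᵀ * S.map (Int.cast : ℤ → ℝ) * A = Matrix.diagonal (fun i => if i = i₀ then 1 else -1)

/-- `P` is one of the connected components of the set of vectors of positive norm. -/
def IsPositiveCone (S : Matrix ι ι ℤ) (P : Set (ι → ℝ)) : Prop :=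
  ∃ y ∈ {x : ι → ℝ | 0 < quad S x}, P = connectedComponentIn {x : ι → ℝ | 0 < quad S x} y

/-- The orthogonal upper half-space: all `z = x + i y` with `y` in the positive cone `P`. -/
def upperHalfSpace (P : Set (ι → ℝ)) : Set (ι → ℂ) :=
  {z | (fun i => (z i).im) ∈ P}

/-- The dual lattice, inside the real scalar extension. -/
def dualLattice (S : Matrix ι ι ℤ) : Set (ι → ℝ) :=
  {x | ∀ y : ι → ℤ, ∃ n : ℤ, bilin S x (ofInt ℝ y) = n}

/-- The Gram matrix of the orthogonal sum with the even unimodular lattice of signature `(1, 1)`,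
in blocks of sizes `1, ℓ, 1`:  `(0 0 1; 0 S 0; 1 0 0)`. -/
def bigGram (S : Matrix ι ι ℤ) : Matrix (Unit ⊕ ι ⊕ Unit) (Unit ⊕ ι ⊕ Unit) ℤ :=
  Matrix.fromBlocks 0 (Matrix.fromCols 0 1) (Matrix.fromRows 0 1) (Matrix.fromBlocks S 0 0 0)

/-- The real orthogonal group of `Λ₁`, as a set of matrices. -/
def orthogonalSet (S : Matrix ι ι ℤ) :
    Set (Matrix (Unit ⊕ ι ⊕ Unit) (Unit ⊕ ι ⊕ Unit) ℝ) :=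
  {M | Mᵀ * (bigGram S).map (Int.cast : ℤ → ℝ) * M = (bigGram S).map (Int.cast : ℤ → ℝ)}

/-- `SO⁺(Λ₁ ⊗ ℝ)`, the connected component of the identity in the orthogonal group. -/
def SOPlus (S : Matrix ι ι ℤ) : Set (Matrix (Unit ⊕ ι ⊕ Unit) (Unit ⊕ ι ⊕ Unit) ℝ) :=
  connectedComponentIn (orthogonalSet S) 1

/-- `SO⁺(Λ₁ ⊗ ℚ)`: the elements of `SO⁺(Λ₁ ⊗ ℝ)` with rational entries. -/
def SOPlusRat (S : Matrix ι ι ℤ) : Set (Matrix (Unit ⊕ ι ⊕ Unit) (Unit ⊕ ι ⊕ Unit) ℝ) :=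
  {M | M ∈ SOPlus S ∧ ∀ i j, ∃ q : ℚ, M i j = q}

/-- The modular group: the elements of `SO⁺(Λ₁ ⊗ ℝ)` acting trivially on `Λ₁' / Λ₁`. -/
def modularGroup (S : Matrix ι ι ℤ) :
    Set (Matrix (Unit ⊕ ι ⊕ Unit) (Unit ⊕ ι ⊕ Unit) ℝ) :=
  {M | M ∈ SOPlus S ∧
    ∀ x ∈ dualLattice (bigGram S), ∃ y : Unit ⊕ ι ⊕ Unit → ℤ, M *ᵥ x - x = ofInt ℝ y}

/-- The isotropic vector `(-Q(z), z, 1)` attached to `z`. -/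
def lift (S : Matrix ι ι ℤ) (z : ι → ℂ) : Unit ⊕ ι ⊕ Unit → ℂ :=
  Sum.elim (fun _ => -quad S z) (Sum.elim z (fun _ => 1))

/-- The factor of automorphy `j(M; z)`: since the last coordinate of `lift S w` is `1`, the equation
`M (lift z) = j • lift w` forces `j` to be the last coordinate of `M (lift z)`. -/
def autFactor (S : Matrix ι ι ℤ) (M : Matrix (Unit ⊕ ι ⊕ Unit) (Unit ⊕ ι ⊕ Unit) ℝ)
    (z : ι → ℂ) : ℂ :=
  (M.map (algebraMap ℝ ℂ) *ᵥ lift S z) (Sum.inr (Sum.inr ()))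

/-- The Möbius action `M · z`: the `w` with `M (lift z) = j(M; z) • lift w`. -/
def moebius (S : Matrix ι ι ℤ) (M : Matrix (Unit ⊕ ι ⊕ Unit) (Unit ⊕ ι ⊕ Unit) ℝ)
    (z : ι → ℂ) : ι → ℂ :=
  fun i => (M.map (algebraMap ℝ ℂ) *ᵥ lift S z) (Sum.inr (Sum.inl i)) / autFactor S M z

/-- The slash operator `(F|ₖ M)(z) = j(M; z)⁻ᵏ F(M · z)`. -/
def slash (S : Matrix ι ι ℤ) (k : ℤ) (F : (ι → ℂ) → ℂ)
    (M : Matrix (Unit ⊕ ι ⊕ Unit) (Unit ⊕ ι ⊕ Unit) ℝ) (z : ι → ℂ) : ℂ :=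
  autFactor S M z ^ (-k) * F (moebius S M z)

/-- The point `x + i t v`. -/
def rayPoint (x v : ι → ℝ) (t : ℝ) : ι → ℂ :=
  fun i => (x i : ℂ) + Complex.I * (t * v i : ℝ)

/-- The exponential `q ^ r = exp (2 π i ⟨r, z⟩)`. -/
def qExp (S : Matrix ι ι ℤ) (r : ι → ℝ) (z : ι → ℂ) : ℂ :=
  Complex.exp (2 * Real.pi * Complex.I * bilin S (fun i => (r i : ℂ)) z)

/-- Orthogonal modular forms of weight `k`: holomorphic on the upper half-space, invariant under the
modular group, and of bounded growth at every cusp, i.e. for every `M ∈ SO⁺(Λ₁ ⊗ ℚ)` and `v ∈ P` the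
function `(F|ₖ M)(x + i t v)` stays bounded, uniformly in the real part `x`, as `t → ∞`. -/
structure IsModularForm (S : Matrix ι ι ℤ) (P : Set (ι → ℝ)) (k : ℤ) (F : (ι → ℂ) → ℂ) :
    Prop where
  holomorphic : DifferentiableOn ℂ F (upperHalfSpace P)
  slash_eq : ∀ M ∈ modularGroup S, ∀ z ∈ upperHalfSpace P, slash S k F M z = F z
  bounded : ∀ M ∈ SOPlusRat S, ∀ v ∈ P, ∃ B : ℝ, ∀ᶠ t : ℝ in atTop, ∀ x : ι → ℝ,
    ‖slash S k F M (rayPoint x v t)‖ ≤ B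

/-- Cusp forms: modular forms such that, for every `M ∈ SO⁺(Λ₁ ⊗ ℚ)`, the limits of
`(F|ₖ M)(x + i t v)` as `t → ∞` vanish, and the Fourier expansion of `F|ₖ M` (whose exponents lie in
`d⁻¹ Λ'` for some positive integer `d`) is supported on the open cone `P`.  The second condition
expresses vanishing also along the one-dimensional boundary components. -/
structure IsCuspForm (S : Matrix ι ι ℤ) (P : Set (ι → ℝ)) (k : ℤ) (F : (ι → ℂ) → ℂ) :
    Prop where
  isModularForm : IsModularForm S P k F
  tendsto_zero : ∀ M ∈ SOPlusRat S, ∀ v ∈ P, ∀ x : ι → ℝ,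
    Tendsto (fun t : ℝ => slash S k F M (rayPoint x v t)) atTop (𝓝 0)
  support : ∀ M ∈ SOPlusRat S, ∃ d : ℕ, 0 < d ∧ ∃ c : dualLattice S → ℂ,
    (∀ r, c r ≠ 0 → (r : ι → ℝ) ∈ P) ∧
    ∀ z ∈ upperHalfSpace P,
      HasSum (fun r : dualLattice S => c r * qExp S ((d : ℝ)⁻¹ • (r : ι → ℝ)) z) (slash S k F M z)

/-- The partial derivative `∂G/∂zᵢ`. -/
def partialDeriv (i : ι) (G : (ι → ℂ) → ℂ) : (ι → ℂ) → ℂ :=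
  fun z => fderiv ℂ G z (Pi.single i 1)

/-- The Laplace operator `Δ = ½ ∑ᵢⱼ sⁱʲ ∂²/∂zᵢ∂zⱼ`, where `(sⁱʲ) = S⁻¹`. -/
def laplacian (S : Matrix ι ι ℤ) (G : (ι → ℂ) → ℂ) : (ι → ℂ) → ℂ :=
  fun z => (1 / 2) * ∑ i, ∑ j,
    (S.map (Int.cast : ℤ → ℂ))⁻¹ i j * partialDeriv i (partialDeriv j G) z

/-- For `2 n₁ + n₂ = N`, the coefficient of `x ^ n₂ y ^ n₁` in the rescaled Gegenbauer polynomial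
`G_N^s(x, y) = N! ∑ (-1)^n₁ Γ(s + n₁ + n₂) / (Γ(s + ⌈N/2⌉) n₁! n₂!) x^n₂ y^n₁`.  The quotient of
Gamma values is the polynomial `(s + ⌈N/2⌉)(s + ⌈N/2⌉ + 1) ⋯ (s + n₁ + n₂ - 1)` in `s`, with
`⌊N/2⌋ - n₁` factors. -/
def gegenbauerCoeff (N : ℕ) (s : ℂ) (n₁ : ℕ) : ℂ :=
  (-1) ^ n₁ * (N.factorial : ℂ) / ((n₁.factorial : ℂ) * ((N - 2 * n₁).factorial : ℂ)) *
    (ascPochhammer ℂ (N / 2 - n₁)).eval (s + ((N + 1) / 2 : ℕ))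

/-- The rescaled homogenized Gegenbauer polynomial `G_N^s(x, y)`. -/
def gegenbauer (N : ℕ) (s x y : ℂ) : ℂ :=
  ∑ n₁ ∈ Finset.range (N / 2 + 1), gegenbauerCoeff N s n₁ * x ^ (N - 2 * n₁) * y ^ n₁

/-- The orthogonal complement `λ^⊥` of a lattice vector. -/
def orthLattice (S : Matrix ι ι ℤ) (lam : ι → ℤ) : Submodule ℤ (ι → ℤ) where
  carrier := {x | x ⬝ᵥ (S *ᵥ lam) = 0}
  add_mem' {x y} (hx : x ⬝ᵥ (S *ᵥ lam) = 0) (hy : y ⬝ᵥ (S *ᵥ lam) = 0) :=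
    show (x + y) ⬝ᵥ (S *ᵥ lam) = 0 by rw [add_dotProduct, hx, hy, add_zero]
  zero_mem' := zero_dotProduct _
  smul_mem' a x (hx : x ⬝ᵥ (S *ᵥ lam) = 0) :=
    show (a • x) ⬝ᵥ (S *ᵥ lam) = 0 by rw [smul_dotProduct, hx, smul_zero]

/-- The Gram matrix of a family `b` of lattice vectors. -/
def gramOf (S : Matrix ι ι ℤ) (b : κ → ι → ℤ) : Matrix κ κ ℤ :=
  Matrix.of fun i j => b i ⬝ᵥ (S *ᵥ b j)

/-- The vector with coordinates `z` with respect to the family `b`. -/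
def embed {K : Type*} [Field K] (b : κ → ι → ℤ) (z : κ → K) : ι → K :=
  ∑ i, z i • ofInt K (b i)

/-- The positive cone of the sublattice spanned by `b` that is contained in `P`. -/
def subCone (b : κ → ι → ℤ) (P : Set (ι → ℝ)) : Set (κ → ℝ) :=
  {y | embed b y ∈ P}

/-- The `N`-th pullback
`P_N^L F(z; λ) = (2 π i)^(-N) G_N^(k + (1 - ℓ)/2)(∂_w, m Δ_L) F(z + w λ) |_{w = 0}`, `m = -Q(λ)`,
where `L` is the lattice with basis `b`. -/
def pullback (S : Matrix ι ι ℤ) (b : κ → ι → ℤ) (k : ℤ) (N : ℕ) (F : (ι → ℂ) → ℂ)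
    (lam : ι → ℤ) : (κ → ℂ) → ℂ :=
  fun z => ((2 * Real.pi * Complex.I) ^ N)⁻¹ * ∑ n₁ ∈ Finset.range (N / 2 + 1),
    gegenbauerCoeff N (k + (1 - (Fintype.card ι : ℂ)) / 2) n₁ *
      (-quad S (ofInt ℂ lam)) ^ n₁ *
      ((laplacian (gramOf S b))^[n₁] (fun u : κ → ℂ =>
        iteratedDeriv (N - 2 * n₁) (fun w : ℂ => F (embed b u + w • ofInt ℂ lam)) 0)) z

/-- The group `(2m)⁻¹ ℤ`. -/
def fracInt (m : ℤ) : Set ℝ := {μ | ∃ n : ℤ, μ = n / (2 * m)}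

end

end HigherPullback

open HigherPullback

namespace HigherPullback

open Matrix Filter Topology

set_option linter.unusedSectionVars false

noncomputable section

/-! ### Holomorphic functions of several variables: parametric integrals and derivatives -/

section ComplexAnalysis

open MeasureTheory Metric Set

variable {E : Type*} [NormedAddCommGroup E] [NormedSpace ℂ E]

/-! A function `F` on the half-space is the same thing as a function on the isotropic cone of `Λ₁ ⊗
ℂ` that is homogeneous of degree `-k`; the slash operator then becomes composition with the matrix.
`amb` extends this function off the cone so that it does not depend on the first coordinate. Let `Δ`
be the Laplace operator of `L₁ = L ⊕ II₁,₁`. Its hyperbolic part involves the derivative in the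
first coordinate, so `G_N(∂_λ, mΔ)` acts on `amb F` as `G_N(∂_λ, mΔ_L)` acts on `F` (`gegOp_amb`).

An element `M` of `SO⁺(L₁)` extends to `Λ₁` by fixing `λ` (`extMat`), and the extension `M'`
commutes with `∂_λ` and `Δ`. However, `amb F ∘ M'` and `amb (F|M')` agree only on the cone. Their
difference is locally `QΨ` with `Ψ` homogeneous of degree `-k-2` (`exists_eq_mul_of_vanish`). The
heart of the proof is that the Gegenbauer operator annihilates `QΨ` at the points of the cone
orthogonal to `λ`. Indeed `Q`, `Δ` and the Euler operator satisfy `sl₂` relations, and after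
evaluation the sum telescopes by the recurrence of the Gegenbauer coefficients exactly when `s = k +
1 - dim(L₁)/2 = k + (1-ℓ)/2` (`eval_gegenbauer_q`). Consequently the pullback commutes with slash
operators (`slash_pullback`), and invariance under the modular group follows because `M'` lies in
that of `Λ`.

At a rational `M`, the function `F|M'` is periodic, hence has an absolutely convergent Fourier
expansion, and bounded growth forces every exponent `x` to pair nonnegatively with `P`, so `Q(x) ≥
0`. The pullback multiplies the coefficient at `x` by `G_N(⟨x,λ⟩, mQ(r))`, where `r` is the
projection of `x` to `L` and `Q(r) = Q(x) + ⟨x,λ⟩²/4m`. If `Q(r) > 0`, then `r` is in the open cone;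
otherwise both arguments vanish and `G_N(0,0) = 0` for `N ≥ 1`. This gives the support condition,
and dominated convergence gives the limits at the cusps.

The formula for the coefficients is the same computation with exponents `x = r - μλ`; then `Q(x) ≥
0` reads `mμ² ≤ Q(r)` and leaves finitely many `μ`. The scaling in `λ` is the weighted homogeneity
of `G_N`. -/

theorem norm_fderiv_le_of_norm_le {f : E → ℂ} {x : E} {r C : ℝ} (hr : 0 < r)
    (hd : DifferentiableOn ℂ f (ball x r)) (hC : ∀ y ∈ ball x r, ‖f y‖ ≤ C) :
    ‖fderiv ℂ f x‖ ≤ 2 * C / r := by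
  refine Complex.norm_fderiv_le_div_of_mapsTo_ball hd (fun y hy => ?_) hr
  rw [mem_closedBall, dist_eq_norm]
  calc ‖f y - f x‖ ≤ ‖f y‖ + ‖f x‖ := norm_sub_le _ _
    _ ≤ 2 * C := by linarith [hC y hy, hC x (mem_ball_self hr)]

/-- Parametric integrals of holomorphic functions over a compact set are holomorphic. -/
theorem differentiableOn_setIntegral [ProperSpace E] {α : Type*} [TopologicalSpace α]
    [SecondCountableTopology α] [MeasurableSpace α] [OpensMeasurableSpace α]
    (μ : Measure α) [IsFiniteMeasureOnCompacts μ]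
    {K : Set α} (hK : IsCompact K) (hKm : MeasurableSet K) {U : Set E} (hU : IsOpen U)
    {G : α → E → ℂ} (hc : ContinuousOn (fun p : α × E => G p.1 p.2) (K ×ˢ U))
    (hd : ∀ a ∈ K, DifferentiableOn ℂ (G a) U) :
    DifferentiableOn ℂ (fun x => ∫ a in K, G a x ∂μ) U := by
  intro x₀ hx₀
  refine DifferentiableAt.differentiableWithinAt ?_
  obtain ⟨r, hr, hrU⟩ := nhds_basis_closedBall.mem_iff.1 (hU.mem_nhds hx₀)
  have hcB : ContinuousOn (fun p : α × E => G p.1 p.2) (K ×ˢ closedBall x₀ r) :=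
    hc.mono (prod_mono le_rfl hrU)
  obtain ⟨C, hC⟩ := (hK.prod (isCompact_closedBall x₀ r)).exists_bound_of_continuousOn hcB
  have hdB : ∀ a ∈ K, DifferentiableOn ℂ (G a) (ball x₀ r) := fun a ha =>
    (hd a ha).mono (ball_subset_closedBall.trans hrU)
  have hμ : μ K < ⊤ := hK.measure_lt_top
  have : IsFiniteMeasure (μ.restrict K) := ⟨by simpa using hμ⟩
  have hmeas : ∀ x ∈ closedBall x₀ r, AEStronglyMeasurable (fun a => G a x) (μ.restrict K) := by
    intro x hx
    refine ContinuousOn.aestronglyMeasurable ?_ hKm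
    exact hcB.comp (f := fun a => (a, x)) (by fun_prop) (fun a ha => ⟨ha, hx⟩)
  -- Currying makes `a ↦ G a` continuous for the supremum norm on the closed ball, and the Cauchy
  -- estimate bounds the difference of two derivatives at `x₀` by `2/r` times that norm.
  have hF' : ContinuousOn (fun a => fderiv ℂ (G a) x₀) K := by
    have : CompactSpace K := isCompact_iff_compactSpace.1 hK
    have : CompactSpace (closedBall x₀ r) :=
      isCompact_iff_compactSpace.1 (isCompact_closedBall x₀ r)
    let g : C(K × closedBall x₀ r, ℂ) :=
      ⟨fun p => G p.1 p.2, by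
        have := continuousOn_iff_continuous_domRestrict.1 hcB
        exact this.comp (f := fun p : K × closedBall x₀ r =>
          (⟨(p.1, p.2), p.1.2, p.2.2⟩ : (K ×ˢ closedBall x₀ r : Set (α × E)))) (by fun_prop)⟩
    rw [continuousOn_iff_continuous_domRestrict, continuous_iff_continuousAt]
    intro a
    have hg := (g.curry.continuous.tendsto a)
    rw [tendsto_iff_norm_sub_tendsto_zero] at hg
    rw [ContinuousAt, tendsto_iff_norm_sub_tendsto_zero]
    have h2 := (hg.const_mul 2).div_const r
    simp only [mul_zero, zero_div] at h2
    refine squeeze_zero (fun _ => norm_nonneg _) (fun b => ?_) h2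
    have hxb : ball x₀ r ∈ 𝓝 x₀ := ball_mem_nhds _ hr
    simp only [domRestrict_apply]
    rw [← fderiv_fun_sub ((hdB b b.2).differentiableAt hxb) ((hdB a a.2).differentiableAt hxb)]
    refine norm_fderiv_le_of_norm_le hr ((hdB b b.2).sub (hdB a a.2)) (fun y hy => ?_)
    exact (g.curry b - g.curry a).norm_coe_le_norm ⟨y, ball_subset_closedBall hy⟩
  have hr2 : 0 < r / 2 := half_pos hr
  -- The Lipschitz constant is the Cauchy estimate on balls of radius `r / 2` around points of the
  -- half ball, which stay inside the ball of radius `r`.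
  refine (hasFDerivAt_integral_of_dominated_loc_of_lip' (F := fun x a => G a x)
    (F' := fun a => fderiv ℂ (G a) x₀)
    (bound := fun _ => 2 * C / (r / 2)) (s := ball x₀ (r / 2)) (ball_mem_nhds _ hr2)
    (fun x hx => hmeas x (ball_subset_closedBall (ball_subset_ball (by linarith) hx)))
    ?_ (hF'.aestronglyMeasurable_of_isCompact hK hKm) ?_ (integrable_const _) ?_).2.differentiableAt
  · refine Integrable.of_bound (hmeas x₀ (mem_closedBall_self hr.le)) C ?_
    filter_upwards [ae_restrict_mem hKm] with a ha
    exact hC (a, x₀) ⟨ha, mem_closedBall_self hr.le⟩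
  · filter_upwards [ae_restrict_mem hKm] with a ha x hx
    refine (convex_ball x₀ (r / 2)).norm_image_sub_le_of_norm_fderiv_le (𝕜 := ℂ)
      (fun y hy => (hdB a ha).differentiableAt (isOpen_ball.mem_nhds
        (ball_subset_ball (by linarith) hy))) (fun y hy => ?_) (mem_ball_self hr2) hx
    have hsub : ball y (r / 2) ⊆ ball x₀ r := ball_subset_ball' (by
      have := mem_ball.1 hy; linarith)
    exact norm_fderiv_le_of_norm_le hr2 ((hdB a ha).mono hsub)
      (fun w hw => hC (a, w) ⟨ha, ball_subset_closedBall (hsub hw)⟩)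
  · filter_upwards [ae_restrict_mem hKm] with a ha
    exact ((hdB a ha).differentiableAt (ball_mem_nhds _ hr)).hasFDerivAt

/-- Cauchy's formula on a circle in the complex line `x + ζ v` writes the directional derivative as
an integral, over a compact parameter set, of functions holomorphic in `x`. -/
theorem differentiableOn_fderiv_apply [ProperSpace E] {U : Set E} (hU : IsOpen U) {f : E → ℂ}
    (hf : DifferentiableOn ℂ f U) (v : E) : DifferentiableOn ℂ (fun x => fderiv ℂ f x v) U := by
  intro x₀ hx₀
  refine DifferentiableAt.differentiableWithinAt ?_
  obtain ⟨r, hr, hrU⟩ := nhds_basis_closedBall.mem_iff.1 (hU.mem_nhds hx₀)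
  -- The radius is small enough that the circle around any `x` in the half ball stays in the ball of
  -- radius `r`.
  obtain ⟨R, hR, hRv⟩ : ∃ R : ℝ, 0 < R ∧ R * ‖v‖ < r / 2 := by
    refine ⟨r / 2 / (‖v‖ + 1), by positivity, ?_⟩
    rw [div_mul_eq_mul_div, div_lt_iff₀ (by positivity)]
    nlinarith [norm_nonneg v]
  have hmem : ∀ x ∈ ball x₀ (r / 2), ∀ ζ ∈ closedBall (0 : ℂ) R, x + ζ • v ∈ U := by
    intro x hx ζ hζ
    refine hrU (mem_closedBall.2 ?_)
    rw [dist_eq_norm]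
    have h1 : ‖x - x₀‖ < r / 2 := by simpa [dist_eq_norm] using hx
    have h2 : ‖ζ‖ ≤ R := by simpa using hζ
    calc ‖x + ζ • v - x₀‖ = ‖(x - x₀) + ζ • v‖ := by congr 1; abel
      _ ≤ ‖x - x₀‖ + ‖ζ‖ * ‖v‖ := by rw [← norm_smul]; exact norm_add_le _ _
      _ ≤ r := by nlinarith [norm_nonneg v, mul_le_mul_of_nonneg_right h2 (norm_nonneg v)]
  have key : ∀ x ∈ ball x₀ (r / 2), fderiv ℂ f x v =
      ∫ θ in Icc 0 (2 * Real.pi), (2 * Real.pi * Complex.I : ℂ)⁻¹ *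
        (deriv (circleMap 0 R) θ * (((circleMap 0 R θ) ^ 2)⁻¹ * f (x + circleMap 0 R θ • v))) := by
    intro x hx
    have hdg : DifferentiableOn ℂ (fun ζ : ℂ => f (x + ζ • v)) (closedBall 0 R) :=
      hf.comp (by fun_prop) (fun ζ hζ => hmem x hx ζ hζ)
    have hxU : x ∈ U := by simpa using hmem x hx 0 (mem_closedBall_self hR.le)
    have h1 : deriv (fun ζ : ℂ => f (x + ζ • v)) 0 = fderiv ℂ f x v := by
      have h3 : HasFDerivAt f (fderiv ℂ f x) (x + (0 : ℂ) • v) := by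
        simpa using (hf.differentiableAt (hU.mem_nhds hxU)).hasFDerivAt
      have h4 : HasDerivAt (fun ζ : ℂ => x + ζ • v) v 0 := by
        simpa using ((hasDerivAt_id (0 : ℂ)).smul_const v).const_add x
      exact (h3.comp_hasDerivAt (0 : ℂ) h4).deriv
    have h5 := hdg.deriv_eq_smul_circleIntegral hR
    replace h5 := (eq_inv_smul_iff₀ Complex.two_pi_I_ne_zero).2 h5.symm
    rw [← h1, h5, circleIntegral,
      intervalIntegral.integral_of_le (by positivity), ← integral_Icc_eq_integral_Ioc,
      smul_eq_mul, ← integral_const_mul]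
    refine setIntegral_congr_fun measurableSet_Icc (fun θ _ => ?_)
    simp
  have hdiff : DifferentiableOn ℂ (fun x => ∫ θ in Icc 0 (2 * Real.pi),
      (2 * Real.pi * Complex.I : ℂ)⁻¹ * (deriv (circleMap 0 R) θ *
        (((circleMap 0 R θ) ^ 2)⁻¹ * f (x + circleMap 0 R θ • v)))) (ball x₀ (r / 2)) := by
    refine differentiableOn_setIntegral volume isCompact_Icc measurableSet_Icc isOpen_ball ?_ ?_
    · have hcm : Continuous fun p : ℝ × E => circleMap 0 R p.1 := by fun_prop
      refine continuousOn_const.mul (ContinuousOn.mul ?_ (ContinuousOn.mul ?_ ?_))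
      · simp only [deriv_circleMap]
        fun_prop
      · refine ContinuousOn.inv₀ (by fun_prop) (fun p _ => ?_)
        exact pow_ne_zero _ (circleMap_ne_center hR.ne')
      · refine hf.continuousOn.comp (f := fun p : ℝ × E => p.2 + circleMap 0 R p.1 • v)
          (by fun_prop) (fun p hp => hmem p.2 hp.2 _ ?_)
        simp [abs_of_pos hR]
    · intro θ _
      refine DifferentiableOn.const_mul (DifferentiableOn.const_mul
        (DifferentiableOn.const_mul ?_ _) _) _
      refine hf.comp (by fun_prop) (fun x hx => hmem x hx _ ?_)
      simp [abs_of_pos hR]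
  exact (hdiff.congr key).differentiableAt (ball_mem_nhds _ (half_pos hr))

end ComplexAnalysis

/-! ### The module of holomorphic functions and its operators -/

section HolomorphicFunctions

open TopologicalSpace

variable {E : Type*} [NormedAddCommGroup E] [NormedSpace ℂ E]

/-- The holomorphic functions on the open set `U`, extended by zero. -/
def hol (U : Opens E) : Submodule ℂ (E → ℂ) where
  carrier := {f | DifferentiableOn ℂ f U ∧ ∀ x ∉ U, f x = 0}
  add_mem' := fun hf hg => ⟨hf.1.add hg.1, fun x hx => by simp [hf.2 x hx, hg.2 x hx]⟩
  zero_mem' := ⟨differentiableOn_const 0, fun _ _ => rfl⟩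
  smul_mem' := fun c _ hf => ⟨hf.1.const_smul c, fun x hx => by simp [hf.2 x hx]⟩

variable {U : Opens E}

theorem differentiableAt_hol (f : hol U) {x : E} (hx : x ∈ U) : DifferentiableAt ℂ (f : E → ℂ) x :=
  f.2.1.differentiableAt (U.isOpen.mem_nhds hx)

theorem hol.ext_on {f g : hol U} (h : ∀ x ∈ U, (f : E → ℂ) x = (g : E → ℂ) x) : f = g := by
  refine Subtype.ext (funext fun x => ?_)
  by_cases hx : x ∈ U
  · exact h x hx
  · rw [f.2.2 x hx, g.2.2 x hx]

open Classical in
/-- A function that is holomorphic on `U`, as an element of `hol U`. -/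
def cut (U : Opens E) (f : E → ℂ) (hf : DifferentiableOn ℂ f U) : hol U :=
  ⟨fun x => if x ∈ U then f x else 0,
    hf.congr (fun _ hx => if_pos hx), fun _ hx => if_neg hx⟩

theorem cut_apply {f : E → ℂ} (hf : DifferentiableOn ℂ f U) {x : E} (hx : x ∈ U) :
    (cut U f hf : E → ℂ) x = f x := if_pos hx

theorem fderiv_congr_on {f g : E → ℂ} (h : ∀ x ∈ U, f x = g x) {x : E} (hx : x ∈ U) :
    fderiv ℂ f x = fderiv ℂ g x :=
  Filter.EventuallyEq.fderiv_eq (Filter.mem_of_superset (U.isOpen.mem_nhds hx) h)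

theorem fderiv_cut {f : E → ℂ} (hf : DifferentiableOn ℂ f U) {x : E} (hx : x ∈ U) :
    fderiv ℂ (cut U f hf : E → ℂ) x = fderiv ℂ f x :=
  fderiv_congr_on (fun _ hy => cut_apply hf hy) hx

/-- Multiplication of holomorphic functions. -/
def mulOp : hol U →ₗ[ℂ] Module.End ℂ (hol U) :=
  LinearMap.mk₂ ℂ (fun g f => ⟨fun x => (g : E → ℂ) x * (f : E → ℂ) x,
      g.2.1.mul f.2.1, fun x hx => by simp [f.2.2 x hx]⟩)
    (fun g₁ g₂ f => Subtype.ext (funext fun _ => add_mul _ _ _))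
    (fun c g f => Subtype.ext (funext fun _ => mul_assoc _ _ _))
    (fun g f₁ f₂ => Subtype.ext (funext fun _ => mul_add _ _ _))
    (fun c g f => Subtype.ext (funext fun _ => mul_left_comm _ _ _))

theorem mulOp_apply (g f : hol U) (x : E) :
    (mulOp g f : E → ℂ) x = (g : E → ℂ) x * (f : E → ℂ) x := rfl

theorem differentiableAt_clm_of_apply {F : Type*} [NormedAddCommGroup F] [NormedSpace ℂ F]
    [FiniteDimensional ℂ E] {f : F → E →L[ℂ] ℂ} {x : F}
    (h : ∀ w, DifferentiableAt ℂ (fun y => f y w) x) : DifferentiableAt ℂ f x := by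
  let n := Module.finrank ℂ E
  have hE : n = Module.finrank ℂ (Fin n → ℂ) := (Module.finrank_fin_fun ℂ).symm
  let e₁ := ContinuousLinearEquiv.ofFinrankEq hE
  let e₂ := (e₁.arrowCongr (1 : ℂ ≃L[ℂ] ℂ)).trans (ContinuousLinearEquiv.piRing (Fin n))
  rw [← Function.id_comp f, ← e₂.symm_comp_self]
  refine e₂.symm.differentiable.differentiableAt.comp x (differentiableAt_pi.2 fun i => h _)

variable [ProperSpace E]

/-- The directional derivatives of holomorphic functions on `U`. -/
def dd (U : Opens E) : E →ₗ[ℂ] Module.End ℂ (hol U) :=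
  LinearMap.mk₂ ℂ
    (fun v f => cut U (fun x => fderiv ℂ (f : E → ℂ) x v)
      (differentiableOn_fderiv_apply U.isOpen f.2.1 v))
    (fun v w f => hol.ext_on fun x hx => by
      simp [cut_apply _ hx])
    (fun c v f => hol.ext_on fun x hx => by
      simp [cut_apply _ hx])
    (fun v f g => hol.ext_on fun x hx => by
      simp [cut_apply _ hx, fderiv_add (differentiableAt_hol f hx) (differentiableAt_hol g hx)])
    (fun c v f => hol.ext_on fun x hx => by
      simp [cut_apply _ hx, fderiv_const_smul (differentiableAt_hol f hx)])

theorem dd_apply (v : E) (f : hol U) {x : E} (hx : x ∈ U) :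
    (dd U v f : E → ℂ) x = fderiv ℂ (f : E → ℂ) x v :=
  cut_apply (differentiableOn_fderiv_apply U.isOpen f.2.1 v) hx

theorem dd_mulOp (v : E) (g f : hol U) :
    dd U v (mulOp g f) = mulOp (dd U v g) f + mulOp g (dd U v f) := by
  refine hol.ext_on fun x hx => ?_
  have h : fderiv ℂ (mulOp g f : E → ℂ) x = _ :=
    fderiv_fun_mul (differentiableAt_hol g hx) (differentiableAt_hol f hx)
  simp only [dd_apply _ _ hx, Submodule.coe_add, Pi.add_apply, mulOp_apply]
  rw [h]
  simp
  ring

/-- Symmetry of the second derivative. It needs the full derivative to be differentiable, which in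
finite dimension follows from the differentiability of the directional derivatives. -/
theorem dd_comm [FiniteDimensional ℂ E] (v w : E) : dd U v * dd U w = dd U w * dd U v := by
  refine LinearMap.ext fun f => hol.ext_on fun x hx => ?_
  have hsnd : ∀ v w : E, (dd U v (dd U w f) : E → ℂ) x =
      fderiv ℂ (fun y => fderiv ℂ (f : E → ℂ) y) x v w := by
    intro v w
    have hd : DifferentiableAt ℂ (fun y => fderiv ℂ (f : E → ℂ) y) x := by
      have h1 : ∀ w, DifferentiableAt ℂ (fun y => fderiv ℂ (f : E → ℂ) y w) x := fun w =>
        (differentiableOn_fderiv_apply U.isOpen f.2.1 w).differentiableAt (U.isOpen.mem_nhds hx)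
      exact differentiableAt_clm_of_apply h1
    rw [dd_apply _ _ hx, fderiv_congr_on (fun y hy => dd_apply w f hy) hx,
      fderiv_clm_apply hd (differentiableAt_const w)]
    simp
  have hd : DifferentiableAt ℂ (fun y => fderiv ℂ (f : E → ℂ) y) x :=
    differentiableAt_clm_of_apply fun w =>
      (differentiableOn_fderiv_apply U.isOpen f.2.1 w).differentiableAt (U.isOpen.mem_nhds hx)
  simp only [Module.End.mul_apply, hsnd]
  exact second_derivative_symmetric_of_eventually (f := (f : E → ℂ))
    (Filter.mem_of_superset (U.isOpen.mem_nhds hx)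
      fun y hy => (differentiableAt_hol f hy).hasFDerivAt) hd.hasFDerivAt v w

end HolomorphicFunctions

/-! ### Commutator algebra and the vanishing of the Gegenbauer operator -/

section WeylRelations

variable {R : Type*} [Ring R] [Algebra ℂ R]

/-- Operators behaving like a quadratic form `q`, the partial derivatives `D i` along a
nondegenerate subspace with Gram matrix `g`, and the derivative `d` along an orthogonal vector of
norm `-m`. -/
structure WeylSystem {I : Type*} [Fintype I] [DecidableEq I] (g g' : Matrix I I ℂ) (m : ℂ)
    (D x : I → R) (d q t : R) : Prop where
  gram : g' * g = 1
  symm : gᵀ = g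
  symm' : g'ᵀ = g'
  D_comm : ∀ i j, D i * D j = D j * D i
  D_d : ∀ i, D i * d = d * D i
  D_q : ∀ i, D i * q = q * D i + x i
  D_x : ∀ i j, D i * x j = x j * D i + algebraMap ℂ R (g i j)
  D_t : ∀ i, D i * t = t * D i
  d_q : d * q = q * d + t
  d_t : d * t = t * d - algebraMap ℂ R (2 * m)
  d_x : ∀ i, d * x i = x i * d

variable {I : Type*} [Fintype I] [DecidableEq I]

/-- The Laplace operator attached to commuting derivations. -/
def lapl (g' : Matrix I I ℂ) (D : I → R) : R := (1 / 2 : ℂ) • ∑ i, ∑ j, g' i j • (D i * D j)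

/-- The Euler operator. -/
def euler (g' : Matrix I I ℂ) (D x : I → R) : R := ∑ i, ∑ j, g' i j • (x i * D j)

namespace WeylSystem

variable {g g' : Matrix I I ℂ} {m : ℂ} {D x : I → R} {d q t : R}

theorem lapl_comm_t (h : WeylSystem g g' m D x d q t) : lapl g' D * t = t * lapl g' D := by
  simp only [lapl, mul_smul_comm, smul_mul_assoc, Finset.mul_sum, Finset.sum_mul]
  congr 1
  refine Finset.sum_congr rfl fun i _ => Finset.sum_congr rfl fun j _ => ?_
  rw [mul_assoc, h.D_t, ← mul_assoc, h.D_t, mul_assoc]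

theorem euler_comm_d (h : WeylSystem g g' m D x d q t) :
    d * euler g' D x = euler g' D x * d := by
  simp only [euler, mul_smul_comm, smul_mul_assoc, Finset.mul_sum, Finset.sum_mul]
  refine Finset.sum_congr rfl fun i _ => Finset.sum_congr rfl fun j _ => ?_
  rw [← mul_assoc, h.d_x, mul_assoc, ← h.D_d, mul_assoc]

/-- Moving `D i * D j` past `q` produces `x i * D j + x j * D i + g i j`. Contracting with half the
symmetric inverse Gram matrix gives the Euler operator and half the trace of the identity. -/
theorem lapl_q (h : WeylSystem g g' m D x d q t) :
    lapl g' D * q = q * lapl g' D + euler g' D x +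
      algebraMap ℂ R ((Fintype.card I : ℂ) / 2) := by
  have h1 : ∀ i j, D i * D j * q = q * (D i * D j) + x i * D j + x j * D i +
      algebraMap ℂ R (g i j) := by
    intro i j
    rw [mul_assoc, h.D_q, mul_add, ← mul_assoc, h.D_q, h.D_x]
    noncomm_ring
  have h2 : ∑ i, ∑ j, g' i j • (x j * D i) = euler g' D x := by
    rw [Finset.sum_comm, euler]
    refine Finset.sum_congr rfl fun i _ => Finset.sum_congr rfl fun j _ => ?_
    rw [← congrFun (congrFun h.symm' i) j, transpose_apply]
  have h3 : ∑ i, ∑ j, g' i j • algebraMap ℂ R (g i j) = algebraMap ℂ R (Fintype.card I) := by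
    have h4 : ∑ i, ∑ j, g' i j * g i j = (Fintype.card I : ℂ) := by
      have h5 := congrArg trace h.gram
      rw [trace_one] at h5
      rw [← h5]
      simp only [trace, diag_apply, mul_apply]
      refine Finset.sum_congr rfl fun i _ => Finset.sum_congr rfl fun j _ => ?_
      rw [← congrFun (congrFun h.symm i) j, transpose_apply]
    rw [← h4]
    simp only [map_sum, Algebra.smul_def, map_mul]
  calc lapl g' D * q = (1 / 2 : ℂ) • ∑ i, ∑ j, g' i j • (D i * D j * q) := by
        simp only [lapl, smul_mul_assoc, Finset.sum_mul]
    _ = (1 / 2 : ℂ) • ((∑ i, ∑ j, g' i j • (q * (D i * D j))) + euler g' D x + euler g' D x +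
          algebraMap ℂ R (Fintype.card I)) := by
        rw [← h3]
        nth_rw 2 [← h2]
        simp only [h1, smul_add, Finset.sum_add_distrib, euler]
    _ = _ := by
        simp only [lapl, mul_smul_comm, Finset.mul_sum, smul_add]
        simp only [Algebra.algebraMap_eq_smul_one]
        module

theorem D_euler (h : WeylSystem g g' m D x d q t) (k : I) :
    D k * euler g' D x = euler g' D x * D k + D k := by
  have h1 : ∀ i j, D k * (x i * D j) = x i * D j * D k + g k i • D j := by
    intro i j
    rw [← mul_assoc, h.D_x, add_mul, mul_assoc, h.D_comm, mul_assoc, ← Algebra.smul_def]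
  have h2 : ∑ i, ∑ j, g' i j • g k i • D j = D k := by
    rw [Finset.sum_comm]
    have h3 : ∀ j, ∑ i, g' i j • g k i • D j = (1 : Matrix I I ℂ) k j • D j := by
      intro j
      rw [← mul_eq_one_comm.1 h.gram, mul_apply, Finset.sum_smul]
      exact Finset.sum_congr rfl fun i _ => by rw [smul_smul, mul_comm]
    simp [h3, one_apply]
  calc D k * euler g' D x = ∑ i, ∑ j, g' i j • (D k * (x i * D j)) := by
        simp only [euler, mul_smul_comm, Finset.mul_sum]
    _ = _ := by
        simp only [h1, smul_add, Finset.sum_add_distrib, h2, euler, smul_mul_assoc, Finset.sum_mul]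

/-- The Laplace operator lowers degrees by two. -/
theorem lapl_euler (h : WeylSystem g g' m D x d q t) :
    lapl g' D * euler g' D x = euler g' D x * lapl g' D + (2 : ℂ) • lapl g' D := by
  have h1 : ∀ i j, D i * D j * euler g' D x =
      euler g' D x * (D i * D j) + (2 : ℂ) • (D i * D j) := by
    intro i j
    rw [mul_assoc, h.D_euler, mul_add, ← mul_assoc, h.D_euler, two_smul]
    noncomm_ring
  calc lapl g' D * euler g' D x
      = (1 / 2 : ℂ) • ∑ i, ∑ j, g' i j • (D i * D j * euler g' D x) := by
        simp only [lapl, smul_mul_assoc, Finset.sum_mul]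
    _ = _ := by
        simp only [h1, smul_add, Finset.sum_add_distrib, lapl, mul_smul_comm, Finset.mul_sum,
          Finset.smul_sum, smul_comm (2 : ℂ)]

/-- This is the `sl₂` relation. Moving `E + n/2` to the right past a power of the Laplace operator
shifts it by an even integer; over the `j + 1` positions the shifts average to `-j`. -/
theorem lapl_pow_q (h : WeylSystem g g' m D x d q t) (j : ℕ) :
    lapl g' D ^ (j + 1) * q = q * lapl g' D ^ (j + 1) + ((j : ℂ) + 1) • (lapl g' D ^ j *
      (euler g' D x + algebraMap ℂ R ((Fintype.card I : ℂ) / 2 - j))) := by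
  induction j with
  | zero => simp [h.lapl_q, add_assoc]
  | succ j ih =>
    have hE : euler g' D x * lapl g' D = lapl g' D * euler g' D x - (2 : ℂ) • lapl g' D := by
      rw [h.lapl_euler]; abel
    rw [pow_succ _ (j + 1), mul_assoc, h.lapl_q, mul_add, mul_add, ← mul_assoc, ih]
    rw [add_mul, smul_mul_assoc, mul_assoc (lapl g' D ^ j), add_mul (euler g' D x), hE]
    simp only [Algebra.algebraMap_eq_smul_one, pow_succ, mul_add, mul_sub, smul_mul_assoc,
      mul_smul_comm, one_mul, mul_one, mul_assoc]
    push_cast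
    module

theorem d_pow_t (h : WeylSystem g g' m D x d q t) (p : ℕ) :
    d ^ p * t * d = t * d ^ (p + 1) - (2 * m * p : ℂ) • d ^ p := by
  induction p with
  | zero => simp
  | succ p ih =>
    have h1 : d ^ (p + 1) * t * d = d * (d ^ p * t * d) := by rw [pow_succ']; noncomm_ring
    rw [h1, ih, mul_sub, ← mul_assoc, h.d_t, sub_mul, mul_smul_comm, mul_assoc, ← pow_succ',
      ← pow_succ', ← Algebra.smul_def]
    push_cast
    module

/-- Leibniz's rule stops at second order: the first derivative of `q` is `t`, the second is the
constant `-2m`, and the third vanishes. -/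
theorem d_pow_q (h : WeylSystem g g' m D x d q t) (p : ℕ) :
    d ^ (p + 2) * q = q * d ^ (p + 2) + ((p : ℂ) + 2) • (t * d ^ (p + 1)) -
      (m * (p + 2) * (p + 1) : ℂ) • d ^ p := by
  induction p with
  | zero =>
    rw [pow_two, mul_assoc, h.d_q, mul_add, ← mul_assoc, h.d_q, h.d_t,
      Algebra.algebraMap_eq_smul_one, add_mul, pow_zero, zero_add, pow_one, mul_assoc]
    push_cast
    module
  | succ p ih =>
    rw [pow_succ' d (p + 2), mul_assoc, ih, mul_sub, mul_add, mul_smul_comm, mul_smul_comm,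
      ← mul_assoc, ← mul_assoc, h.d_q, h.d_t, Algebra.algebraMap_eq_smul_one]
    simp only [add_mul, sub_mul, smul_mul_assoc, one_mul, mul_assoc, ← pow_succ']
    push_cast
    module

variable {M : Type*} [AddCommGroup M] [Module ℂ M] {D x : I → Module.End ℂ M}
  {d q t : Module.End ℂ M}

/-- The operators `Δ ^ j d ^ p` applied to a multiple `q Ψ`, for a homogeneous element `Ψ`, modulo
the multiples of `q` and `t`. -/
theorem eval_lapl_pow_d_pow_q (h : WeylSystem g g' m D x d q t) {ev : M →ₗ[ℂ] ℂ}
    (hq : ∀ f, ev (q f) = 0) (ht : ∀ f, ev (t f) = 0) (hm : m ≠ 0) {c : ℂ} {Ψ : M}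
    (hΨ : euler g' D x Ψ = c • Ψ + (1 / (2 * m)) • t (d Ψ)) (j p : ℕ) :
    ev ((lapl g' D ^ j * d ^ p) (q Ψ)) =
      j * (c - p + Fintype.card I / 2 - (j - 1)) * ev ((lapl g' D ^ (j - 1) * d ^ p) Ψ) -
        m * p * (p - 1) * ev ((lapl g' D ^ j * d ^ (p - 2)) Ψ) := by
  have hLt : ∀ j : ℕ, lapl g' D ^ j * t = t * lapl g' D ^ j := fun j =>
    ((show Commute (lapl g' D) t from h.lapl_comm_t).pow_left j)
  have hdE : ∀ p : ℕ, d ^ p * euler g' D x = euler g' D x * d ^ p := fun p =>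
    ((show Commute d (euler g' D x) from h.euler_comm_d).pow_left p)
  have hevt : ∀ (j : ℕ) (f : M), ev ((lapl g' D ^ j) (t f)) = 0 := by
    intro j f
    rw [← Module.End.mul_apply, hLt, Module.End.mul_apply, ht]
  have hE : ∀ j p : ℕ, ev ((lapl g' D ^ j) (euler g' D x ((d ^ p) Ψ))) =
      (c - p) * ev ((lapl g' D ^ j) ((d ^ p) Ψ)) := by
    intro j p
    have h1 : (d ^ p) (t (d Ψ)) = t ((d ^ (p + 1)) Ψ) - (2 * m * p : ℂ) • (d ^ p) Ψ := by
      have := LinearMap.congr_fun (h.d_pow_t p) Ψ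
      simpa [Module.End.mul_apply, LinearMap.sub_apply] using this
    -- Homogeneity of `Ψ` is transported to its `p`-th derivative: the term with `t` would vanish
    -- under `ev`, but moving `d ^ p` past `t` leaves `-2mp`, which lowers the degree from `c` to `c
    -- - p`.
    rw [← Module.End.mul_apply (euler g' D x), ← hdE, Module.End.mul_apply, hΨ, map_add, map_smul,
      map_smul, h1]
    simp only [map_add, map_smul, map_sub, hevt, smul_eq_mul]
    field_simp
    ring
  have hL : ∀ j p : ℕ, ev ((lapl g' D ^ j) (q ((d ^ p) Ψ))) =
      j * (c - p + Fintype.card I / 2 - (j - 1)) * ev ((lapl g' D ^ (j - 1)) ((d ^ p) Ψ)) := by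
    intro j p
    cases j with
    | zero => simp [hq]
    | succ j =>
      have h1 := LinearMap.congr_fun (h.lapl_pow_q j) ((d ^ p) Ψ)
      rw [Module.End.mul_apply] at h1
      rw [h1]
      simp only [LinearMap.add_apply, Module.End.mul_apply, LinearMap.smul_apply, map_add, hq,
        map_smul, hE, smul_eq_mul, Module.algebraMap_end_apply, Nat.add_sub_cancel]
      push_cast
      ring
  -- The exponent `p - 2` is truncated; for `p = 0, 1` the factor `p (p - 1)` vanishes, and these
  -- cases are treated apart.
  rcases p with _ | _ | p
  · simpa using hL j 0
  · have h1 : (lapl g' D ^ j * d ^ 1) (q Ψ) = (lapl g' D ^ j) (q (d Ψ)) +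
        (lapl g' D ^ j) (t Ψ) := by
      rw [pow_one, Module.End.mul_apply, ← Module.End.mul_apply d, h.d_q]
      simp
    have h2 := hL j 1
    simp only [pow_one] at h2
    rw [zero_add, h1, map_add, hevt, h2, Module.End.mul_apply, pow_one]
    push_cast
    ring
  · have h1 := LinearMap.congr_fun (h.d_pow_q p) Ψ
    rw [Module.End.mul_apply] at h1
    rw [Module.End.mul_apply, h1]
    simp only [LinearMap.add_apply, LinearMap.sub_apply, Module.End.mul_apply,
      LinearMap.smul_apply, map_add, map_sub, map_smul, hevt, hL, smul_eq_mul]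
    rw [show p + 1 + 1 - 2 = p from rfl]
    push_cast
    ring

/-- Passing from `j` to `j + 1` removes the top factor `s + N - (j + 1)` of the Pochhammer product
and the two top factors of `(N - 2j)!`. This recurrence is what makes the sum in `eval_gegenbauer_q`
telescope. -/
theorem gegenbauerCoeff_succ (N j : ℕ) (hj : j + 1 ≤ N / 2) (s : ℂ) :
    gegenbauerCoeff N s (j + 1) * (j + 1) * (s + N - (j + 1)) =
      -(gegenbauerCoeff N s j * ((N - 2 * j : ℕ) : ℂ) * (((N - 2 * j : ℕ) : ℂ) - 1)) := by
  obtain ⟨a, ha⟩ : ∃ a, N = 2 * j + 2 + a := ⟨N - (2 * j + 2), by omega⟩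
  have h1 : N - 2 * (j + 1) = a := by omega
  have h2 : N - 2 * j = a + 2 := by omega
  have h3 : N / 2 - j = (N / 2 - (j + 1)) + 1 := by omega
  have h4 : (((N + 1) / 2 : ℕ) : ℂ) + ((N / 2 - (j + 1) : ℕ) : ℂ) = N - (j + 1) := by
    have : (N + 1) / 2 + (N / 2 - (j + 1)) + (j + 1) = N := by omega
    have h5 : ((((N + 1) / 2 + (N / 2 - (j + 1)) + (j + 1) : ℕ)) : ℂ) = N := by rw [this]
    push_cast at h5 ⊢
    linear_combination h5
  have hj1 : (j : ℂ) + 1 ≠ 0 := by exact_mod_cast Nat.succ_ne_zero j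
  have ha1 : (a : ℂ) + 1 ≠ 0 := by exact_mod_cast Nat.succ_ne_zero a
  have ha2 : (a : ℂ) + 1 + 1 ≠ 0 := by exact_mod_cast Nat.succ_ne_zero (a + 1)
  have hjf : (j.factorial : ℂ) ≠ 0 := by exact_mod_cast j.factorial_ne_zero
  have haf : (a.factorial : ℂ) ≠ 0 := by exact_mod_cast a.factorial_ne_zero
  simp only [gegenbauerCoeff, h1, h2, h3, ascPochhammer_succ_eval, Nat.factorial_succ]
  have h6 : s + N - (j + 1) = s + (((N + 1) / 2 : ℕ) : ℂ) + ((N / 2 - (j + 1) : ℕ) : ℂ) := by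
    rw [add_assoc, h4]; ring
  rw [h6]
  push_cast
  field_simp
  ring

/-- The Gegenbauer operator annihilates homogeneous multiples of `q`. -/
theorem eval_gegenbauer_q (h : WeylSystem g g' m D x d q t) {ev : M →ₗ[ℂ] ℂ}
    (hq : ∀ f, ev (q f) = 0) (ht : ∀ f, ev (t f) = 0) (hm : m ≠ 0) {k s : ℂ} {Ψ : M}
    (hΨ : euler g' D x Ψ = (-k - 2) • Ψ + (1 / (2 * m)) • t (d Ψ))
    (hs : s = k + 1 - Fintype.card I / 2) (N : ℕ) :
    ∑ j ∈ Finset.range (N / 2 + 1), gegenbauerCoeff N s j * m ^ j *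
      ev ((lapl g' D ^ j * d ^ (N - 2 * j)) (q Ψ)) = 0 := by
  simp only [h.eval_lapl_pow_d_pow_q hq ht hm hΨ, mul_sub (gegenbauerCoeff _ _ _ * _),
    Finset.sum_sub_distrib]
  -- The first sum carries a factor `j`, so its first term drops; the second carries `p (p - 1)`
  -- with `p = N - 2j`, so its last term drops. What remains matches after shifting the index by
  -- one.
  rw [sub_eq_zero, Finset.sum_range_succ', Finset.sum_range_succ]
  have h0 : m * ((N - 2 * (N / 2) : ℕ) : ℂ) * (((N - 2 * (N / 2) : ℕ) : ℂ) - 1) = 0 := by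
    have : N - 2 * (N / 2) = 0 ∨ N - 2 * (N / 2) = 1 := by omega
    rcases this with h | h <;> simp [h]
  rw [h0]
  simp only [Nat.cast_zero, zero_mul, mul_zero, add_zero]
  refine Finset.sum_congr rfl fun j hj => ?_
  have hj' : j + 1 ≤ N / 2 := by simpa using hj
  have h1 := gegenbauerCoeff_succ N j hj' s
  have h2 : ((N - 2 * (j + 1) : ℕ) : ℂ) = N - 2 * (j + 1) := by
    rw [Nat.cast_sub (by omega)]; push_cast; ring
  have h3 : N - 2 * j - 2 = N - 2 * (j + 1) := by omega
  rw [h3, Nat.add_sub_cancel, h2]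
  -- Here the degree `-k - 2` and the value of `s` combine to the factor of the recurrence.
  have h4 : (-k - 2 - (N - 2 * ((j : ℂ) + 1)) + Fintype.card I / 2 - (((j + 1 : ℕ) : ℂ) - 1)) =
      -(s + N - (j + 1)) := by
    rw [hs]; push_cast; ring
  rw [h4]
  push_cast
  linear_combination (-m ^ (j + 1) * ev ((lapl g' D ^ j * d ^ (N - 2 * (j + 1))) Ψ)) * h1

end WeylSystem

end WeylRelations

/-! ### Division by a quadratic form -/

section Division

open MeasureTheory Metric Set

variable {E : Type*} [NormedAddCommGroup E] [NormedSpace ℂ E]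

/-- A holomorphic function that vanishes where `Q` does is locally a multiple of `Q`, if `Q` is
affine and not constant along some direction. -/
theorem exists_eq_mul_of_vanish [ProperSpace E] {W₀ : Set E} (hW₀ : IsOpen W₀) {h : E → ℂ}
    (hd : DifferentiableOn ℂ h W₀) {Q τ : E → ℂ} (hQ : Differentiable ℂ Q)
    (hτ : Differentiable ℂ τ) {e : E} (hlin : ∀ X (c : ℂ), Q (X + c • e) = Q X + c * τ X)
    {X₀ : E} (hX₀ : X₀ ∈ W₀) (hτ₀ : τ X₀ ≠ 0) (hQ₀ : Q X₀ = 0)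
    (hv : ∀ X ∈ W₀, Q X = 0 → h X = 0) :
    ∃ W : TopologicalSpace.Opens E, X₀ ∈ W ∧ (W : Set E) ⊆ W₀ ∧ (∀ X ∈ W, τ X ≠ 0) ∧
      ∃ Ψ : hol W, ∀ X ∈ W, h X = Q X * (Ψ : E → ℂ) X := by
  -- The segment along `e` from the point of the hypersurface `Q = 0` on the line through `X` (at
  -- time `0`) to `X` itself (at time `1`).
  let π : ℝ × E → E := fun p => p.2 - ((1 - (p.1 : ℂ)) * (Q p.2 / τ p.2)) • e
  let T : Set E := {X | τ X ≠ 0}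
  have hT : IsOpen T := isOpen_ne_fun hτ.continuous continuous_const
  have hπ : ContinuousOn π (univ ×ˢ T) := by
    have h1 : ContinuousOn (fun p : ℝ × E => Q p.2 / τ p.2) (univ ×ˢ T) :=
      ContinuousOn.div (hQ.continuous.comp continuous_snd).continuousOn
        (hτ.continuous.comp continuous_snd).continuousOn (fun p hp => hp.2)
    have h2 : Continuous fun p : ℝ × E => 1 - (p.1 : ℂ) := by fun_prop
    exact continuous_snd.continuousOn.sub ((h2.continuousOn.mul h1).smul continuousOn_const)
  have hopen : IsOpen ((univ ×ˢ T) ∩ π ⁻¹' W₀) :=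
    hπ.isOpen_inter_preimage (isOpen_univ.prod hT) hW₀
  have hsub : Icc (0 : ℝ) 1 ×ˢ {X₀} ⊆ (univ ×ˢ T) ∩ π ⁻¹' W₀ := by
    rintro ⟨s, X⟩ ⟨-, hX⟩
    obtain rfl : X = X₀ := hX
    exact ⟨⟨trivial, hτ₀⟩, by simpa [π, hQ₀] using hX₀⟩
  -- For `X₀` the segment is constant because `Q X₀ = 0`, so the tube lemma gives a neighbourhood on
  -- which all segments remain in `W₀`.
  obtain ⟨A, B, hA, hB, hIA, hXB, hAB⟩ :=
    generalized_tube_lemma isCompact_Icc isCompact_singleton hopen hsub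
  let W : TopologicalSpace.Opens E := ⟨B ∩ W₀, hB.inter hW₀⟩
  have hWT : ∀ X ∈ W, τ X ≠ 0 := fun X hX =>
    (hAB (show ((0 : ℝ), X) ∈ A ×ˢ B from ⟨hIA ⟨le_rfl, zero_le_one⟩, hX.1⟩)).1.2
  have hπW : ∀ s ∈ Icc (0 : ℝ) 1, ∀ X ∈ W, π (s, X) ∈ W₀ := fun s hs X hX =>
    (hAB (show (s, X) ∈ A ×ˢ B from ⟨hIA hs, hX.1⟩)).2
  have hdh := differentiableOn_fderiv_apply hW₀ hd e
  have hcont : ContinuousOn (fun p : ℝ × E => fderiv ℂ h (π p) e) (Icc 0 1 ×ˢ (W : Set E)) :=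
    hdh.continuousOn.comp (hπ.mono (prod_mono (subset_univ _) hWT))
      (fun p hp => hπW p.1 hp.1 p.2 hp.2)
  have hint : DifferentiableOn ℂ (fun X => ∫ s in Icc (0 : ℝ) 1, fderiv ℂ h (π (s, X)) e)
      (W : Set E) := by
    refine differentiableOn_setIntegral volume isCompact_Icc measurableSet_Icc W.isOpen hcont ?_
    intro s hs
    refine hdh.comp ?_ (fun X hX => hπW s hs X hX)
    have h1 : DifferentiableOn ℂ (fun X => Q X / τ X) (W : Set E) :=
      (hQ.differentiableOn.mul (hτ.differentiableOn.inv hWT)).congr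
        fun X _ => div_eq_mul_inv _ _
    exact differentiableOn_id.sub ((h1.const_mul (1 - (s : ℂ))).smul_const e)
  refine ⟨W, ⟨hXB rfl, hX₀⟩, inter_subset_right, hWT,
    cut W (fun X => (τ X)⁻¹ * ∫ s in Icc (0 : ℝ) 1, fderiv ℂ h (π (s, X)) e)
      ((hτ.differentiableOn.inv hWT).mul hint), fun X hX => ?_⟩
  rw [cut_apply _ hX]
  have hτX := hWT X hX
  have hderiv : ∀ s ∈ uIcc (0 : ℝ) 1, HasDerivAt (fun s : ℝ => h (π (s, X)))
      ((Q X / τ X) * fderiv ℂ h (π (s, X)) e) s := by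
    intro s hs
    rw [uIcc_of_le zero_le_one] at hs
    have h1 : HasFDerivAt h (fderiv ℂ h (π (s, X))) (π (s, X)) :=
      (hd.differentiableAt (hW₀.mem_nhds (hπW s hs X hX))).hasFDerivAt
    have h2 : HasDerivAt (fun s : ℝ => π (s, X)) ((Q X / τ X) • e) s := by
      have h3 : HasDerivAt (fun s : ℝ => (1 - (s : ℂ)) * (Q X / τ X)) (-1 * (Q X / τ X)) s :=
        ((Complex.ofRealCLM.hasDerivAt (x := s)).const_sub 1).mul_const _
      have h4 := (h3.smul_const e).const_sub X
      convert! h4 using 1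
      rw [neg_one_mul, neg_smul, neg_neg]
    have h5 := (h1.restrictScalars ℝ).comp_hasDerivAt s h2
    convert! h5 using 1
    simp
  have hci : ContinuousOn (fun s : ℝ => fderiv ℂ h (π (s, X)) e) (Icc 0 1) :=
    hcont.comp (f := fun s => (s, X)) (by fun_prop) (fun s hs => ⟨hs, hX⟩)
  -- Since `h` vanishes at the foot of the segment, `h X` equals `Q X / τ X` times the integral of
  -- the derivative of `h` along `e`; the remaining factor is the quotient.
  have hFTC := intervalIntegral.integral_eq_sub_of_hasDerivAt hderiv
    ((ContinuousOn.mul continuousOn_const hci).intervalIntegrable_of_Icc zero_le_one)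
  have hπ1 : π (1, X) = X := by simp [π]
  have hπ0 : h (π (0, X)) = 0 := by
    refine hv _ (hπW 0 ⟨le_rfl, zero_le_one⟩ X hX) ?_
    have : π (0, X) = X + (-(Q X / τ X)) • e := by
      simp only [π, Complex.ofReal_zero, sub_zero, one_mul, neg_smul]
      exact sub_eq_add_neg _ _
    rw [this, hlin]
    field_simp
    ring
  rw [hπ1, hπ0, sub_zero] at hFTC
  rw [← hFTC, intervalIntegral.integral_const_mul, integral_Icc_eq_integral_Ioc,
    ← intervalIntegral.integral_of_le zero_le_one]
  ring

end Division

/-! ### Operators commuting with restriction and linear substitution -/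

section Intertwiners

variable {M M' : Type*} [AddCommGroup M] [Module ℂ M] [AddCommGroup M'] [Module ℂ M']

theorem intertwine_pow {T : M →ₗ[ℂ] M'} {A : Module.End ℂ M} {A' : Module.End ℂ M'}
    (h : ∀ f, T (A f) = A' (T f)) (n : ℕ) (f : M) : T ((A ^ n) f) = (A' ^ n) (T f) := by
  induction n generalizing f with
  | zero => rfl
  | succ n ih => rw [pow_succ, pow_succ, Module.End.mul_apply, Module.End.mul_apply, ih, h]

/-- The Gegenbauer polynomial in the operators `d` and `m L`. -/
def gegOp (N : ℕ) (s m : ℂ) (L d : Module.End ℂ M) : Module.End ℂ M :=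
  ∑ j ∈ Finset.range (N / 2 + 1), (gegenbauerCoeff N s j * m ^ j) • (L ^ j * d ^ (N - 2 * j))

theorem gegOp_apply (N : ℕ) (s m : ℂ) (L d : Module.End ℂ M) (f : M) :
    gegOp N s m L d f = ∑ j ∈ Finset.range (N / 2 + 1),
      (gegenbauerCoeff N s j * m ^ j) • (L ^ j) ((d ^ (N - 2 * j)) f) := by
  simp [gegOp, LinearMap.sum_apply]

theorem intertwine_gegOp {T : M →ₗ[ℂ] M'} {L d : Module.End ℂ M} {L' d' : Module.End ℂ M'}
    (hL : ∀ f, T (L f) = L' (T f)) (hd : ∀ f, T (d f) = d' (T f)) (N : ℕ) (s m : ℂ) (f : M) :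
    T (gegOp N s m L d f) = gegOp N s m L' d' (T f) := by
  simp only [gegOp_apply, map_sum, map_smul, intertwine_pow hL, intertwine_pow hd]

theorem lapl_apply {I : Type*} [Fintype I] (g' : Matrix I I ℂ) (D : I → Module.End ℂ M) (f : M) :
    lapl g' D f = (1 / 2 : ℂ) • ∑ i, ∑ j, g' i j • D i (D j f) := by
  simp [lapl, LinearMap.sum_apply]

theorem intertwine_lapl {I : Type*} [Fintype I] {T : M →ₗ[ℂ] M'} {g' : Matrix I I ℂ}
    {D : I → Module.End ℂ M} {D' : I → Module.End ℂ M'} (h : ∀ i f, T (D i f) = D' i (T f))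
    (f : M) : T (lapl g' D f) = lapl g' D' (T f) := by
  simp only [lapl_apply, map_sum, map_smul, h]

open TopologicalSpace

variable {E : Type*} [NormedAddCommGroup E] [NormedSpace ℂ E] [ProperSpace E]

/-- Evaluation at a point. -/
def evalAt {U : Opens E} (x : E) : hol U →ₗ[ℂ] ℂ :=
  (LinearMap.proj x : (E → ℂ) →ₗ[ℂ] ℂ) ∘ₗ (hol U).subtype

theorem evalAt_apply {U : Opens E} (x : E) (f : hol U) : evalAt x f = (f : E → ℂ) x := rfl

/-- Composition with a linear map, restricted to a smaller open set. -/
def compOn {U W : Opens E} (A : E →L[ℂ] E) (h : ∀ x ∈ W, A x ∈ U) : hol U →ₗ[ℂ] hol W where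
  toFun f := cut W (fun x => (f : E → ℂ) (A x))
    (f.2.1.comp A.differentiable.differentiableOn h)
  map_add' f g := hol.ext_on fun x hx => by simp [cut_apply _ hx]
  map_smul' c f := hol.ext_on fun x hx => by simp [cut_apply _ hx]

theorem compOn_apply {U W : Opens E} (A : E →L[ℂ] E) (h : ∀ x ∈ W, A x ∈ U) (f : hol U) {x : E}
    (hx : x ∈ W) : (compOn A h f : E → ℂ) x = (f : E → ℂ) (A x) :=
  cut_apply (f.2.1.comp A.differentiable.differentiableOn h) hx

theorem dd_compOn {U W : Opens E} (A : E →L[ℂ] E) (h : ∀ x ∈ W, A x ∈ U) (v : E) (f : hol U) :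
    dd W v (compOn A h f) = compOn A h (dd U (A v) f) := by
  refine hol.ext_on fun x hx => ?_
  rw [dd_apply _ _ hx, compOn_apply A h _ hx, dd_apply _ _ (h x hx),
    fderiv_congr_on (fun y hy => compOn_apply A h f hy) hx]
  have := ((differentiableAt_hol f (h x hx)).hasFDerivAt.comp x A.hasFDerivAt).fderiv
  rw [Function.comp_def] at this
  rw [this]
  rfl

/-- Invariance of the Laplace operator. -/
theorem lapl_compOn {I : Type*} [Fintype I] {U W : Opens E} (A : E →L[ℂ] E)
    (h : ∀ x ∈ W, A x ∈ U) {b : I → E} {Mx g' : Matrix I I ℂ}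
    (hA : ∀ i, A (b i) = ∑ k, Mx k i • b k) (hM : Mx * g' * Mxᵀ = g') (f : hol U) :
    lapl g' (fun i => dd W (b i)) (compOn A h f) =
      compOn A h (lapl g' (fun i => dd U (b i)) f) := by
  have h1 : ∀ i j, dd U (A (b i)) (dd U (A (b j)) f) =
      ∑ k, ∑ l, (Mx k i * Mx l j) • dd U (b k) (dd U (b l) f) := by
    intro i j
    simp only [hA, map_sum, map_smul, LinearMap.sum_apply, LinearMap.smul_apply, Finset.smul_sum,
      smul_smul]
    rw [Finset.sum_comm]
    simp only [mul_comm]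
  have h2 : ∑ i, ∑ j, g' i j • dd U (A (b i)) (dd U (A (b j)) f) =
      ∑ k, ∑ l, g' k l • dd U (b k) (dd U (b l) f) := by
    simp only [h1, Finset.smul_sum, smul_smul]
    calc _ = ∑ k, ∑ l, ∑ i, ∑ j,
          (g' i j * (Mx k i * Mx l j)) • dd U (b k) (dd U (b l) f) := by
          rw [Finset.sum_congr rfl fun i _ => Finset.sum_comm]
          rw [Finset.sum_comm]
          refine Finset.sum_congr rfl fun k _ => ?_
          rw [Finset.sum_congr rfl fun i _ => Finset.sum_comm]
          rw [Finset.sum_comm]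
      _ = _ := by
          refine Finset.sum_congr rfl fun k _ => Finset.sum_congr rfl fun l _ => ?_
          rw [← congrFun (congrFun hM k) l]
          simp only [mul_apply, transpose_apply, ← Finset.sum_smul, Finset.sum_mul]
          congr 1
          rw [Finset.sum_comm]
          refine Finset.sum_congr rfl fun i _ => Finset.sum_congr rfl fun j _ => ?_
          ring
  simp only [lapl_apply, dd_compOn, ← h2, map_smul, map_sum]

end Intertwiners

/-! ### The Gegenbauer operator on functions vanishing on the isotropic cone -/

section QuadraticCone

open TopologicalSpace

variable {E : Type*} [NormedAddCommGroup E] [NormedSpace ℂ E] [FiniteDimensional ℂ E]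

theorem hasFDerivAt_quadratic (B : E →L[ℂ] E →L[ℂ] ℂ) (hB : ∀ x y, B x y = B y x) (x : E) :
    HasFDerivAt (fun x => B x x / 2) (B x) x := by
  have h1 : HasFDerivAt (fun x => B x x) _ x :=
    B.hasFDerivAt_of_bilinear (hasFDerivAt_id x) (hasFDerivAt_id x)
  have h2 := h1.mul_const (2⁻¹ : ℂ)
  simp only [div_eq_mul_inv]
  convert! h2 using 1
  ext v
  simp [hB v x]
  ring

theorem differentiable_quadratic (B : E →L[ℂ] E →L[ℂ] ℂ) (hB : ∀ x y, B x y = B y x) :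
    Differentiable ℂ (fun x => B x x / 2) :=
  fun x => (hasFDerivAt_quadratic B hB x).differentiableAt

variable [ProperSpace E]

/-- Derivatives along a nondegenerate subspace and its orthogonal complement form a
`WeylSystem`. -/
theorem weylSystem_hol {I : Type*} [Fintype I] [DecidableEq I] (W : Opens E)
    (B : E →L[ℂ] E →L[ℂ] ℂ) (hB : ∀ x y, B x y = B y x) {b : I → E} {v : E} {m : ℂ}
    {g g' : Matrix I I ℂ} (hg : ∀ i j, B (b i) (b j) = g i j) (hg' : g' * g = 1)
    (hsymm' : g'ᵀ = g') (hbv : ∀ i, B (b i) v = 0) (hv : B v v = -(2 * m)) :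
    WeylSystem g g' m (fun i => dd W (b i))
      (fun i => mulOp (cut W (B (b i)) (B (b i)).differentiable.differentiableOn)) (dd W v)
      (mulOp (cut W (fun x => B x x / 2)
        (differentiable_quadratic B hB).differentiableOn))
      (mulOp (cut W (B v) (B v).differentiable.differentiableOn)) := by
  have hlin : ∀ w u : E, dd W w (cut W (B u) (B u).differentiable.differentiableOn) =
      B u w • cut W (fun _ => 1) (differentiableOn_const 1) := by
    intro w u
    refine hol.ext_on fun x hx => ?_
    rw [dd_apply _ _ hx, fderiv_cut _ hx, ContinuousLinearMap.fderiv]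
    simp [cut_apply _ hx]
  have hone : ∀ f : hol W, mulOp (cut W (fun _ => 1) (differentiableOn_const 1)) f = f := by
    intro f
    refine hol.ext_on fun x hx => ?_
    rw [mulOp_apply, cut_apply _ hx, one_mul]
  have hDx : ∀ w u : E, dd W w * mulOp (cut W (B u) (B u).differentiable.differentiableOn) =
      mulOp (cut W (B u) (B u).differentiable.differentiableOn) * dd W w +
        algebraMap ℂ (Module.End ℂ (hol W)) (B u w) := by
    intro w u
    refine LinearMap.ext fun f => ?_
    rw [Module.End.mul_apply, dd_mulOp, hlin, map_smul, LinearMap.smul_apply, hone,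
      LinearMap.add_apply, Module.algebraMap_end_apply, Module.End.mul_apply, add_comm]
  have hDq : ∀ w : E, dd W w * mulOp (cut W (fun x => B x x / 2)
        (differentiable_quadratic B hB).differentiableOn) =
      mulOp (cut W (fun x => B x x / 2)
        (differentiable_quadratic B hB).differentiableOn) *
        dd W w + mulOp (cut W (B w) (B w).differentiable.differentiableOn) := by
    intro w
    refine LinearMap.ext fun f => ?_
    rw [Module.End.mul_apply, dd_mulOp, LinearMap.add_apply, Module.End.mul_apply, add_comm]
    congr 2
    refine congrArg _ (hol.ext_on fun x hx => ?_)
    rw [dd_apply _ _ hx, fderiv_cut _ hx, (hasFDerivAt_quadratic B hB x).fderiv, hB,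
      cut_apply _ hx]
  refine ⟨hg', ?_, hsymm', fun i j => dd_comm _ _, fun i => dd_comm _ _, fun i => hDq _,
    fun i j => ?_, fun i => ?_, hDq v, ?_, fun i => ?_⟩
  · ext i j
    rw [transpose_apply, ← hg, ← hg, hB]
  · rw [hDx, hB, hg]
  · rw [hDx, hB, hbv, map_zero, add_zero]
  · rw [hDx, hv, map_neg, sub_eq_add_neg]
  · rw [hDx, hbv, map_zero, add_zero]

/-- The Gegenbauer operator annihilates, at the points of the cone orthogonal to `v`, the
homogeneous functions that vanish on the cone. -/
theorem gegOp_eq_zero_of_vanish {I : Type*} [Fintype I] [DecidableEq I] {W₀ : Opens E}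
    (B : E →L[ℂ] E →L[ℂ] ℂ) (hB : ∀ x y, B x y = B y x) {b : I → E} {v : E} {m : ℂ}
    {g g' : Matrix I I ℂ} (hg : ∀ i j, B (b i) (b j) = g i j) (hg' : g' * g = 1)
    (hsymm' : g'ᵀ = g') (hbv : ∀ i, B (b i) v = 0) (hv : B v v = -(2 * m)) (hm : m ≠ 0)
    (hproj : ∀ X, ∑ i, ∑ j, (g' i j * B (b i) X) • b j = X + (1 / (2 * m) * B v X) • v)
    {e X₀ : E} (he : B e e = 0) (hX₀ : X₀ ∈ W₀) (heX : B e X₀ ≠ 0) (hQX : B X₀ X₀ = 0)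
    (hvX : B v X₀ = 0) {k s : ℂ} (hs : s = k + 1 - Fintype.card I / 2) {h : hol W₀}
    (hk : ∀ X ∈ W₀, fderiv ℂ (h : E → ℂ) X X = -k * (h : E → ℂ) X)
    (hvan : ∀ X ∈ W₀, B X X = 0 → (h : E → ℂ) X = 0) (N : ℕ) :
    (gegOp N s m (lapl g' (fun i => dd W₀ (b i))) (dd W₀ v) h : E → ℂ) X₀ = 0 := by
  have hQd := differentiable_quadratic B hB
  have hlin : ∀ X (c : ℂ), B (X + c • e) (X + c • e) / 2 = B X X / 2 + c * B e X := by
    intro X c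
    simp only [map_add, map_smul, _root_.add_apply, _root_.smul_apply,
      smul_eq_mul, he, hB X e]
    ring
  obtain ⟨W, hXW, hWW, hτ, Ψ, hΨ⟩ := exists_eq_mul_of_vanish W₀.isOpen h.2.1 hQd
    (B e).differentiable hlin hX₀ heX (by simp [hQX])
    (fun X hX hQ => hvan X hX (by simpa using hQ))
  have hid : ∀ x ∈ W, ContinuousLinearMap.id ℂ E x ∈ W₀ := fun x hx => hWW hx
  -- Off the cone, Euler's identity for `h = QΨ` can be divided by `Q`, which is homogeneous of
  -- degree two.
  have hEuler0 : ∀ X ∈ W, B X X / 2 ≠ 0 →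
      fderiv ℂ (Ψ : E → ℂ) X X = (-k - 2) * (Ψ : E → ℂ) X := by
    intro X hX hQ
    have h1 := hk X (hWW hX)
    have h2 : HasFDerivAt (fun y => B y y / 2 * (Ψ : E → ℂ) y) _ X :=
      (hasFDerivAt_quadratic B hB X).mul (differentiableAt_hol Ψ hX).hasFDerivAt
    rw [fderiv_congr_on (U := W) hΨ hX, h2.fderiv, hΨ X hX] at h1
    simp only [_root_.add_apply, _root_.smul_apply, smul_eq_mul] at h1
    refine mul_left_cancel₀ hQ ?_
    linear_combination h1
  have hEuler : ∀ X ∈ W, fderiv ℂ (Ψ : E → ℂ) X X = (-k - 2) * (Ψ : E → ℂ) X := by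
    intro X hX
    by_cases hQ : B X X / 2 = 0
    -- At a point of the cone the identity follows by continuity: on the line `X + c e` the form
    -- equals `c` times `B e X`, hence is nonzero for `c ≠ 0`.
    · have hc1 : ∀ u, ContinuousAt (fun Y => fderiv ℂ (Ψ : E → ℂ) Y u) X := fun u =>
        ((differentiableOn_fderiv_apply W.isOpen Ψ.2.1 u).continuousOn).continuousAt
          (W.isOpen.mem_nhds hX)
      have hΨc : ContinuousAt (Ψ : E → ℂ) X := (differentiableAt_hol Ψ hX).continuousAt
      have hφ : Tendsto (fun c : ℂ => fderiv ℂ (Ψ : E → ℂ) (X + c • e) X +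
          c * fderiv ℂ (Ψ : E → ℂ) (X + c • e) e - (-k - 2) * (Ψ : E → ℂ) (X + c • e)) (𝓝[≠] 0)
          (𝓝 (fderiv ℂ (Ψ : E → ℂ) X X + 0 * fderiv ℂ (Ψ : E → ℂ) X e -
            (-k - 2) * (Ψ : E → ℂ) X)) := by
        have hl : Tendsto (fun c : ℂ => X + c • e) (𝓝[≠] 0) (𝓝 X) := by
          have : Continuous fun c : ℂ => X + c • e := by fun_prop
          simpa using (this.tendsto 0).mono_left nhdsWithin_le_nhds
        have hc : Tendsto (fun c : ℂ => c) (𝓝[≠] 0) (𝓝 0) := nhdsWithin_le_nhds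
        exact (((hc1 X).tendsto.comp hl).add (hc.mul ((hc1 e).tendsto.comp hl))).sub
          (tendsto_const_nhds.mul (hΨc.tendsto.comp hl))
      have hφ0 : Tendsto (fun c : ℂ => fderiv ℂ (Ψ : E → ℂ) (X + c • e) X +
          c * fderiv ℂ (Ψ : E → ℂ) (X + c • e) e - (-k - 2) * (Ψ : E → ℂ) (X + c • e)) (𝓝[≠] 0)
          (𝓝 0) := by
        refine tendsto_const_nhds.congr' ?_
        have hW : ∀ᶠ c : ℂ in 𝓝[≠] 0, X + c • e ∈ W := by
          have hcont : Continuous fun c : ℂ => X + c • e := by fun_prop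
          exact nhdsWithin_le_nhds (hcont.continuousAt.preimage_mem_nhds
            (by simpa using W.isOpen.mem_nhds hX))
        filter_upwards [hW, self_mem_nhdsWithin] with c hcW hc0
        have h1 := hEuler0 _ hcW (by
          rw [hlin, hQ, zero_add]
          exact mul_ne_zero hc0 (hτ X hX))
        rw [map_add, map_smul, smul_eq_mul] at h1
        rw [h1, sub_self]
      have := tendsto_nhds_unique hφ hφ0
      rw [zero_mul, add_zero, sub_eq_zero] at this
      exact this
    · exact hEuler0 X hX hQ
  have hres : compOn (ContinuousLinearMap.id ℂ E) hid h =
      mulOp (cut W (fun x => B x x / 2) hQd.differentiableOn) Ψ := by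
    refine hol.ext_on fun x hx => ?_
    rw [compOn_apply _ hid _ hx, mulOp_apply, cut_apply _ hx]
    exact hΨ x hx
  have hsys := weylSystem_hol W B hB hg hg' hsymm' hbv hv
  have hfin := hsys.eval_gegenbauer_q (ev := evalAt X₀) (Ψ := Ψ) (k := k) (s := s)
    (fun f => by rw [evalAt_apply, mulOp_apply, cut_apply _ hXW, hQX]; simp)
    (fun f => by rw [evalAt_apply, mulOp_apply, cut_apply _ hXW, hvX]; simp) hm
    -- By `hproj` the Euler field of the subspace is the full Euler field plus a multiple of `v`,
    -- which accounts for the term with `t (d Ψ)`.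
    (hol.ext_on fun x hx => by
      have h1 : (euler g' (fun i => dd W (b i)) (fun i => mulOp (cut W (B (b i))
          (B (b i)).differentiable.differentiableOn)) Ψ : E → ℂ) x =
          fderiv ℂ (Ψ : E → ℂ) x (∑ i, ∑ j, (g' i j * B (b i) x) • b j) := by
        simp only [euler, LinearMap.sum_apply, LinearMap.smul_apply, Module.End.mul_apply, map_sum,
          map_smul, AddSubmonoidClass.coe_finsetSum, Finset.sum_apply, Submodule.coe_smul,
          Pi.smul_apply, smul_eq_mul, mulOp_apply]
        refine Finset.sum_congr rfl fun i _ => Finset.sum_congr rfl fun j _ => ?_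
        rw [cut_apply _ hx, dd_apply _ _ hx, mul_assoc]
      rw [h1, hproj, map_add, hEuler x hx, map_smul]
      simp only [Submodule.coe_add, Pi.add_apply, Submodule.coe_smul, Pi.smul_apply, smul_eq_mul,
        mulOp_apply]
      rw [cut_apply _ hx, dd_apply _ _ hx]
      ring) hs N
  -- All operators commute with the restriction from `W₀` to the smaller set on which the quotient
  -- exists.
  have hint := intertwine_gegOp (T := compOn (ContinuousLinearMap.id ℂ E) hid)
    (L := lapl g' (fun i => dd W₀ (b i))) (d := dd W₀ v) (L' := lapl g' (fun i => dd W (b i)))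
    (d' := dd W v) (intertwine_lapl fun i f => (dd_compOn _ hid (b i) f).symm)
    (fun f => (dd_compOn _ hid v f).symm) N s m h
  have hval := congrArg (fun f : hol W => (f : E → ℂ) X₀) hint
  simp only [compOn_apply _ hid _ hXW, ContinuousLinearMap.coe_id', id_eq] at hval
  rw [hval, hres, ← hfin, ← evalAt_apply, gegOp_apply, map_sum]
  simp only [map_smul, smul_eq_mul, Module.End.mul_apply]

end QuadraticCone

variable {ι κ : Type*} [Fintype ι] [DecidableEq ι] [Fintype κ] [DecidableEq κ]

/-! ### Bilinear forms and block vectors -/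

section Bilinear

variable {K : Type*} [Field K]

theorem bilin_add_left (S : Matrix ι ι ℤ) (x y z : ι → K) :
    bilin S (x + y) z = bilin S x z + bilin S y z := add_dotProduct _ _ _

theorem bilin_smul_left (S : Matrix ι ι ℤ) (c : K) (x z : ι → K) :
    bilin S (c • x) z = c * bilin S x z := smul_dotProduct _ _ _

theorem bilin_add_right (S : Matrix ι ι ℤ) (x y z : ι → K) :
    bilin S x (y + z) = bilin S x y + bilin S x z := by
  simp [bilin, mulVec_add, dotProduct_add]

theorem bilin_smul_right (S : Matrix ι ι ℤ) (c : K) (x z : ι → K) :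
    bilin S x (c • z) = c * bilin S x z := by
  simp [bilin, mulVec_smul, dotProduct_smul]

theorem bilin_comm {S : Matrix ι ι ℤ} (hS : S.IsSymm) (x y : ι → K) :
    bilin S x y = bilin S y x := by
  rw [bilin, bilin, dotProduct_mulVec, ← mulVec_transpose, dotProduct_comm, ← transpose_map, hS.eq]

theorem bilin_sum_left {J : Type*} (s : Finset J) (S : Matrix ι ι ℤ) (x : J → ι → K)
    (y : ι → K) : bilin S (∑ j ∈ s, x j) y = ∑ j ∈ s, bilin S (x j) y := by
  simp [bilin, sum_dotProduct]

theorem bilin_ofInt (S : Matrix ι ι ℤ) (x y : ι → ℤ) :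
    bilin S (ofInt K x) (ofInt K y) = ((x ⬝ᵥ (S *ᵥ y) : ℤ) : K) := by
  simp [bilin, ofInt, dotProduct, mulVec]

/-- The form `bilin S` as a continuous bilinear map. -/
def bilinCLM (S : Matrix ι ι ℤ) : (ι → ℂ) →L[ℂ] (ι → ℂ) →L[ℂ] ℂ :=
  LinearMap.toContinuousLinearMap
    ((LinearMap.toContinuousLinearMap (𝕜 := ℂ) (E := ι → ℂ) (F' := ℂ)).toLinearMap ∘ₗ
      LinearMap.mk₂ ℂ (bilin S) (bilin_add_left S) (bilin_smul_left S) (bilin_add_right S)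
        (fun c x z => bilin_smul_right S c x z))

theorem bilinCLM_apply (S : Matrix ι ι ℤ) (x y : ι → ℂ) : bilinCLM S x y = bilin S x y := rfl

/-- The vector with the blocks `a`, `y`, `c`. -/
def vec (a : K) (y : ι → K) (c : K) : Unit ⊕ ι ⊕ Unit → K :=
  Sum.elim (fun _ => a) (Sum.elim y (fun _ => c))

/-- The middle block of a vector. -/
def mid (X : Unit ⊕ ι ⊕ Unit → K) : ι → K := fun i => X (Sum.inr (Sum.inl i))

/-- The last block of a vector. -/
def last (X : Unit ⊕ ι ⊕ Unit → K) : K := X (Sum.inr (Sum.inr ()))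

theorem vec_eta (X : Unit ⊕ ι ⊕ Unit → K) : vec (X (Sum.inl ())) (mid X) (last X) = X := by
  funext j
  rcases j with _ | _ | _ <;> rfl

theorem vec_add (a a' : K) (y y' : ι → K) (c c' : K) :
    vec a y c + vec a' y' c' = vec (a + a') (y + y') (c + c') := by
  funext j
  rcases j with _ | _ | _ <;> rfl

theorem vec_smul (r a : K) (y : ι → K) (c : K) : r • vec a y c = vec (r * a) (r • y) (r * c) := by
  funext j
  rcases j with _ | _ | _ <;> rfl

theorem lift_eq_vec (S : Matrix ι ι ℤ) (z : ι → ℂ) : lift S z = vec (-quad S z) z 1 :=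
  rfl

/-- The Gram matrix of the orthogonal sum of a hyperbolic plane and a lattice with Gram matrix
`T`. -/
def hyp (T : Matrix ι ι K) : Matrix (Unit ⊕ ι ⊕ Unit) (Unit ⊕ ι ⊕ Unit) K :=
  Matrix.fromBlocks 0 (Matrix.fromCols 0 1) (Matrix.fromRows 0 1) (Matrix.fromBlocks T 0 0 0)

theorem bigGram_map (S : Matrix ι ι ℤ) :
    (bigGram S).map (Int.cast : ℤ → K) = hyp (S.map (Int.cast : ℤ → K)) := by
  ext i j
  rcases i with i | i | i <;> rcases j with j | j | j <;> simp [bigGram, hyp]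

theorem hyp_mulVec (T : Matrix ι ι K) (a : K) (y : ι → K) (c : K) :
    hyp T *ᵥ vec a y c = vec c (T *ᵥ y) a := by
  funext j
  rcases j with j | j | j <;> simp [hyp, vec, mulVec, dotProduct]

theorem hyp_mul_hyp {T T' : Matrix ι ι K} (h : T * T' = 1) : hyp T * hyp T' = 1 := by
  refine Matrix.ext_of_mulVec_single fun i => ?_
  rw [← mulVec_mulVec, one_mulVec]
  rw [← vec_eta (Pi.single i 1), hyp_mulVec, hyp_mulVec, mulVec_mulVec, h, one_mulVec]

theorem hyp_transpose {T : Matrix ι ι K} (h : Tᵀ = T) : (hyp T)ᵀ = hyp T := by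
  ext i j
  rcases i with i | i | i <;> rcases j with j | j | j <;> simp [hyp, one_apply]
  exact congrFun (congrFun h i) j

theorem dotProduct_vec (a a' : K) (y y' : ι → K) (c c' : K) :
    vec a y c ⬝ᵥ vec a' y' c' = a * a' + y ⬝ᵥ y' + c * c' := by
  simp [vec, dotProduct, add_assoc]

theorem bilin_bigGram (S : Matrix ι ι ℤ) (a a' : K) (y y' : ι → K) (c c' : K) :
    bilin (bigGram S) (vec a y c) (vec a' y' c') = a * c' + bilin S y y' + c * a' := by
  rw [bilin, bigGram_map, hyp_mulVec, dotProduct_vec, bilin]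

theorem isSymm_bigGram {S : Matrix ι ι ℤ} (h : S.IsSymm) : (bigGram S).IsSymm := by
  ext i j
  rcases i with i | i | i <;> rcases j with j | j | j <;> simp [bigGram, one_apply]
  exact congrFun (congrFun h i) j

end Bilinear

/-- The vectors `e` are a basis of a lattice of corank one, orthogonal to the vector `lam` of
norm `-m`. -/
structure IsOrthBasis (S : Matrix ι ι ℤ) (e : κ → ι → ℤ) (lam : ι → ℤ) (m : ℤ) : Prop where
  symm : S.IsSymm
  det_ne_zero : S.det ≠ 0
  orth : ∀ k, e k ⬝ᵥ (S *ᵥ lam) = 0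
  norm : lam ⬝ᵥ (S *ᵥ lam) = -(2 * m)
  pos : 0 < m
  card : Fintype.card κ + 1 = Fintype.card ι
  linearIndependent : LinearIndependent ℤ e

/-! ### The lattice spanned by `e` and `lam` -/

namespace IsOrthBasis

variable {S : Matrix ι ι ℤ} {e : κ → ι → ℤ} {lam : ι → ℤ} {m : ℤ}

/-- The matrix with columns `e` and `lam`. -/
def colMatrix (e : κ → ι → ℤ) (lam : ι → ℤ) : Matrix ι (κ ⊕ Unit) ℤ :=
  of fun i j => Sum.elim (fun k => e k i) (fun _ => lam i) j

theorem symm_gram (h : IsOrthBasis S e lam m) : (gramOf S e).IsSymm := by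
  ext i j
  simp only [gramOf, transpose_apply, of_apply]
  rw [dotProduct_mulVec, ← mulVec_transpose, h.symm.eq, dotProduct_comm]

theorem colMatrix_gram (h : IsOrthBasis S e lam m) :
    (colMatrix e lam)ᵀ * S * colMatrix e lam =
      fromBlocks (gramOf S e) 0 0 ((-(2 * m) : ℤ) • (1 : Matrix Unit Unit ℤ)) := by
  have hent : ∀ a b, ((colMatrix e lam)ᵀ * S * colMatrix e lam) a b =
      (fun i => colMatrix e lam i a) ⬝ᵥ (S *ᵥ fun i => colMatrix e lam i b) := by
    intro a b
    rw [Matrix.mul_assoc, mul_apply_eq_vecMul]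
    rfl
  have hor : ∀ k, lam ⬝ᵥ (S *ᵥ e k) = 0 := by
    intro k
    rw [dotProduct_mulVec, ← mulVec_transpose, h.symm.eq, dotProduct_comm, h.orth]
  ext a b
  rw [hent]
  rcases a with a | a <;> rcases b with b | b
  · rfl
  · exact h.orth a
  · exact hor b
  · change _ = (-(2 * m)) • (1 : Matrix Unit Unit ℤ) a b
    rw [Subsingleton.elim a b, one_apply_eq, smul_eq_mul, mul_one]
    exact h.norm

theorem mulVec_colMatrix (e : κ → ι → ℤ) (lam : ι → ℤ) (v : κ ⊕ Unit → ℤ) :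
    colMatrix e lam *ᵥ v = (∑ k, v (Sum.inl k) • e k) + v (Sum.inr ()) • lam := by
  funext i
  simp [colMatrix, mulVec, dotProduct, mul_comm]

/-- The columns are independent: pairing a relation with `lam` kills the part from `e`, and `lam`
has nonzero norm, so its coefficient vanishes. The equivalence only serves to make the matrix
square. -/
theorem exists_equiv_det (h : IsOrthBasis S e lam m) :
    ∃ σ : ι ≃ κ ⊕ Unit, ((colMatrix e lam).submatrix id σ).det ≠ 0 := by
  have hc : Fintype.card ι = Fintype.card (κ ⊕ Unit) := by simp [← h.card]
  refine ⟨Fintype.equivOfCardEq hc, fun hdet => ?_⟩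
  obtain ⟨v, hv0, hv⟩ := exists_mulVec_eq_zero_iff.2 hdet
  set σ := Fintype.equivOfCardEq hc
  have h1 : colMatrix e lam *ᵥ (v ∘ σ.symm) = 0 := by
    rw [← hv]
    have := submatrix_mulVec_equiv (colMatrix e lam) v id σ
    rw [this]
    rfl
  rw [mulVec_colMatrix] at h1
  have h2 := congrArg (fun x => x ⬝ᵥ (S *ᵥ lam)) h1
  simp only [add_dotProduct, sum_dotProduct, smul_dotProduct, h.orth, mul_zero, h.norm,
    Finset.sum_const_zero, zero_add, zero_dotProduct, smul_eq_mul] at h2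
  have hv1 : (v ∘ σ.symm) (Sum.inr ()) = 0 := by
    have := h.pos
    rcases mul_eq_zero.1 h2 with h3 | h3
    · exact h3
    · omega
  rw [hv1, zero_smul, add_zero] at h1
  have hv2 := Fintype.linearIndependent_iff.1 h.linearIndependent _ h1
  refine hv0 (funext fun i => ?_)
  rw [← σ.symm_apply_apply i]
  rcases σ i with k | k
  · exact hv2 k
  · exact hv1

/-- The Gram determinant of `e` together with `lam` is the square of the change-of-basis determinant
times `det S`, and it is also `-2m` times the Gram determinant of `e`. -/
theorem det_gram_ne_zero (h : IsOrthBasis S e lam m) : (gramOf S e).det ≠ 0 := by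
  obtain ⟨σ, hσ⟩ := h.exists_equiv_det
  have h1 := congrArg (fun M => (M.submatrix σ σ).det) h.colMatrix_gram
  simp only [det_submatrix_equiv_self, det_fromBlocks_zero₂₁] at h1
  have h2 : ((colMatrix e lam)ᵀ * S * colMatrix e lam).submatrix σ σ =
      ((colMatrix e lam).submatrix id σ)ᵀ * S * (colMatrix e lam).submatrix id σ := by
    ext i j
    simp [mul_apply]
  intro h0
  rw [h0, zero_mul, ← det_submatrix_equiv_self σ, h2, det_mul, det_mul, det_transpose] at h1
  exact mul_ne_zero (mul_ne_zero hσ h.det_ne_zero) hσ h1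

variable {K : Type*} [Field K] [CharZero K]

theorem det_map_ne_zero {J : Type*} [Fintype J] [DecidableEq J] {M : Matrix J J ℤ}
    (h : M.det ≠ 0) : (M.map (Int.cast : ℤ → K)).det ≠ 0 := by
  have : (M.map (Int.cast : ℤ → K)).det = ((M.det : ℤ) : K) := by
    exact (Int.cast_det M).symm
  rw [this]
  exact_mod_cast h

/-- A vector orthogonal to `e` and `lam` vanishes. -/
theorem eq_zero_of_bilin (h : IsOrthBasis S e lam m) {Y : ι → K}
    (h1 : ∀ k, bilin S (ofInt K (e k)) Y = 0) (h2 : bilin S (ofInt K lam) Y = 0) : Y = 0 := by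
  obtain ⟨σ, hσ⟩ := h.exists_equiv_det
  have h3 : (((colMatrix e lam).submatrix id σ)ᵀ * S).map (Int.cast : ℤ → K) *ᵥ Y = 0 := by
    rw [Matrix.map_mul_intCast, ← mulVec_mulVec]
    funext i
    change (fun j => ((colMatrix e lam j (σ i) : ℤ) : K)) ⬝ᵥ _ = 0
    rcases σ i with k | k
    · exact h1 k
    · exact h2
  have h4 : (((colMatrix e lam).submatrix id σ)ᵀ * S).det ≠ 0 := by
    rw [det_mul, det_transpose]
    exact mul_ne_zero hσ h.det_ne_zero
  exact eq_zero_of_mulVec_eq_zero (det_map_ne_zero h4) h3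

end IsOrthBasis

/-! ### Orthogonal projection to the sublattice -/

section Projection

variable {K : Type*} [Field K]

/-- The coordinates of the orthogonal projection to the span of `e`. -/
def projL (S : Matrix ι ι ℤ) (e : κ → ι → ℤ) (x : ι → K) : κ → K :=
  ((gramOf S e).map (Int.cast : ℤ → K))⁻¹ *ᵥ fun k => bilin S (ofInt K (e k)) x

theorem embed_add (e : κ → ι → ℤ) (y z : κ → K) : embed e (y + z) = embed e y + embed e z := by
  simp [embed, add_smul, Finset.sum_add_distrib]

theorem embed_smul (e : κ → ι → ℤ) (c : K) (z : κ → K) : embed e (c • z) = c • embed e z := by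
  simp [embed, mul_smul, Finset.smul_sum]

theorem bilin_embed_left (S : Matrix ι ι ℤ) (e : κ → ι → ℤ) (z : κ → K) (x : ι → K) :
    bilin S (embed e z) x = ∑ k, z k * bilin S (ofInt K (e k)) x := by
  simp only [embed, bilin_sum_left, bilin_smul_left]

end Projection

namespace IsOrthBasis

variable {S : Matrix ι ι ℤ} {e : κ → ι → ℤ} {lam : ι → ℤ} {m : ℤ}
variable {K : Type*} [Field K]

theorem bilin_embed_embed (h : IsOrthBasis S e lam m) (y z : κ → K) :
    bilin S (embed e y) (embed e z) = bilin (gramOf S e) y z := by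
  have h1 : ∀ k, bilin S (ofInt K (e k)) (embed e z) =
      ((gramOf S e).map (Int.cast : ℤ → K) *ᵥ z) k := by
    intro k
    rw [bilin_comm h.symm, bilin_embed_left, mulVec, dotProduct]
    refine Finset.sum_congr rfl fun l _ => ?_
    rw [bilin_comm h.symm, bilin_ofInt, mul_comm, gramOf, map_apply, of_apply]
  rw [bilin_embed_left]
  simp only [h1]
  rfl

theorem quad_embed (h : IsOrthBasis S e lam m) (z : κ → K) :
    quad S (embed e z) = quad (gramOf S e) z := by
  rw [quad, h.bilin_embed_embed, quad]

theorem bilin_embed_lam (h : IsOrthBasis S e lam m) (z : κ → K) :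
    bilin S (embed e z) (ofInt K lam) = 0 := by
  simp [bilin_embed_left, bilin_ofInt, h.orth]

theorem bilin_lam_lam (h : IsOrthBasis S e lam m) :
    bilin S (ofInt K lam) (ofInt K lam) = -(2 * m) := by
  rw [bilin_ofInt, h.norm]; push_cast; ring

variable [CharZero K]

theorem isUnit_det_gram (h : IsOrthBasis S e lam m) :
    IsUnit ((gramOf S e).map (Int.cast : ℤ → K)).det :=
  isUnit_iff_ne_zero.2 (det_map_ne_zero h.det_gram_ne_zero)

theorem bilin_ofInt_embed_projL (h : IsOrthBasis S e lam m) (k : κ) (x : ι → K) :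
    bilin S (ofInt K (e k)) (embed e (projL S e x)) = bilin S (ofInt K (e k)) x := by
  have h1 : ofInt K (e k) = embed e (Pi.single k (1 : K)) := by
    simp [embed, Pi.single_apply]
  rw [h1, h.bilin_embed_embed, bilin, projL, mulVec_mulVec, mul_nonsing_inv _ h.isUnit_det_gram,
    one_mulVec, single_dotProduct, one_mul, ← h1]

theorem m_ne_zero (h : IsOrthBasis S e lam m) : (m : K) ≠ 0 := by exact_mod_cast h.pos.ne'

/-- Both sides have the same pairings with `e` and with `lam`, and these vectors span the space. -/
theorem decomp (h : IsOrthBasis S e lam m) (x : ι → K) :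
    embed e (projL S e x) = x + (1 / (2 * m) * bilin S (ofInt K lam) x) • ofInt K lam := by
  have hm := h.m_ne_zero (K := K)
  rw [← sub_eq_zero, sub_eq_add_neg, ← neg_one_smul K]
  refine h.eq_zero_of_bilin (fun k => ?_) ?_
  · simp only [bilin_add_right, bilin_smul_right, h.bilin_ofInt_embed_projL]
    rw [bilin_ofInt _ (e k) lam, h.orth]
    simp
  · simp only [bilin_add_right, bilin_smul_right, h.bilin_lam_lam]
    rw [bilin_comm h.symm, h.bilin_embed_lam]
    field_simp
    ring

end IsOrthBasis

/-! ### Homogeneous functions on the ambient space and covariance of the Gegenbauer operator -/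

section Ambient

open TopologicalSpace

/-- The cone over the middle block lying above the open set `H`. -/
def coneOver (H : Opens (ι → ℂ)) : Opens (Unit ⊕ ι ⊕ Unit → ℂ) :=
  ⟨{X | last X ≠ 0} ∩ (fun X => (last X)⁻¹ • mid X) ⁻¹' H, by
    have h1 : Continuous fun X : Unit ⊕ ι ⊕ Unit → ℂ => last X := continuous_apply _
    have h2 : Continuous fun X : Unit ⊕ ι ⊕ Unit → ℂ => mid X :=
      continuous_pi fun i => continuous_apply _
    refine ContinuousOn.isOpen_inter_preimage ?_ (isOpen_ne_fun h1 continuous_const) H.isOpen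
    exact ContinuousOn.smul (h1.continuousOn.inv₀ fun X hX => hX) h2.continuousOn⟩

theorem mem_coneOver {H : Opens (ι → ℂ)} {X : Unit ⊕ ι ⊕ Unit → ℂ} :
    X ∈ coneOver H ↔ last X ≠ 0 ∧ (last X)⁻¹ • mid X ∈ H := Iff.rfl

theorem differentiable_last : Differentiable ℂ fun X : Unit ⊕ ι ⊕ Unit → ℂ => last X :=
  differentiable_apply _

theorem differentiable_mid : Differentiable ℂ fun X : Unit ⊕ ι ⊕ Unit → ℂ => mid X :=
  differentiable_pi.2 fun _ => differentiable_apply _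

theorem differentiableOn_homogenize (k : ℤ) {H : Opens (ι → ℂ)} (F : hol H) :
    DifferentiableOn ℂ (fun X : Unit ⊕ ι ⊕ Unit → ℂ =>
      last X ^ (-k) * (F : (ι → ℂ) → ℂ) ((last X)⁻¹ • mid X)) (coneOver H) := by
  have h1 : DifferentiableOn ℂ (fun X : Unit ⊕ ι ⊕ Unit → ℂ => (last X)⁻¹) (coneOver H) :=
    differentiable_last.differentiableOn.inv fun X hX => hX.1
  refine DifferentiableOn.mul ?_ (F.2.1.comp (h1.smul differentiable_mid.differentiableOn)
    fun X hX => hX.2)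
  intro X hX
  exact ((differentiable_last X).zpow (Or.inl hX.1)).differentiableWithinAt

/-- The homogeneous function of degree `-k` attached to a function on `H`, extended off the cone
so as not to depend on the first coordinate. -/
def amb (k : ℤ) {H : Opens (ι → ℂ)} (F : hol H) : hol (coneOver H) :=
  cut (coneOver H) _ (differentiableOn_homogenize k F)

theorem amb_apply (k : ℤ) {H : Opens (ι → ℂ)} (F : hol H) {X : Unit ⊕ ι ⊕ Unit → ℂ}
    (hX : X ∈ coneOver H) : (amb k F : (Unit ⊕ ι ⊕ Unit → ℂ) → ℂ) X =
      last X ^ (-k) * (F : (ι → ℂ) → ℂ) ((last X)⁻¹ • mid X) :=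
  cut_apply (differentiableOn_homogenize k F) hX

theorem amb_add (k : ℤ) {H : Opens (ι → ℂ)} (F G : hol H) :
    amb k (F + G) = amb k F + amb k G :=
  hol.ext_on fun X hX => by simp [amb_apply _ _ hX, mul_add]

theorem amb_smul (k : ℤ) {H : Opens (ι → ℂ)} (c : ℂ) (F : hol H) :
    amb k (c • F) = c • amb k F :=
  hol.ext_on fun X hX => by simp [amb_apply _ _ hX, mul_left_comm]

/-- `amb` as a linear map. -/
def ambLin (k : ℤ) (H : Opens (ι → ℂ)) : hol H →ₗ[ℂ] hol (coneOver H) :=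
  ⟨⟨amb k, amb_add k⟩, amb_smul k⟩

theorem fderiv_apply_eq_deriv {E : Type*} [NormedAddCommGroup E] [NormedSpace ℂ E] {f : E → ℂ}
    {x : E} (hf : DifferentiableAt ℂ f x) (v : E) :
    fderiv ℂ f x v = deriv (fun t : ℂ => f (x + t • v)) 0 :=
  hf.lineDeriv_eq_fderiv.symm

/-- By the chain rule the inner scaling by the inverse of the last coordinate comes out as a factor,
which raises the weight by one. -/
theorem dd_vec_amb (k : ℤ) {H : Opens (ι → ℂ)} (v : ι → ℂ) (F : hol H) :
    dd (coneOver H) (vec 0 v 0) (amb k F) = amb (k + 1) (dd H v F) := by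
  refine hol.ext_on fun X hX => ?_
  have hl := hX.1
  have hmem : ∀ t : ℂ, last (X + t • vec 0 v 0) = last X ∧
      mid (X + t • vec 0 v 0) = mid X + t • v := by
    intro t
    constructor
    · simp [last, vec]
    · funext i; simp [mid, vec]
  have h1 : fderiv ℂ (amb k F : (Unit ⊕ ι ⊕ Unit → ℂ) → ℂ) X (vec 0 v 0) =
      fderiv ℂ (fun X : Unit ⊕ ι ⊕ Unit → ℂ =>
        last X ^ (-k) * (F : (ι → ℂ) → ℂ) ((last X)⁻¹ • mid X)) X (vec 0 v 0) := by
    rw [amb, fderiv_cut _ hX]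
  rw [dd_apply _ _ hX, h1, amb_apply _ _ hX, dd_apply _ _ hX.2,
    fderiv_apply_eq_deriv ((differentiableOn_homogenize k F).differentiableAt
      ((coneOver H).isOpen.mem_nhds hX))]
  simp only [(hmem _).1, (hmem _).2]
  have h2 : HasFDerivAt (F : (ι → ℂ) → ℂ) (fderiv ℂ (F : (ι → ℂ) → ℂ) ((last X)⁻¹ • mid X))
      ((last X)⁻¹ • (mid X + (0 : ℂ) • v)) := by
    simpa using (differentiableAt_hol F hX.2).hasFDerivAt
  have h3 : HasDerivAt (fun t : ℂ => (last X)⁻¹ • (mid X + t • v)) ((last X)⁻¹ • v) 0 := by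
    have h4 := (((hasDerivAt_id (0 : ℂ)).smul_const v).const_add (mid X)).const_smul (last X)⁻¹
    rw [one_smul] at h4
    exact h4
  have h5 : HasDerivAt (fun t : ℂ => last X ^ (-k) * (F : (ι → ℂ) → ℂ)
      ((last X)⁻¹ • (mid X + t • v))) _ 0 :=
    (h2.comp_hasDerivAt (0 : ℂ) h3).const_mul (last X ^ (-k))
  rw [h5.deriv, map_smul, smul_eq_mul,
    neg_add, zpow_add₀ hl, _root_.zpow_neg_one]
  ring

theorem dd_first_amb (k : ℤ) {H : Opens (ι → ℂ)} (F : hol H) :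
    dd (coneOver H) (vec 1 0 0) (amb k F) = 0 := by
  refine hol.ext_on fun X hX => ?_
  have hmem : ∀ t : ℂ, last (X + t • vec 1 0 0) = last X ∧
      mid (X + t • vec 1 0 0) = mid X := by
    intro t
    constructor
    · simp [last, vec]
    · funext i; simp [mid, vec]
  have h1 : fderiv ℂ (amb k F : (Unit ⊕ ι ⊕ Unit → ℂ) → ℂ) X (vec 1 0 0) =
      fderiv ℂ (fun X : Unit ⊕ ι ⊕ Unit → ℂ =>
        last X ^ (-k) * (F : (ι → ℂ) → ℂ) ((last X)⁻¹ • mid X)) X (vec 1 0 0) := by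
    rw [amb, fderiv_cut _ hX]
  rw [dd_apply _ _ hX, h1,
    fderiv_apply_eq_deriv ((differentiableOn_homogenize k F).differentiableAt
      ((coneOver H).isOpen.mem_nhds hX))]
  simp only [(hmem _).1, (hmem _).2, deriv_const]
  rfl

/-- The basis of the orthogonal sum of the span of `e` and a hyperbolic plane. -/
def bigBasis (e : κ → ι → ℤ) : Unit ⊕ κ ⊕ Unit → Unit ⊕ ι ⊕ Unit → ℂ :=
  Sum.elim (fun _ => vec 1 0 0) (Sum.elim (fun k => vec 0 (ofInt ℂ (e k)) 0) fun _ => vec 0 0 1)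

theorem sum_hyp {M : Type*} [AddCommGroup M] [Module ℂ M] (T : Matrix κ κ ℂ)
    (φ : Unit ⊕ κ ⊕ Unit → Unit ⊕ κ ⊕ Unit → M) :
    ∑ i, ∑ j, hyp T i j • φ i j = φ (Sum.inl ()) (Sum.inr (Sum.inr ())) +
      (∑ i, ∑ j, T i j • φ (Sum.inr (Sum.inl i)) (Sum.inr (Sum.inl j))) +
      φ (Sum.inr (Sum.inr ())) (Sum.inl ()) := by
  simp [hyp, Fintype.sum_sum_type, add_assoc]

/-- The hyperbolic plane contributes only mixed derivatives involving the first coordinate, on which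
`amb` does not depend. The Laplace operator of the larger lattice therefore reduces to that of the
sublattice. -/
theorem lapl_amb (k : ℤ) {H : Opens (ι → ℂ)} (e : κ → ι → ℤ) (T : Matrix κ κ ℂ) (F : hol H) :
    lapl (hyp T) (fun i => dd (coneOver H) (bigBasis e i)) (amb k F) =
      amb (k + 2) (lapl T (fun i => dd H (ofInt ℂ (e i))) F) := by
  have h1 : dd (coneOver H) (vec 1 0 0) (dd (coneOver H) (vec 0 0 1) (amb k F)) = 0 := by
    rw [← Module.End.mul_apply, dd_comm, Module.End.mul_apply, dd_first_amb, map_zero]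
  have h2 : amb (k + 2) (lapl T (fun i => dd H (ofInt ℂ (e i))) F) =
      ambLin (k + 2) H (lapl T (fun i => dd H (ofInt ℂ (e i))) F) := rfl
  rw [h2, lapl_apply, lapl_apply, sum_hyp T (fun i j =>
    dd (coneOver H) (bigBasis e i) (dd (coneOver H) (bigBasis e j) (amb k F)))]
  simp only [bigBasis, Sum.elim_inl, Sum.elim_inr, h1, dd_first_amb, map_zero, zero_add, add_zero,
    dd_vec_amb, map_smul, map_sum]
  rw [show k + 2 = k + 1 + 1 by ring]
  rfl

/-- Every term raises the weight by the same amount: `N - 2j` from the first-order derivatives and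
`2j` from the Laplace operators. -/
theorem gegOp_amb (k : ℤ) {H : Opens (ι → ℂ)} (e : κ → ι → ℤ) (T : Matrix κ κ ℂ) (v : ι → ℂ)
    (N : ℕ) (s m : ℂ) (F : hol H) :
    gegOp N s m (lapl (hyp T) fun i => dd (coneOver H) (bigBasis e i))
        (dd (coneOver H) (vec 0 v 0)) (amb k F) =
      amb (k + N) (gegOp N s m (lapl T fun i => dd H (ofInt ℂ (e i))) (dd H v) F) := by
  have hd : ∀ (p : ℕ) (k : ℤ) (F : hol H), (dd (coneOver H) (vec 0 v 0) ^ p) (amb k F) =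
      amb (k + p) ((dd H v ^ p) F) := by
    intro p
    induction p with
    | zero => intro k F; simp
    | succ p ih =>
      intro k F
      rw [pow_succ, pow_succ, Module.End.mul_apply, Module.End.mul_apply, dd_vec_amb, ih]
      congr 1
      push_cast
      ring
  have hL : ∀ (j : ℕ) (k : ℤ) (F : hol H),
      (lapl (hyp T) (fun i => dd (coneOver H) (bigBasis e i)) ^ j) (amb k F) =
      amb (k + 2 * j) ((lapl T (fun i => dd H (ofInt ℂ (e i))) ^ j) F) := by
    intro j
    induction j with
    | zero => intro k F; simp
    | succ j ih =>
      intro k F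
      rw [pow_succ, pow_succ, Module.End.mul_apply, Module.End.mul_apply, lapl_amb, ih]
      congr 1
      push_cast
      ring
  have h2 : ∀ F : hol H, amb (k + N) F = ambLin (k + N) H F := fun _ => rfl
  rw [h2, gegOp_apply, gegOp_apply, map_sum]
  refine Finset.sum_congr rfl fun j hj => ?_
  have hj' : j ≤ N / 2 := Nat.lt_succ_iff.1 (Finset.mem_range.1 hj)
  rw [map_smul, hd, hL, ← h2]
  congr 2
  have : (((N - 2 * j : ℕ)) : ℤ) = N - 2 * j := by
    rw [Nat.cast_sub (by omega)]; push_cast; ring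
  rw [this]
  ring

theorem smul_mem_coneOver {H : Opens (ι → ℂ)} {X : Unit ⊕ ι ⊕ Unit → ℂ} (hX : X ∈ coneOver H)
    {c : ℂ} (hc : c ≠ 0) : c • X ∈ coneOver H ∧
      (last (c • X))⁻¹ • mid (c • X) = (last X)⁻¹ • mid X := by
  have h1 : (last (c • X))⁻¹ • mid (c • X) = (last X)⁻¹ • mid X := by
    funext i
    simp only [last, mid, Pi.smul_apply, smul_eq_mul]
    have := hX.1
    field_simp
  refine ⟨⟨mul_ne_zero hc hX.1, ?_⟩, h1⟩
  change (last (c • X))⁻¹ • mid (c • X) ∈ (H : Set (ι → ℂ))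
  rw [h1]
  exact hX.2

theorem amb_smul_apply (k : ℤ) {H : Opens (ι → ℂ)} (F : hol H) {X : Unit ⊕ ι ⊕ Unit → ℂ}
    (hX : X ∈ coneOver H) {c : ℂ} (hc : c ≠ 0) :
    (amb k F : (Unit ⊕ ι ⊕ Unit → ℂ) → ℂ) (c • X) =
      c ^ (-k) * (amb k F : (Unit ⊕ ι ⊕ Unit → ℂ) → ℂ) X := by
  obtain ⟨h1, h2⟩ := smul_mem_coneOver hX hc
  rw [amb_apply _ _ h1, amb_apply _ _ hX, h2, ← mul_assoc, ← mul_zpow]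
  rfl

/-- Euler's identity. -/
theorem fderiv_self_of_homogeneous {E : Type*} [NormedAddCommGroup E] [NormedSpace ℂ E]
    {f : E → ℂ} {X : E} (hf : DifferentiableAt ℂ f X) (k : ℤ)
    (hk : ∀ c : ℂ, c ≠ 0 → f (c • X) = c ^ (-k) * f X) : fderiv ℂ f X X = -k * f X := by
  have h1 : HasDerivAt (fun c : ℂ => f (c • X)) (fderiv ℂ f X X) 1 := by
    have h2 : HasFDerivAt f (fderiv ℂ f X) ((1 : ℂ) • X) := by simpa using hf.hasFDerivAt
    have h3 : HasDerivAt (fun c : ℂ => c • X) X 1 := by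
      simpa using (hasDerivAt_id (1 : ℂ)).smul_const X
    exact h2.comp_hasDerivAt (1 : ℂ) h3
  have h4 : HasDerivAt (fun c : ℂ => c ^ (-k) * f X) (-k * f X) 1 := by
    have := (hasDerivAt_zpow (-k) (1 : ℂ) (Or.inl one_ne_zero)).mul_const (f X)
    simpa using this
  refine h1.unique (h4.congr_of_eventuallyEq ?_)
  filter_upwards [isOpen_ne.mem_nhds (one_ne_zero : (1 : ℂ) ≠ 0)] with c hc using hk c hc

/-- Covariance of the Gegenbauer operator under isometries fixing `lam`. -/
theorem gegOp_covariant {S : Matrix ι ι ℤ} {e : κ → ι → ℤ} {lam : ι → ℤ} {m : ℤ}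
    (h : IsOrthBasis S e lam m) {k : ℤ} {s : ℂ} (hs : s = k + (1 - (Fintype.card ι : ℂ)) / 2)
    {H : Opens (ι → ℂ)} (F G : hol H)
    (A : (Unit ⊕ ι ⊕ Unit → ℂ) →L[ℂ] (Unit ⊕ ι ⊕ Unit → ℂ))
    {Mx : Matrix (Unit ⊕ κ ⊕ Unit) (Unit ⊕ κ ⊕ Unit) ℂ}
    (hA : ∀ i, A (bigBasis e i) = ∑ k, Mx k i • bigBasis e k)
    (hM : Mx * hyp ((gramOf S e).map (Int.cast : ℤ → ℂ))⁻¹ * Mxᵀ =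
      hyp ((gramOf S e).map (Int.cast : ℤ → ℂ))⁻¹)
    (hlam : A (vec 0 (ofInt ℂ lam) 0) = vec 0 (ofInt ℂ lam) 0)
    (hFG : ∀ X ∈ coneOver H, A X ∈ coneOver H → bilin (bigGram S) X X = 0 →
      (amb k F : (Unit ⊕ ι ⊕ Unit → ℂ) → ℂ) (A X) =
        (amb k G : (Unit ⊕ ι ⊕ Unit → ℂ) → ℂ) X)
    {X₀ : Unit ⊕ ι ⊕ Unit → ℂ} (hX₀ : X₀ ∈ coneOver H) (hAX₀ : A X₀ ∈ coneOver H)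
    (hQ : bilin (bigGram S) X₀ X₀ = 0)
    (hlX : bilin (bigGram S) (vec 0 (ofInt ℂ lam) 0) X₀ = 0) (N : ℕ) :
    (amb (k + N) (gegOp N s m (lapl ((gramOf S e).map (Int.cast : ℤ → ℂ))⁻¹
        fun i => dd H (ofInt ℂ (e i))) (dd H (ofInt ℂ lam)) F) :
          (Unit ⊕ ι ⊕ Unit → ℂ) → ℂ) (A X₀) =
      (amb (k + N) (gegOp N s m (lapl ((gramOf S e).map (Int.cast : ℤ → ℂ))⁻¹
        fun i => dd H (ofInt ℂ (e i))) (dd H (ofInt ℂ lam)) G) :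
          (Unit ⊕ ι ⊕ Unit → ℂ) → ℂ) X₀ := by
  set T := ((gramOf S e).map (Int.cast : ℤ → ℂ))⁻¹ with hT
  set U := coneOver H
  set L := lapl (hyp T) (fun i => dd U (bigBasis e i)) with hL
  let W₀ : Opens (Unit ⊕ ι ⊕ Unit → ℂ) := ⟨U ∩ A ⁻¹' U, U.isOpen.inter (U.isOpen.preimage A.cont)⟩
  have hi : ∀ x ∈ W₀, ContinuousLinearMap.id ℂ _ x ∈ U := fun x hx => hx.1
  have hAW : ∀ x ∈ W₀, A x ∈ U := fun x hx => hx.2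
  have hXW : X₀ ∈ W₀ := ⟨hX₀, hAX₀⟩
  -- This difference vanishes on the isotropic cone by `hFG`, but in general not off it; it is the
  -- function to be divided by the quadratic form.
  let f : hol W₀ := compOn A hAW (amb k F) - compOn (ContinuousLinearMap.id ℂ _) hi (amb k G)
  have hf : ∀ X ∈ W₀, (f : (Unit ⊕ ι ⊕ Unit → ℂ) → ℂ) X =
      (amb k F : (Unit ⊕ ι ⊕ Unit → ℂ) → ℂ) (A X) -
        (amb k G : (Unit ⊕ ι ⊕ Unit → ℂ) → ℂ) X := by
    intro X hX
    have h1 := compOn_apply A hAW (amb k F) hX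
    have h2 := compOn_apply (ContinuousLinearMap.id ℂ _) hi (amb k G) hX
    change (compOn A hAW (amb k F) : (Unit ⊕ ι ⊕ Unit → ℂ) → ℂ) X -
      (compOn (ContinuousLinearMap.id ℂ _) hi (amb k G) : (Unit ⊕ ι ⊕ Unit → ℂ) → ℂ) X = _
    rw [h1, h2]
    rfl
  have hsymm : ∀ x y, bilinCLM (bigGram S) x y = bilinCLM (bigGram S) y x :=
    fun x y => bilin_comm (isSymm_bigGram h.symm) x y
  have hTsymm : Tᵀ = T := by
    rw [hT, transpose_nonsing_inv, ← transpose_map, h.symm_gram.eq]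
  have hTmul : T * (gramOf S e).map (Int.cast : ℤ → ℂ) = 1 :=
    nonsing_inv_mul _ h.isUnit_det_gram
  have hzero : ∀ y : ι → ℂ, bilin S 0 y = 0 := fun y => by simp [bilin]
  have hzero' : ∀ y : ι → ℂ, bilin S y 0 = 0 := fun y => by simp [bilin]
  have hvan := gegOp_eq_zero_of_vanish (W₀ := W₀) (bilinCLM (bigGram S)) hsymm
    (b := bigBasis e) (v := vec 0 (ofInt ℂ lam) 0) (m := m)
    (g := hyp ((gramOf S e).map (Int.cast : ℤ → ℂ))) (g' := hyp T)
    (by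
      intro i j
      rw [bilinCLM_apply]
      rcases i with i | i | i <;> rcases j with j | j | j <;>
        simp [bigBasis, bilin_bigGram, hyp, hzero, hzero', bilin_ofInt, gramOf])
    (hyp_mul_hyp hTmul) (hyp_transpose hTsymm)
    (by
      intro i
      rw [bilinCLM_apply]
      rcases i with i | i | i <;>
        simp [bigBasis, bilin_bigGram, hzero, bilin_ofInt, h.orth])
    (by rw [bilinCLM_apply, bilin_bigGram, h.bilin_lam_lam]; ring) h.m_ne_zero
    (by
      intro X
      rw [← vec_eta X]
      generalize X (Sum.inl ()) = a, mid X = y, last X = c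
      simp only [mul_smul, sum_hyp T
        (fun i j => bilinCLM (bigGram S) (bigBasis e i) (vec a y c) • bigBasis e j)]
      have h1 : ∑ i, ∑ j, T i j • bilinCLM (bigGram S) (bigBasis e (Sum.inr (Sum.inl i)))
          (vec a y c) • bigBasis e (Sum.inr (Sum.inl j)) =
            vec 0 (embed e (projL S e y)) 0 := by
        have h2 : ∀ i, bilinCLM (bigGram S) (bigBasis e (Sum.inr (Sum.inl i))) (vec a y c) =
            bilin S (ofInt ℂ (e i)) y := by
          intro i
          rw [bilinCLM_apply]
          simp [bigBasis, bilin_bigGram]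
        have h3 : ∀ y : κ → ℂ, vec 0 (embed e y) 0 =
            ∑ j, y j • bigBasis e (Sum.inr (Sum.inl j)) := by
          intro y
          funext a
          rcases a with a | a | a <;> simp [vec, bigBasis, embed]
        rw [h3, Finset.sum_comm]
        refine Finset.sum_congr rfl fun j _ => ?_
        simp only [h2, projL, mulVec, dotProduct, Finset.sum_smul, smul_smul]
        refine Finset.sum_congr rfl fun i _ => ?_
        rw [← congrFun (congrFun hTsymm i) j, transpose_apply]
      rw [h1, h.decomp, bilinCLM_apply, bilinCLM_apply, bilinCLM_apply]
      simp only [bigBasis, Sum.elim_inl, Sum.elim_inr, bilin_bigGram, vec_smul, vec_add, hzero]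
      congr 1 <;> simp [smul_smul])
    -- An isotropic direction whose pairing with `X` is the last coordinate, which does not vanish
    -- on the domain.
    (e := vec 1 0 0) (X₀ := X₀) (by simp [bilinCLM_apply, bilin_bigGram, hzero]) hXW
    (by
      rw [bilinCLM_apply, ← vec_eta X₀, bilin_bigGram, hzero]
      simpa using hX₀.1) hQ hlX (k := k) (s := s)
    -- The subspace has dimension `ℓ + 1`, so `k + 1 - (ℓ + 1)/2` is the parameter `k + (1 - ℓ)/2`.
    (by
      rw [hs, ← h.card]
      simp
      ring) (h := f)
    (by
      intro X hX
      refine fderiv_self_of_homogeneous (differentiableAt_hol f hX) k fun c hc => ?_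
      have hcX : c • X ∈ W₀ := ⟨(smul_mem_coneOver hX.1 hc).1, by
        change A (c • X) ∈ U
        rw [map_smul]
        exact (smul_mem_coneOver hX.2 hc).1⟩
      rw [hf _ hcX, hf _ hX, map_smul, amb_smul_apply k F hX.2 hc, amb_smul_apply k G hX.1 hc,
        mul_sub])
    (fun X hX hB => by rw [hf X hX, hFG X hX.1 hX.2 hB, sub_self]) N
  -- Substituting `A` commutes with the Laplace operator because `A` preserves its symbol (`hM`),
  -- and with the derivative along `lam` because `A` fixes that vector.
  have hG1 : gegOp N s m (lapl (hyp T) fun i => dd W₀ (bigBasis e i))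
      (dd W₀ (vec 0 (ofInt ℂ lam) 0)) (compOn A hAW (amb k F)) =
      compOn A hAW (gegOp N s m L (dd U (vec 0 (ofInt ℂ lam) 0)) (amb k F)) :=
    (intertwine_gegOp (fun f => (lapl_compOn A hAW hA hM f).symm)
      (fun f => by rw [dd_compOn, hlam]) N s m (amb k F)).symm
  have hG2 : gegOp N s m (lapl (hyp T) fun i => dd W₀ (bigBasis e i))
      (dd W₀ (vec 0 (ofInt ℂ lam) 0)) (compOn (ContinuousLinearMap.id ℂ _) hi (amb k G)) =
      compOn (ContinuousLinearMap.id ℂ _) hi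
        (gegOp N s m L (dd U (vec 0 (ofInt ℂ lam) 0)) (amb k G)) :=
    (intertwine_gegOp (intertwine_lapl fun i f => (dd_compOn _ hi (bigBasis e i) f).symm)
      (fun f => by rw [dd_compOn]; rfl) N s m (amb k G)).symm
  rw [map_sub, hG1, hG2, hL, gegOp_amb, gegOp_amb] at hvan
  have h5 := compOn_apply A hAW (amb (k + N) (gegOp N s m (lapl T fun i => dd H (ofInt ℂ (e i)))
    (dd H (ofInt ℂ lam)) F)) hXW
  have h6 := compOn_apply (ContinuousLinearMap.id ℂ _) hi (amb (k + N) (gegOp N s m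
    (lapl T fun i => dd H (ofInt ℂ (e i))) (dd H (ofInt ℂ lam)) G)) hXW
  rw [← h5, ← sub_eq_zero]
  rw [ContinuousLinearMap.id_apply] at h6
  rw [← h6]
  exact hvan

end Ambient

/-! ### Lorentzian geometry of the positive cone -/

section Lorentzian

variable {S : Matrix ι ι ℤ}

theorem IsEvenLorentzian.det_ne_zero (hS : IsEvenLorentzian S) : S.det ≠ 0 := by
  obtain ⟨i₀, A, -, hA⟩ := hS.signature
  intro h0
  have h1 := congrArg det hA
  rw [det_mul, det_mul, ← Int.cast_det, h0, det_diagonal] at h1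
  simp only [Int.cast_zero, mul_zero, zero_mul] at h1
  obtain ⟨i, -, hi⟩ := Finset.prod_eq_zero_iff.1 h1.symm
  split_ifs at hi <;> norm_num at hi

theorem bilin_self (S : Matrix ι ι ℤ) (x : ι → ℝ) : bilin S x x = 2 * quad S x := by
  rw [quad]; ring

theorem quad_add_smul (hS : S.IsSymm) (a b : ℝ) (v x : ι → ℝ) :
    quad S (a • v + b • x) = a ^ 2 * quad S v + b ^ 2 * quad S x + a * b * bilin S v x := by
  simp only [quad, bilin_add_left, bilin_add_right, bilin_smul_left, bilin_smul_right,
    bilin_comm hS x v]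
  ring

theorem dotProduct_mulVec_mulVec {J R : Type*} [Fintype J] [CommRing R] (A G : Matrix J J R)
    (x y : J → R) : (A *ᵥ x) ⬝ᵥ (G *ᵥ (A *ᵥ y)) = x ⬝ᵥ ((Aᵀ * G * A) *ᵥ y) := by
  rw [← mulVec_mulVec, ← mulVec_mulVec, dotProduct_mulVec x Aᵀ, vecMul_transpose]

/-- A hyperplane on which the form is negative definite. -/
theorem IsEvenLorentzian.exists_functional (hS : IsEvenLorentzian S) :
    ∃ f : (ι → ℝ) →ₗ[ℝ] ℝ, ∀ x, f x = 0 → x ≠ 0 → quad S x < 0 := by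
  obtain ⟨i₀, A, hdet, hA⟩ := hS.signature
  refine ⟨LinearMap.proj i₀ ∘ₗ A⁻¹.mulVecLin, fun x hf hx => ?_⟩
  set y := A⁻¹ *ᵥ x with hy
  have hxy : x = A *ᵥ y := by rw [hy, mulVec_mulVec, mul_nonsing_inv _ hdet, one_mulVec]
  have hf' : y i₀ = 0 := hf
  have hB : bilin S x x = ∑ i, (if i = i₀ then 1 else -1) * (y i) ^ 2 := by
    rw [bilin, hxy, dotProduct_mulVec_mulVec, hA, dotProduct]
    refine Finset.sum_congr rfl fun i _ => ?_
    rw [mulVec_diagonal]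
    ring
  obtain ⟨i₁, hi₁⟩ : ∃ i, y i ≠ 0 := by
    by_contra hcon
    push Not at hcon
    exact hx (by rw [hxy, show y = 0 from funext hcon, mulVec_zero])
  have hlt : ∑ i, (if i = i₀ then (1 : ℝ) else -1) * (y i) ^ 2 < 0 := by
    refine Finset.sum_neg' (fun i _ => ?_) ⟨i₁, Finset.mem_univ _, ?_⟩
    · split_ifs with h
      · rw [h, hf']; simp
      · nlinarith [sq_nonneg (y i)]
    · rw [if_neg (by rintro rfl; exact hi₁ hf')]
      have := sq_pos_of_ne_zero hi₁
      linarith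
  rw [quad, hB]
  linarith

/-- If `Q x ≥ 0`, the combination `f(x) v - f(v) x` would have nonnegative norm and lie in the
kernel of `f`, on which the form is negative definite; so it is zero, and then so is `x`. -/
theorem IsEvenLorentzian.quad_neg_of_orth (hS : IsEvenLorentzian S) {v x : ι → ℝ}
    (hv : 0 < quad S v) (hvx : bilin S v x = 0) (hx : x ≠ 0) : quad S x < 0 := by
  obtain ⟨f, hf⟩ := hS.exists_functional
  by_contra hneg
  push Not at hneg
  have hv0 : v ≠ 0 := by rintro rfl; simp [quad, bilin] at hv
  have hfv : f v ≠ 0 := fun h => absurd (hf v h hv0) (by linarith)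
  have h1 : f (f x • v + (-f v) • x) = 0 := by simp; ring
  have h2 := quad_add_smul hS.symm (f x) (-f v) v x
  rw [hvx, mul_zero, add_zero] at h2
  have h3 : f x • v + (-f v) • x = 0 := by
    by_contra h
    have := hf _ h1 h
    have h4 : 0 ≤ quad S (f x • v + (-f v) • x) := by rw [h2]; positivity
    linarith
  rw [h3] at h2
  have h5 : quad S (0 : ι → ℝ) = 0 := by simp [quad, bilin]
  have h6 : f x = 0 := by
    have : 0 ≤ (-f v) ^ 2 * quad S x := by positivity
    have h7 : f x ^ 2 * quad S v = 0 := by nlinarith [sq_nonneg (f x)]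
    rcases mul_eq_zero.1 h7 with h | h
    · exact pow_eq_zero_iff two_ne_zero |>.1 h
    · exact absurd h hv.ne'
  rw [h6, zero_smul, zero_add, smul_eq_zero] at h3
  rcases h3 with h | h
  · exact hfv (neg_eq_zero.1 h)
  · exact hx h

/-- The component of `x` orthogonal to `v` has nonpositive norm. -/
theorem IsEvenLorentzian.reverse_cauchy_schwarz (hS : IsEvenLorentzian S) {v : ι → ℝ}
    (hv : 0 < quad S v) (x : ι → ℝ) : 4 * quad S v * quad S x ≤ bilin S v x ^ 2 := by
  have h1 := quad_add_smul hS.symm (-bilin S v x) (2 * quad S v) v x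
  have h2 : bilin S v ((-bilin S v x) • v + (2 * quad S v) • x) = 0 := by
    rw [bilin_add_right, bilin_smul_right, bilin_smul_right, bilin_self]; ring
  have h3 : quad S ((-bilin S v x) • v + (2 * quad S v) • x) ≤ 0 := by
    by_cases h : (-bilin S v x) • v + (2 * quad S v) • x = 0
    · rw [h]; simp [quad, bilin]
    · exact (hS.quad_neg_of_orth hv h2 h).le
  rw [h1] at h3
  have h4 : quad S v * (4 * quad S v * quad S x - bilin S v x ^ 2) ≤ 0 := by nlinarith
  by_contra hcon
  push Not at hcon
  nlinarith [mul_pos hv (sub_pos.2 hcon)]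

theorem continuous_bilin_left (S : Matrix ι ι ℤ) (v : ι → ℝ) : Continuous (bilin S v) := by
  unfold bilin dotProduct mulVec dotProduct
  fun_prop

theorem continuous_quad (S : Matrix ι ι ℤ) : Continuous (quad S : (ι → ℝ) → ℝ) := by
  unfold quad bilin dotProduct mulVec dotProduct
  fun_prop

/-- The combination of `x` and `y` orthogonal to `v` has nonpositive norm, although its two square
terms are positive; the mixed term must therefore be negative. -/
theorem IsEvenLorentzian.bilin_pos_of_same_side (hS : IsEvenLorentzian S) {v x y : ι → ℝ}
    (hv : 0 < quad S v) (hx : 0 < quad S x) (hy : 0 < quad S y) (hvx : 0 < bilin S v x)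
    (hvy : 0 < bilin S v y) : 0 < bilin S x y := by
  have h1 := quad_add_smul hS.symm (bilin S v y) (-bilin S v x) x y
  have h2 : bilin S v (bilin S v y • x + (-bilin S v x) • y) = 0 := by
    rw [bilin_add_right, bilin_smul_right, bilin_smul_right]; ring
  have h3 : quad S (bilin S v y • x + (-bilin S v x) • y) ≤ 0 := by
    by_cases h : bilin S v y • x + (-bilin S v x) • y = 0
    · rw [h]; simp [quad, bilin]
    · exact (hS.quad_neg_of_orth hv h2 h).le
  rw [h1] at h3
  have h4 : 0 < bilin S v y ^ 2 * quad S x := by positivity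
  have h5 : 0 < (-bilin S v x) ^ 2 * quad S y := by
    have : (0 : ℝ) < (-bilin S v x) ^ 2 := by rw [neg_sq]; positivity
    positivity
  by_contra hcon
  push Not at hcon
  have h6 : 0 < bilin S v y * bilin S v x := by positivity
  nlinarith [mul_nonneg h6.le (neg_nonneg.2 hcon)]

namespace IsPositiveCone

variable {P : Set (ι → ℝ)}

theorem quad_pos (hP : IsPositiveCone S P) {x : ι → ℝ} (hx : x ∈ P) : 0 < quad S x := by
  obtain ⟨y, -, rfl⟩ := hP
  exact connectedComponentIn_subset {x : ι → ℝ | 0 < quad S x} y hx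

theorem eq_component (hP : IsPositiveCone S P) {v : ι → ℝ} (hv : v ∈ P) :
    P = connectedComponentIn {x : ι → ℝ | 0 < quad S x} v := by
  obtain ⟨y, -, rfl⟩ := hP
  exact connectedComponentIn_eq hv

theorem nonempty (hP : IsPositiveCone S P) : P.Nonempty := by
  obtain ⟨y, hy, rfl⟩ := hP
  exact ⟨y, mem_connectedComponentIn hy⟩

/-- By the reverse Cauchy–Schwarz inequality the pairing with `v` has no zero on the connected set
`P`, so its sign is constant. Conversely the half cone on the right is convex, hence contained in
the component of `v`. -/
theorem mem_iff (hS : IsEvenLorentzian S) (hP : IsPositiveCone S P) {v : ι → ℝ} (hv : v ∈ P)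
    {x : ι → ℝ} : x ∈ P ↔ 0 < quad S x ∧ 0 < bilin S v x := by
  have hvq := hP.quad_pos hv
  have hvv : 0 < bilin S v v := by rw [bilin_self]; linarith
  constructor
  · intro hx
    refine ⟨hP.quad_pos hx, ?_⟩
    have hconn : IsPreconnected P := by
      rw [hP.eq_component hv]; exact isPreconnected_connectedComponentIn
    have hne : ∀ y ∈ P, bilin S v y ≠ 0 := by
      intro y hy h0
      have h1 := hS.reverse_cauchy_schwarz hvq y
      rw [h0] at h1
      have := mul_pos hvq (hP.quad_pos hy)
      nlinarith
    by_contra hcon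
    push Not at hcon
    obtain ⟨y, hy, hy0⟩ := hconn.intermediate_value hx hv
      (continuous_bilin_left S v).continuousOn ⟨hcon, hvv.le⟩
    exact hne y hy hy0
  · rintro ⟨hx, hvx⟩
    rw [hP.eq_component hv]
    have hconv : Convex ℝ {x : ι → ℝ | 0 < quad S x ∧ 0 < bilin S v x} := by
      intro x hx y hy a b ha hb hab
      have hxy := hS.bilin_pos_of_same_side hvq hx.1 hy.1 hx.2 hy.2
      constructor
      · change 0 < quad S (a • x + b • y)
        rw [quad_add_smul hS.symm]
        rcases ha.eq_or_lt with rfl | ha'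
        · have : b = 1 := by linarith
          subst this
          simpa using hy.1
        · have h1 := mul_pos (pow_pos ha' 2) hx.1
          have h2 := mul_nonneg (sq_nonneg b) hy.1.le
          have h3 := mul_nonneg (mul_nonneg ha hb) hxy.le
          linarith
      · change 0 < bilin S v (a • x + b • y)
        rw [bilin_add_right, bilin_smul_right, bilin_smul_right]
        rcases ha.eq_or_lt with rfl | ha'
        · have : b = 1 := by linarith
          subst this
          simpa using hy.2
        · have h1 := mul_pos ha' hx.2
          have h2 := mul_nonneg hb hy.2.le
          linarith
    exact hconv.isPreconnected.subset_connectedComponentIn ⟨hvq, hvv⟩ (fun y hy => hy.1) ⟨hx, hvx⟩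

theorem isOpen (hS : IsEvenLorentzian S) (hP : IsPositiveCone S P) : IsOpen P := by
  obtain ⟨v, hv⟩ := hP.nonempty
  have : P = {x : ι → ℝ | 0 < quad S x} ∩ {x | 0 < bilin S v x} :=
    Set.ext fun x => hP.mem_iff hS hv
  rw [this]
  exact (isOpen_lt continuous_const (continuous_quad S)).inter
    (isOpen_lt continuous_const (continuous_bilin_left S v))

theorem bilin_pos (hS : IsEvenLorentzian S) (hP : IsPositiveCone S P) {x y : ι → ℝ} (hx : x ∈ P)
    (hy : y ∈ P) : 0 < bilin S x y := ((hP.mem_iff hS hx).1 hy).2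

theorem smul_mem (hS : IsEvenLorentzian S) (hP : IsPositiveCone S P) {x : ι → ℝ} (hx : x ∈ P)
    {c : ℝ} (hc : 0 < c) : c • x ∈ P := by
  rw [hP.mem_iff hS hx, bilin_smul_right, bilin_self]
  have h1 := hP.quad_pos hx
  refine ⟨?_, by positivity⟩
  have : quad S (c • x) = c ^ 2 * quad S x := by
    simp only [quad, bilin_smul_left, bilin_smul_right]; ring
  rw [this]
  positivity

theorem add_mem (hS : IsEvenLorentzian S) (hP : IsPositiveCone S P) {x y : ι → ℝ} (hx : x ∈ P)
    (hy : y ∈ P) : x + y ∈ P := by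
  rw [hP.mem_iff hS hx, bilin_add_right, bilin_self]
  have h1 := hP.quad_pos hx
  have h2 := hP.quad_pos hy
  have h3 := hP.bilin_pos hS hx hy
  refine ⟨?_, by linarith⟩
  have := quad_add_smul hS.symm 1 1 x y
  simp only [one_smul, one_pow, one_mul] at this
  rw [this]
  linarith

theorem convex (hS : IsEvenLorentzian S) (hP : IsPositiveCone S P) : Convex ℝ P := by
  intro x hx y hy a b ha hb hab
  rcases ha.eq_or_lt with rfl | ha'
  · have : b = 1 := by linarith
    subst this
    simpa using hy
  · rcases hb.eq_or_lt with rfl | hb'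
    · have : a = 1 := by linarith
      subst this
      simpa using hx
    · exact hP.add_mem hS (hP.smul_mem hS hx ha') (hP.smul_mem hS hy hb')

/-- If `Q r < 0`, one can start at `v` and move along `r` to the point where the pairing with `r`
vanishes without leaving `P`. A slightly longer step stays in the open cone and makes the pairing
negative. -/
theorem quad_nonneg_of_dual (hS : IsEvenLorentzian S) (hP : IsPositiveCone S P) {r : ι → ℝ}
    (hr : ∀ v ∈ P, 0 ≤ bilin S r v) : 0 ≤ quad S r := by
  by_contra hneg
  push Not at hneg
  obtain ⟨v, hv⟩ := hP.nonempty
  have hvq := hP.quad_pos hv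
  have hrv := hr v hv
  have hvr : 0 ≤ bilin S v r := by rwa [bilin_comm hS.symm]
  set s : ℝ := -bilin S v r / (2 * quad S r) with hs
  have hs0 : 0 ≤ s := div_nonneg_of_nonpos (by linarith) (by linarith)
  have hsr : s * (2 * quad S r) = -bilin S v r := by
    rw [hs, div_mul_cancel₀ _ (by linarith)]
  have hw : v + s • r ∈ P := by
    rw [hP.mem_iff hS hv]
    have h1 := quad_add_smul hS.symm 1 s v r
    rw [one_smul] at h1
    rw [h1, bilin_add_right, bilin_smul_right, bilin_self]
    constructor
    · nlinarith [mul_nonneg hs0 hvr]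
    · nlinarith [mul_nonneg hs0 hvr]
  have hcont : Continuous fun δ : ℝ => v + s • r + δ • r := by fun_prop
  have hnhds : ∀ᶠ δ : ℝ in 𝓝 0, v + s • r + δ • r ∈ P :=
    hcont.continuousAt.preimage_mem_nhds (by simpa using (hP.isOpen hS).mem_nhds hw)
  obtain ⟨δ, hδ, hδ0⟩ := ((hnhds.filter_mono nhdsWithin_le_nhds).and
    (self_mem_nhdsWithin (s := Set.Ioi (0 : ℝ)))).exists
  have h2 := hr _ hδ
  rw [bilin_add_right, bilin_add_right, bilin_smul_right, bilin_smul_right, bilin_self,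
    bilin_comm hS.symm r v] at h2
  have h3 : δ * (2 * quad S r) < 0 := mul_neg_of_pos_of_neg hδ0 (by linarith)
  linarith

end IsPositiveCone

end Lorentzian

/-! ### The action on the half-space and the cocycle relation -/

section Action

variable {S : Matrix ι ι ℤ}

/-- Complex conjugation of vectors. -/
def conjVec {J : Type*} (x : J → ℂ) : J → ℂ := fun i => (starRingEnd ℂ) (x i)

theorem bilin_self_re_im (hS : S.IsSymm) (y : ι → ℂ) :
    bilin S y y = ((bilin S (fun i => (y i).re) (fun i => (y i).re) -
      bilin S (fun i => (y i).im) (fun i => (y i).im) : ℝ) : ℂ) +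
        ((2 * bilin S (fun i => (y i).re) (fun i => (y i).im) : ℝ) : ℂ) * Complex.I := by
  have hcast : ∀ u v : ι → ℝ, ((bilin S u v : ℝ) : ℂ) =
      bilin S (fun i => (u i : ℂ)) (fun i => (v i : ℂ)) := by
    intro u v; simp [bilin, dotProduct, mulVec]
  have hy : y = (fun i => ((y i).re : ℂ)) + Complex.I • fun i => ((y i).im : ℂ) := by
    funext i
    simp [mul_comm Complex.I, Complex.re_add_im]
  push_cast
  rw [hcast, hcast, hcast]
  nth_rw 1 2 [hy]
  rw [bilin_add_left, bilin_add_right, bilin_add_right, bilin_smul_left, bilin_smul_right,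
    bilin_smul_left, bilin_smul_right, bilin_comm hS (fun i => ((y i).im : ℂ))
      fun i => ((y i).re : ℂ)]
  linear_combination (bilin S (fun i => ((y i).im : ℂ)) fun i => ((y i).im : ℂ)) * Complex.I_sq

theorem bilin_conj_re_im (hS : S.IsSymm) (y : ι → ℂ) :
    bilin S y (conjVec y) = ((bilin S (fun i => (y i).re) (fun i => (y i).re) +
      bilin S (fun i => (y i).im) (fun i => (y i).im) : ℝ) : ℂ) := by
  have hcast : ∀ u v : ι → ℝ, ((bilin S u v : ℝ) : ℂ) =
      bilin S (fun i => (u i : ℂ)) (fun i => (v i : ℂ)) := by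
    intro u v; simp [bilin, dotProduct, mulVec]
  have hy : y = (fun i => ((y i).re : ℂ)) + Complex.I • fun i => ((y i).im : ℂ) := by
    funext i
    simp [mul_comm Complex.I, Complex.re_add_im]
  have hy' : conjVec y = (fun i => ((y i).re : ℂ)) + (-Complex.I) • fun i => ((y i).im : ℂ) := by
    funext i
    apply Complex.ext <;> simp [conjVec]
  push_cast
  rw [hcast, hcast, hy']
  nth_rw 1 [hy]
  rw [bilin_add_left, bilin_add_right, bilin_add_right, bilin_smul_left, bilin_smul_right,
    bilin_smul_left, bilin_smul_right, bilin_comm hS (fun i => ((y i).im : ℂ))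
      fun i => ((y i).re : ℂ)]
  linear_combination (-bilin S (fun i => ((y i).im : ℂ)) fun i => ((y i).im : ℂ)) * Complex.I_sq

theorem bilin_lift_self (z : ι → ℂ) : bilin (bigGram S) (lift S z) (lift S z) = 0 := by
  rw [lift_eq_vec, bilin_bigGram, quad]; ring

/-- The hermitian norm of a lift measures the imaginary part; as an orthogonal invariant it shows
that the action preserves the sign of that norm. -/
theorem bilin_lift_conj (hS : S.IsSymm) (z : ι → ℂ) :
    bilin (bigGram S) (lift S z) (conjVec (lift S z)) =
      ((4 * quad S (fun i => (z i).im) : ℝ) : ℂ) := by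
  have h1 : conjVec (lift S z) = vec (-(starRingEnd ℂ) (quad S z)) (conjVec z) 1 := by
    funext j
    rcases j with j | j | j <;> simp [conjVec, lift, vec]
  rw [h1, lift_eq_vec, bilin_bigGram, bilin_conj_re_im hS, quad, bilin_self_re_im hS, quad]
  simp only [map_div₀, map_add, map_mul, Complex.conj_ofReal, Complex.conj_I, map_ofNat]
  push_cast
  ring

/-- If the last coordinate vanished, the real and imaginary parts of the middle block would be
orthogonal vectors of equal positive norm, which signature `(1, ℓ - 1)` excludes. -/
theorem last_ne_zero_of_isotropic (hS : IsEvenLorentzian S) {Z : Unit ⊕ ι ⊕ Unit → ℂ}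
    (h0 : bilin (bigGram S) Z Z = 0) {c : ℝ} (hc : 0 < c)
    (h1 : bilin (bigGram S) Z (conjVec Z) = (c : ℂ)) : last Z ≠ 0 := by
  intro hl
  obtain ⟨a, y, rfl⟩ : ∃ a y, Z = vec a y 0 := ⟨Z (Sum.inl ()), mid Z, by rw [← hl, vec_eta]⟩
  have hconj : conjVec (vec a y 0) = vec ((starRingEnd ℂ) a) (conjVec y) 0 := by
    funext j
    rcases j with j | j | j <;> simp [conjVec, vec]
  rw [hconj, bilin_bigGram, mul_zero, zero_mul, zero_add, add_zero, bilin_conj_re_im hS.symm,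
    Complex.ofReal_inj] at h1
  rw [bilin_bigGram, mul_zero, zero_mul, zero_add, add_zero, bilin_self_re_im hS.symm] at h0
  have hre := congrArg Complex.re h0
  have him := congrArg Complex.im h0
  simp only [Complex.add_re, Complex.add_im, Complex.mul_re, Complex.mul_im, Complex.ofReal_re,
    Complex.ofReal_im, Complex.I_re, Complex.I_im, Complex.zero_re, Complex.zero_im, mul_zero,
    mul_one, add_zero, sub_zero, zero_add] at hre him
  set u : ι → ℝ := fun i => (y i).re
  set v : ι → ℝ := fun i => (y i).im
  have hu : 0 < quad S u := by
    have : quad S u = bilin S u u / 2 := rfl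
    linarith
  have hv : 0 < quad S v := by
    have : quad S v = bilin S v v / 2 := rfl
    linarith
  have hv0 : v ≠ 0 := by
    intro h
    rw [h] at hv
    simp [quad, bilin] at hv
  linarith [hS.quad_neg_of_orth hu (by linarith : bilin S u v = 0) hv0]

theorem bilin_mulVec_of_orthogonal {M : Matrix (Unit ⊕ ι ⊕ Unit) (Unit ⊕ ι ⊕ Unit) ℝ}
    (hM : M ∈ orthogonalSet S) (X Y : Unit ⊕ ι ⊕ Unit → ℂ) :
    bilin (bigGram S) (M.map (algebraMap ℝ ℂ) *ᵥ X) (M.map (algebraMap ℝ ℂ) *ᵥ Y) =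
      bilin (bigGram S) X Y := by
  have hG : (bigGram S).map (Int.cast : ℤ → ℂ) =
      ((bigGram S).map (Int.cast : ℤ → ℝ)).map (algebraMap ℝ ℂ) := by
    ext i j; simp
  have h1 : (M.map (algebraMap ℝ ℂ))ᵀ * (bigGram S).map (Int.cast : ℤ → ℂ) *
      M.map (algebraMap ℝ ℂ) = (bigGram S).map (Int.cast : ℤ → ℂ) := by
    rw [hG, ← transpose_map, ← Matrix.map_mul, ← Matrix.map_mul]
    exact congrArg (fun A => A.map (algebraMap ℝ ℂ)) hM
  rw [bilin, dotProduct_mulVec_mulVec, h1, bilin]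

/-- The action of an orthogonal matrix on the points whose imaginary part has positive norm. -/
theorem mulVec_lift (hS : IsEvenLorentzian S)
    {M : Matrix (Unit ⊕ ι ⊕ Unit) (Unit ⊕ ι ⊕ Unit) ℝ} (hM : M ∈ orthogonalSet S) {z : ι → ℂ}
    (hz : 0 < quad S (fun i => (z i).im)) :
    autFactor S M z ≠ 0 ∧
      M.map (algebraMap ℝ ℂ) *ᵥ lift S z = autFactor S M z • lift S (moebius S M z) ∧
      0 < quad S (fun i => (moebius S M z i).im) := by
  set Z := M.map (algebraMap ℝ ℂ) *ᵥ lift S z with hZ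
  have hconj : conjVec Z = M.map (algebraMap ℝ ℂ) *ᵥ conjVec (lift S z) := by
    funext i
    simp [hZ, conjVec, mulVec, dotProduct]
  have h0 : bilin (bigGram S) Z Z = 0 := by
    rw [hZ, bilin_mulVec_of_orthogonal hM, bilin_lift_self]
  have h1 : bilin (bigGram S) Z (conjVec Z) = ((4 * quad S (fun i => (z i).im) : ℝ) : ℂ) := by
    rw [hconj, hZ, bilin_mulVec_of_orthogonal hM, bilin_lift_conj hS.symm]
  have hl : last Z ≠ 0 := last_ne_zero_of_isotropic hS h0 (by positivity) h1
  have hj : autFactor S M z = last Z := rfl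
  have hmid : moebius S M z = (last Z)⁻¹ • mid Z := by
    funext i
    simp only [moebius, hj, Pi.smul_apply, smul_eq_mul, mid]
    rw [div_eq_inv_mul]
  have hlift : Z = last Z • lift S (moebius S M z) := by
    rw [← vec_eta Z, bilin_bigGram] at h0
    have hq : quad S (moebius S M z) = (last Z)⁻¹ ^ 2 * (bilin S (mid Z) (mid Z) / 2) := by
      rw [hmid, quad, bilin_smul_left, bilin_smul_right]; ring
    rw [lift_eq_vec, vec_smul, hq, hmid]
    nth_rw 1 [← vec_eta Z]
    congr 1
    · field_simp
      linear_combination h0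
    · rw [smul_smul, mul_inv_cancel₀ hl, one_smul]
    · rw [mul_one]
  refine ⟨hj ▸ hl, by rw [hj]; exact hlift, ?_⟩
  -- Comparing hermitian norms gives `|j|² Q(Im(M · z)) = Q(Im z)`.
  have h2 := h1
  rw [hlift] at h2
  have hc2 : conjVec (last Z • lift S (moebius S M z)) =
      (starRingEnd ℂ) (last Z) • conjVec (lift S (moebius S M z)) := by
    funext i
    simp [conjVec]
  rw [hc2, bilin_smul_left, bilin_smul_right, bilin_lift_conj hS.symm, ← mul_assoc,
    Complex.mul_conj, ← Complex.ofReal_mul, Complex.ofReal_inj] at h2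
  have h3 : 0 < Complex.normSq (last Z) := Complex.normSq_pos.2 hl
  by_contra hcon
  push Not at hcon
  nlinarith [mul_nonneg h3.le (neg_nonneg.2 hcon)]

theorem one_mem_orthogonalSet (S : Matrix ι ι ℤ) : 1 ∈ orthogonalSet S := by
  simp [orthogonalSet]

theorem SOPlus_subset (S : Matrix ι ι ℤ) : SOPlus S ⊆ orthogonalSet S :=
  connectedComponentIn_subset _ _

theorem one_mem_SOPlus (S : Matrix ι ι ℤ) : 1 ∈ SOPlus S :=
  mem_connectedComponentIn (one_mem_orthogonalSet S)

theorem mul_mem_orthogonalSet {M N : Matrix (Unit ⊕ ι ⊕ Unit) (Unit ⊕ ι ⊕ Unit) ℝ}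
    (hM : M ∈ orthogonalSet S) (hN : N ∈ orthogonalSet S) : M * N ∈ orthogonalSet S := by
  simp only [orthogonalSet, Set.mem_ofPred_eq] at *
  rw [transpose_mul]
  calc _ = Nᵀ * (Mᵀ * (bigGram S).map (Int.cast : ℤ → ℝ) * M) * N := by
        simp only [Matrix.mul_assoc]
    _ = _ := by rw [hM, hN]

theorem moebius_one (z : ι → ℂ) : moebius S 1 z = z := by
  funext i
  simp [moebius, autFactor, lift]

/-- The identity component preserves the upper half-space. -/
theorem moebius_mem (hS : IsEvenLorentzian S) {P : Set (ι → ℝ)} (hP : IsPositiveCone S P)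
    {M : Matrix (Unit ⊕ ι ⊕ Unit) (Unit ⊕ ι ⊕ Unit) ℝ} (hM : M ∈ SOPlus S) {z : ι → ℂ}
    (hz : z ∈ upperHalfSpace P) : moebius S M z ∈ upperHalfSpace P := by
  have hq := hP.quad_pos hz
  let g : Matrix (Unit ⊕ ι ⊕ Unit) (Unit ⊕ ι ⊕ Unit) ℝ → ι → ℝ :=
    fun M i => (moebius S M z i).im
  have hcoord : ∀ j, Continuous fun M : Matrix (Unit ⊕ ι ⊕ Unit) (Unit ⊕ ι ⊕ Unit) ℝ =>
      (M.map (algebraMap ℝ ℂ) *ᵥ lift S z) j := by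
    intro j
    unfold mulVec dotProduct
    simp only [map_apply, Complex.coe_algebraMap]
    exact continuous_finsetSum _ fun i _ =>
      (Complex.continuous_ofReal.comp (continuous_apply_apply j i)).mul continuous_const
  have hg : ContinuousOn g (orthogonalSet S) := by
    refine continuousOn_pi.2 fun i => ?_
    refine Complex.continuous_im.comp_continuousOn ?_
    exact (hcoord _).continuousOn.div (hcoord _).continuousOn
      fun M hM => (mulVec_lift hS hM hq).1
  -- The imaginary parts of `M · z`, as `M` varies in the identity component, form a connected set
  -- of vectors of positive norm containing `Im z`.
  have hpre : IsPreconnected (g '' SOPlus S) :=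
    isPreconnected_connectedComponentIn.image g (hg.mono (SOPlus_subset S))
  have hsub : g '' SOPlus S ⊆ {x : ι → ℝ | 0 < quad S x} := by
    rintro _ ⟨N, hN, rfl⟩
    exact (mulVec_lift hS (SOPlus_subset S hN) hq).2.2
  have h1 : (fun i => (z i).im) ∈ g '' SOPlus S :=
    ⟨1, one_mem_SOPlus S, by simp only [g, moebius_one]⟩
  change g M ∈ P
  rw [hP.eq_component hz]
  exact hpre.subset_connectedComponentIn h1 hsub ⟨M, hM, rfl⟩

/-- The cocycle property. -/
theorem autFactor_mul (hS : IsEvenLorentzian S)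
    {M N : Matrix (Unit ⊕ ι ⊕ Unit) (Unit ⊕ ι ⊕ Unit) ℝ}
    (hN : N ∈ orthogonalSet S) {z : ι → ℂ} (hz : 0 < quad S (fun i => (z i).im)) :
    autFactor S (M * N) z = autFactor S N z * autFactor S M (moebius S N z) ∧
      moebius S (M * N) z = moebius S M (moebius S N z) := by
  obtain ⟨hj, hl, -⟩ := mulVec_lift hS hN hz
  have h1 : (M * N).map (algebraMap ℝ ℂ) *ᵥ lift S z =
      autFactor S N z • (M.map (algebraMap ℝ ℂ) *ᵥ lift S (moebius S N z)) := by
    rw [Matrix.map_mul, ← mulVec_mulVec, hl, mulVec_smul]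
  have h2 : autFactor S (M * N) z = autFactor S N z * autFactor S M (moebius S N z) := by
    rw [autFactor, h1]; rfl
  refine ⟨h2, ?_⟩
  funext i
  rw [moebius, h2, h1, moebius, Pi.smul_apply, smul_eq_mul, mul_div_mul_left _ _ hj]

theorem slash_mul (hS : IsEvenLorentzian S) (k : ℤ) (F : (ι → ℂ) → ℂ)
    {M N : Matrix (Unit ⊕ ι ⊕ Unit) (Unit ⊕ ι ⊕ Unit) ℝ}
    (hN : N ∈ orthogonalSet S) {z : ι → ℂ} (hz : 0 < quad S (fun i => (z i).im)) :
    slash S k F (M * N) z = slash S k (slash S k F M) N z := by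
  obtain ⟨h1, h2⟩ := autFactor_mul (M := M) hS hN hz
  simp only [slash, h1, h2, mul_zpow]
  ring

end Action

/-! ### Extending isometries of the sublattice by the identity on `lam` -/

section Extension

/-- The matrix of the inclusion of the sublattice with basis `e`, enlarged by hyperbolic planes. -/
def inclMat (e : κ → ι → ℤ) : Matrix (Unit ⊕ ι ⊕ Unit) (Unit ⊕ κ ⊕ Unit) ℤ :=
  fromBlocks 1 0 0 (fromBlocks (of fun i k => e k i) 0 0 1)

variable {K : Type*} [Field K]

theorem inclMat_mulVec (e : κ → ι → ℤ) (a : K) (y : κ → K) (c : K) :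
    (inclMat e).map (Int.cast : ℤ → K) *ᵥ vec a y c = vec a (embed e y) c := by
  funext j
  rcases j with j | j | j
  · simp [inclMat, vec, mulVec, dotProduct]
  · simp [inclMat, vec, mulVec, dotProduct, embed, ofInt, mul_comm]
  · simp [inclMat, vec, mulVec, dotProduct]

theorem inclMat_gram (S : Matrix ι ι ℤ) (e : κ → ι → ℤ) :
    (inclMat e)ᵀ * bigGram S * inclMat e = bigGram (gramOf S e) := by
  have h0 : (of fun (i : ι) (k : κ) => e k i)ᵀ * S * (of fun i k => e k i) = gramOf S e := by
    ext i j
    rw [Matrix.mul_assoc, mul_apply_eq_vecMul]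
    rfl
  simp only [inclMat, bigGram, fromBlocks_transpose, fromBlocks_multiply, transpose_one,
    transpose_zero, Matrix.mul_zero, Matrix.zero_mul, Matrix.one_mul, Matrix.mul_one, zero_add,
    add_zero]
  rw [← h0]
  congr 1
  · ext i j
    rcases j with j | j <;> simp [mul_apply, Fintype.sum_sum_type]
  · ext i j
    rcases i with i | i <;> simp [mul_apply, Fintype.sum_sum_type]

/-- The coordinates of the orthogonal projection, as a real matrix. -/
def projMat (S : Matrix ι ι ℤ) (e : κ → ι → ℤ) :
    Matrix (Unit ⊕ κ ⊕ Unit) (Unit ⊕ ι ⊕ Unit) ℝ :=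
  hyp ((gramOf S e).map (Int.cast : ℤ → ℝ))⁻¹ *
    (((inclMat e).map (Int.cast : ℤ → ℝ))ᵀ * (bigGram S).map (Int.cast : ℤ → ℝ))

/-- The extension of an endomorphism of the smaller space that acts trivially on the orthogonal
complement. -/
def extMat (S : Matrix ι ι ℤ) (e : κ → ι → ℤ)
    (M : Matrix (Unit ⊕ κ ⊕ Unit) (Unit ⊕ κ ⊕ Unit) ℝ) :
    Matrix (Unit ⊕ ι ⊕ Unit) (Unit ⊕ ι ⊕ Unit) ℝ :=
  1 + (inclMat e).map (Int.cast : ℤ → ℝ) * (M - 1) * projMat S e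

variable {S : Matrix ι ι ℤ} {e : κ → ι → ℤ} {lam : ι → ℤ} {m : ℤ}

theorem map_intCast_mul {α β γ : Type*} [Fintype β] (A : Matrix α β ℤ) (B : Matrix β γ ℤ) :
    (A * B).map (Int.cast : ℤ → ℝ) =
      (A.map (Int.cast : ℤ → ℝ) : Matrix α β ℝ) * (B.map (Int.cast : ℤ → ℝ) : Matrix β γ ℝ) := by
  ext i j
  simp [mul_apply]

theorem inclMat_gram_real (S : Matrix ι ι ℤ) (e : κ → ι → ℤ) :
    ((inclMat e).map (Int.cast : ℤ → ℝ))ᵀ * (bigGram S).map (Int.cast : ℤ → ℝ) *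
      (inclMat e).map (Int.cast : ℤ → ℝ) = (bigGram (gramOf S e)).map (Int.cast : ℤ → ℝ) := by
  rw [← inclMat_gram, map_intCast_mul, map_intCast_mul, transpose_map]

theorem gram_mul_projMat (h : IsOrthBasis S e lam m) :
    (bigGram (gramOf S e)).map (Int.cast : ℤ → ℝ) * projMat S e =
      ((inclMat e).map (Int.cast : ℤ → ℝ))ᵀ * (bigGram S).map (Int.cast : ℤ → ℝ) := by
  rw [projMat, ← Matrix.mul_assoc, bigGram_map (gramOf S e),
    hyp_mul_hyp (mul_nonsing_inv _ h.isUnit_det_gram), Matrix.one_mul]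

theorem transpose_projMat_mul_gram (h : IsOrthBasis S e lam m) :
    (projMat S e)ᵀ * (bigGram (gramOf S e)).map (Int.cast : ℤ → ℝ) =
      (bigGram S).map (Int.cast : ℤ → ℝ) * (inclMat e).map (Int.cast : ℤ → ℝ) := by
  have h1 := congrArg transpose (gram_mul_projMat h)
  rw [transpose_mul, transpose_mul, transpose_transpose, ← transpose_map, ← transpose_map,
    (isSymm_bigGram h.symm).eq, (isSymm_bigGram h.symm_gram).eq] at h1
  exact h1

theorem projMat_mul_inclMat (h : IsOrthBasis S e lam m) :
    projMat S e * (inclMat e).map (Int.cast : ℤ → ℝ) = 1 := by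
  rw [projMat, Matrix.mul_assoc, inclMat_gram_real, bigGram_map,
    hyp_mul_hyp (nonsing_inv_mul _ h.isUnit_det_gram)]

theorem extMat_mul_inclMat (h : IsOrthBasis S e lam m)
    (M : Matrix (Unit ⊕ κ ⊕ Unit) (Unit ⊕ κ ⊕ Unit) ℝ) :
    extMat S e M * (inclMat e).map (Int.cast : ℤ → ℝ) =
      (inclMat e).map (Int.cast : ℤ → ℝ) * M := by
  rw [extMat, Matrix.add_mul, Matrix.one_mul, Matrix.mul_assoc, projMat_mul_inclMat h,
    Matrix.mul_one, Matrix.mul_sub, Matrix.mul_one, add_sub_cancel]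

theorem extMat_one (S : Matrix ι ι ℤ) (e : κ → ι → ℤ) : extMat S e 1 = 1 := by
  simp [extMat]

/-- As inclusion and projection are adjoint, the Gram matrix changes by the conjugate under the
projection of `Mᵀ G M - G`, which is zero. -/
theorem extMat_mem_orthogonalSet (h : IsOrthBasis S e lam m)
    {M : Matrix (Unit ⊕ κ ⊕ Unit) (Unit ⊕ κ ⊕ Unit) ℝ} (hM : M ∈ orthogonalSet (gramOf S e)) :
    extMat S e M ∈ orthogonalSet S := by
  have hM' : Mᵀ * (bigGram (gramOf S e)).map (Int.cast : ℤ → ℝ) * M =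
    (bigGram (gramOf S e)).map (Int.cast : ℤ → ℝ) := hM
  have h1 := gram_mul_projMat h
  have h2 := transpose_projMat_mul_gram h
  have h3 := inclMat_gram_real S e
  change (extMat S e M)ᵀ * (bigGram S).map (Int.cast : ℤ → ℝ) * extMat S e M =
    (bigGram S).map (Int.cast : ℤ → ℝ)
  rw [extMat]
  generalize (bigGram (gramOf S e)).map (Int.cast : ℤ → ℝ) = GK at *
  generalize (bigGram S).map (Int.cast : ℤ → ℝ) = G at *
  generalize (inclMat e).map (Int.cast : ℤ → ℝ) = J at *
  generalize projMat S e = π at *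
  have h4 : G * (J * (M - 1) * π) = πᵀ * (GK * (M - 1)) * π := by
    rw [← Matrix.mul_assoc, ← Matrix.mul_assoc, ← h2]
    simp only [Matrix.mul_assoc]
  have h5 : (J * (M - 1) * π)ᵀ * G = πᵀ * ((M - 1)ᵀ * GK) * π := by
    rw [transpose_mul, transpose_mul, Matrix.mul_assoc, Matrix.mul_assoc, ← h1]
    simp only [Matrix.mul_assoc]
  have h6 : (J * (M - 1) * π)ᵀ * G * (J * (M - 1) * π) =
      πᵀ * ((M - 1)ᵀ * GK * (M - 1)) * π := by
    rw [transpose_mul, transpose_mul, ← h3]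
    simp only [Matrix.mul_assoc]
  have h7 : GK * (M - 1) + ((M - 1)ᵀ * GK + (M - 1)ᵀ * GK * (M - 1)) = 0 := by
    have h8 : GK * (M - 1) + ((M - 1)ᵀ * GK + (M - 1)ᵀ * GK * (M - 1)) = Mᵀ * GK * M - GK := by
      rw [transpose_sub, transpose_one]
      noncomm_ring
    rw [h8, hM', sub_self]
  calc _ = G + (G * (J * (M - 1) * π) + ((J * (M - 1) * π)ᵀ * G +
        (J * (M - 1) * π)ᵀ * G * (J * (M - 1) * π))) := by
        rw [transpose_add, transpose_one]
        noncomm_ring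
    _ = G := by
        rw [h4, h6, h5, ← Matrix.add_mul, ← Matrix.mul_add, ← Matrix.add_mul, ← Matrix.mul_add, h7]
        simp

/-- The extension is continuous in `M` and sends `1` to `1`, so the image of the identity component
is connected and contains `1`. -/
theorem extMat_mem_SOPlus (h : IsOrthBasis S e lam m)
    {M : Matrix (Unit ⊕ κ ⊕ Unit) (Unit ⊕ κ ⊕ Unit) ℝ} (hM : M ∈ SOPlus (gramOf S e)) :
    extMat S e M ∈ SOPlus S := by
  have hcont : Continuous (extMat S e) := by
    unfold extMat
    fun_prop
  have hpre : IsPreconnected (extMat S e '' SOPlus (gramOf S e)) :=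
    isPreconnected_connectedComponentIn.image _ hcont.continuousOn
  refine hpre.subset_connectedComponentIn ⟨1, one_mem_SOPlus _, extMat_one S e⟩ ?_ ⟨M, hM, rfl⟩
  rintro _ ⟨N, hN, rfl⟩
  exact extMat_mem_orthogonalSet h (SOPlus_subset _ hN)

theorem projMat_mulVec_lam (h : IsOrthBasis S e lam m) :
    projMat S e *ᵥ vec 0 (ofInt ℝ lam) 0 = 0 := by
  have h1 : ((inclMat e).map (Int.cast : ℤ → ℝ))ᵀ *ᵥ ((bigGram S).map (Int.cast : ℤ → ℝ) *ᵥ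
      vec 0 (ofInt ℝ lam) 0) = 0 := by
    rw [bigGram_map, hyp_mulVec]
    funext j
    rcases j with j | j | j
    · simp [inclMat, vec, mulVec, dotProduct]
    · have h2 : bilin S (ofInt ℝ (e j)) (ofInt ℝ lam) = 0 := by
        rw [bilin_ofInt, h.orth]; simp
      rw [bilin] at h2
      simpa [inclMat, vec, mulVec, dotProduct, ofInt] using h2
    · simp [inclMat, vec, mulVec, dotProduct]
  rw [projMat, ← mulVec_mulVec, ← mulVec_mulVec, h1, mulVec_zero]

theorem extMat_mulVec_lam (h : IsOrthBasis S e lam m)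
    (M : Matrix (Unit ⊕ κ ⊕ Unit) (Unit ⊕ κ ⊕ Unit) ℝ) :
    extMat S e M *ᵥ vec 0 (ofInt ℝ lam) 0 = vec 0 (ofInt ℝ lam) 0 := by
  rw [extMat, add_mulVec, one_mulVec, ← mulVec_mulVec, projMat_mulVec_lam h, mulVec_zero, add_zero]

theorem extMat_mulVec_lam_complex (h : IsOrthBasis S e lam m)
    (M : Matrix (Unit ⊕ κ ⊕ Unit) (Unit ⊕ κ ⊕ Unit) ℝ) :
    (extMat S e M).map (algebraMap ℝ ℂ) *ᵥ vec 0 (ofInt ℂ lam) 0 = vec 0 (ofInt ℂ lam) 0 := by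
  have h1 : (vec 0 (ofInt ℂ lam) 0 : Unit ⊕ ι ⊕ Unit → ℂ) =
      algebraMap ℝ ℂ ∘ vec 0 (ofInt ℝ lam) 0 := by
    funext j
    rcases j with j | j | j <;> simp [vec, ofInt]
  rw [h1]
  funext j
  rw [← RingHom.map_mulVec, extMat_mulVec_lam h]
  rfl

theorem extMat_mulVec_incl (h : IsOrthBasis S e lam m)
    (M : Matrix (Unit ⊕ κ ⊕ Unit) (Unit ⊕ κ ⊕ Unit) ℝ) (X : Unit ⊕ κ ⊕ Unit → ℂ) :
    (extMat S e M).map (algebraMap ℝ ℂ) *ᵥ ((inclMat e).map (Int.cast : ℤ → ℂ) *ᵥ X) =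
      (inclMat e).map (Int.cast : ℤ → ℂ) *ᵥ (M.map (algebraMap ℝ ℂ) *ᵥ X) := by
  have hI : (inclMat e).map (Int.cast : ℤ → ℂ) =
      ((inclMat e).map (Int.cast : ℤ → ℝ)).map (algebraMap ℝ ℂ) := by
    ext i j; simp
  rw [hI, mulVec_mulVec, mulVec_mulVec, ← Matrix.map_mul, ← Matrix.map_mul, extMat_mul_inclMat h]

theorem lift_embed (h : IsOrthBasis S e lam m) (z : κ → ℂ) :
    lift S (embed e z) = (inclMat e).map (Int.cast : ℤ → ℂ) *ᵥ lift (gramOf S e) z := by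
  rw [lift_eq_vec, lift_eq_vec, inclMat_mulVec, h.quad_embed]

/-- Lifts of points of the sublattice are images of smaller lifts under the inclusion, which
intertwines `M` with its extension. -/
theorem extMat_lift (h : IsOrthBasis S e lam m)
    (M : Matrix (Unit ⊕ κ ⊕ Unit) (Unit ⊕ κ ⊕ Unit) ℝ) (z : κ → ℂ) :
    autFactor S (extMat S e M) (embed e z) = autFactor (gramOf S e) M z ∧
      moebius S (extMat S e M) (embed e z) = embed e (moebius (gramOf S e) M z) := by
  have h1 : (extMat S e M).map (algebraMap ℝ ℂ) *ᵥ lift S (embed e z) =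
      vec ((M.map (algebraMap ℝ ℂ) *ᵥ lift (gramOf S e) z) (Sum.inl ()))
        (embed e (mid (M.map (algebraMap ℝ ℂ) *ᵥ lift (gramOf S e) z)))
        (last (M.map (algebraMap ℝ ℂ) *ᵥ lift (gramOf S e) z)) := by
    rw [lift_embed h, extMat_mulVec_incl h]
    nth_rw 1 [← vec_eta (M.map (algebraMap ℝ ℂ) *ᵥ lift (gramOf S e) z)]
    rw [inclMat_mulVec]
  have h2 : autFactor S (extMat S e M) (embed e z) = autFactor (gramOf S e) M z := by
    rw [autFactor, h1]; rfl
  refine ⟨h2, ?_⟩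
  have h3 : moebius (gramOf S e) M z = (autFactor (gramOf S e) M z)⁻¹ •
      mid (M.map (algebraMap ℝ ℂ) *ᵥ lift (gramOf S e) z) := by
    funext i
    simp only [moebius, Pi.smul_apply, smul_eq_mul, mid, div_eq_inv_mul]
  rw [h3, embed_smul]
  funext i
  rw [moebius, h1, h2, Pi.smul_apply, smul_eq_mul, div_eq_inv_mul]
  rfl

theorem extMat_bigBasis (h : IsOrthBasis S e lam m)
    (M : Matrix (Unit ⊕ κ ⊕ Unit) (Unit ⊕ κ ⊕ Unit) ℝ) (i : Unit ⊕ κ ⊕ Unit) :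
    (extMat S e M).map (algebraMap ℝ ℂ) *ᵥ bigBasis e i =
      ∑ k, M.map (algebraMap ℝ ℂ) k i • bigBasis e k := by
  have h1 : ∀ i, bigBasis e i = (inclMat e).map (Int.cast : ℤ → ℂ) *ᵥ Pi.single i 1 := by
    intro i
    rw [mulVec_single_one]
    funext j
    rcases i with i | i | i <;> rcases j with j | j | j <;>
      simp [bigBasis, inclMat, vec, ofInt]
  rw [h1 i, extMat_mulVec_incl h, mulVec_single_one]
  simp only [h1]
  conv_lhs => rw [← Finset.univ_sum_single ((M.map (algebraMap ℝ ℂ)).col i)]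
  rw [mulVec_sum]
  refine Finset.sum_congr rfl fun k _ => ?_
  rw [← mulVec_smul]
  congr 1
  funext j
  simp [Pi.single_apply]

/-- All entries of a real matrix are rational. -/
def IsRat {α β : Type*} (A : Matrix α β ℝ) : Prop := ∀ i j, ∃ q : ℚ, A i j = q

theorem IsRat.intCast {α β : Type*} (A : Matrix α β ℤ) : IsRat (A.map (Int.cast : ℤ → ℝ)) :=
  fun i j => ⟨A i j, by simp⟩

theorem IsRat.transpose {α β : Type*} {A : Matrix α β ℝ} (hA : IsRat A) : IsRat Aᵀ :=
  fun i j => hA j i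

theorem IsRat.add {α β : Type*} {A B : Matrix α β ℝ} (hA : IsRat A) (hB : IsRat B) :
    IsRat (A + B) := fun i j => by
  obtain ⟨p, hp⟩ := hA i j
  obtain ⟨q, hq⟩ := hB i j
  exact ⟨p + q, by simp [hp, hq]⟩

theorem IsRat.sub {α β : Type*} {A B : Matrix α β ℝ} (hA : IsRat A) (hB : IsRat B) :
    IsRat (A - B) := fun i j => by
  obtain ⟨p, hp⟩ := hA i j
  obtain ⟨q, hq⟩ := hB i j
  exact ⟨p - q, by simp [hp, hq]⟩

theorem IsRat.mul {α β γ : Type*} [Fintype β] {A : Matrix α β ℝ} {B : Matrix β γ ℝ}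
    (hA : IsRat A) (hB : IsRat B) : IsRat (A * B) := fun i j => by
  choose p hp using hA
  choose q hq using hB
  exact ⟨∑ k, p i k * q k j, by simp [mul_apply, hp, hq]⟩

theorem IsRat.one {α : Type*} [DecidableEq α] : IsRat (1 : Matrix α α ℝ) :=
  fun i j => ⟨if i = j then 1 else 0, by rw [one_apply]; split_ifs <;> simp⟩

theorem IsRat.inv {α : Type*} [Fintype α] [DecidableEq α] {A : Matrix α α ℝ} (hA : IsRat A)
    (hdet : IsUnit A.det) : IsRat A⁻¹ := by
  choose q hq using hA
  have hA' : A = (of q).map (algebraMap ℚ ℝ) := by ext i j; simp [hq]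
  have hq' : IsUnit (of q).det := by
    rw [isUnit_iff_ne_zero]
    intro h0
    apply hdet.ne_zero
    rw [hA', ← RingHom.mapMatrix_apply, ← RingHom.map_det, h0, map_zero]
  have hinv : A⁻¹ = (of q)⁻¹.map (algebraMap ℚ ℝ) := by
    apply inv_eq_left_inv
    rw [hA', ← Matrix.map_mul, nonsing_inv_mul _ hq']
    simp
  intro i j
  exact ⟨(of q)⁻¹ i j, by rw [hinv]; rfl⟩

theorem IsRat.hyp {A : Matrix κ κ ℝ} (hA : IsRat A) : IsRat (hyp A) := by
  intro i j
  rcases i with i | i | i <;> rcases j with j | j | j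
  case inr.inl.inr.inl => exact hA i j
  all_goals first
    | (refine ⟨0, ?_⟩; simp [HigherPullback.hyp]; done)
    | (refine ⟨1, ?_⟩; cases i; cases j; simp [HigherPullback.hyp])

theorem extMat_rational (h : IsOrthBasis S e lam m)
    {M : Matrix (Unit ⊕ κ ⊕ Unit) (Unit ⊕ κ ⊕ Unit) ℝ} (hM : IsRat M) :
    IsRat (extMat S e M) :=
  IsRat.one.add (((IsRat.intCast _).mul (hM.sub IsRat.one)).mul
    (((IsRat.intCast _).inv h.isUnit_det_gram).hyp.mul
      ((IsRat.intCast _).transpose.mul (IsRat.intCast _))))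

/-- The projection maps the dual of the large lattice into the dual of the small one, where `M - 1`
takes integral values; these are then included back. -/
theorem extMat_mem_modularGroup (h : IsOrthBasis S e lam m)
    {M : Matrix (Unit ⊕ κ ⊕ Unit) (Unit ⊕ κ ⊕ Unit) ℝ} (hM : M ∈ modularGroup (gramOf S e)) :
    extMat S e M ∈ modularGroup S := by
  refine ⟨extMat_mem_SOPlus h hM.1, fun x hx => ?_⟩
  have hdual : projMat S e *ᵥ x ∈ dualLattice (bigGram (gramOf S e)) := by
    intro y
    obtain ⟨n, hn⟩ := hx (inclMat e *ᵥ y)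
    refine ⟨n, ?_⟩
    rw [← hn, bilin_comm (isSymm_bigGram h.symm_gram), bilin_comm (isSymm_bigGram h.symm), bilin,
      mulVec_mulVec, gram_mul_projMat h, ← mulVec_mulVec, dotProduct_mulVec, vecMul_transpose,
      bilin]
    congr 1
    funext i
    simp [ofInt, mulVec, dotProduct]
  obtain ⟨y, hy⟩ := hM.2 _ hdual
  refine ⟨inclMat e *ᵥ y, ?_⟩
  rw [extMat, add_mulVec, one_mulVec, add_sub_cancel_left, ← mulVec_mulVec, ← mulVec_mulVec,
    sub_mulVec, one_mulVec, hy]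
  funext i
  simp [ofInt, mulVec, dotProduct]

end Extension

/-! ### The pullback as a restricted differential operator -/

section PullbackOperator

open TopologicalSpace

variable {S : Matrix ι ι ℤ} {e : κ → ι → ℤ} {lam : ι → ℤ} {m : ℤ} {P : Set (ι → ℝ)}

theorem isOpen_upperHalfSpace (hP : IsOpen P) : IsOpen (upperHalfSpace P) :=
  hP.preimage (continuous_pi fun i => Complex.continuous_im.comp (continuous_apply i))

/-- The upper half-space over an open cone, as an open set. -/
def halfSpace (P : Set (ι → ℝ)) (hP : IsOpen P) : Opens (ι → ℂ) :=
  ⟨upperHalfSpace P, isOpen_upperHalfSpace hP⟩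

theorem embed_im (e : κ → ι → ℤ) (z : κ → ℂ) :
    (fun i => (embed e z i).im) = embed e fun k => (z k).im := by
  funext i
  simp [embed, ofInt]

theorem embed_mem_upperHalfSpace {z : κ → ℂ} :
    embed e z ∈ upperHalfSpace P ↔ z ∈ upperHalfSpace (subCone e P) := by
  simp only [upperHalfSpace, subCone, Set.mem_ofPred_eq, embed_im]

/-- The embedding of the sublattice as a continuous linear map. -/
def embedCLM (e : κ → ι → ℤ) : (κ → ℂ) →L[ℂ] (ι → ℂ) :=
  LinearMap.toContinuousLinearMap ⟨⟨embed e, embed_add e⟩, embed_smul e⟩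

theorem embedCLM_apply (e : κ → ι → ℤ) (z : κ → ℂ) : embedCLM e z = embed e z := rfl

theorem embed_single (e : κ → ι → ℤ) (i : κ) : embed e (Pi.single i (1 : ℂ)) = ofInt ℂ (e i) := by
  simp [embed, Pi.single_apply]

theorem iteratedDeriv_line {E : Type*} [NormedAddCommGroup E] [NormedSpace ℂ E] [ProperSpace E]
    {H : Opens E} (f : hol H) (v x : E) (p : ℕ) :
    ∀ w : ℂ, x + w • v ∈ H →
      iteratedDeriv p (fun w : ℂ => (f : E → ℂ) (x + w • v)) w =
        ((dd H v ^ p) f : E → ℂ) (x + w • v) := by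
  induction p with
  | zero => intro w _; simp
  | succ p ih =>
    intro w hw
    have hopen : ∀ᶠ u : ℂ in 𝓝 w, x + u • v ∈ H := by
      have hc : Continuous fun u : ℂ => x + u • v := by fun_prop
      exact hc.continuousAt.preimage_mem_nhds (H.isOpen.mem_nhds hw)
    have hev : iteratedDeriv p (fun w : ℂ => (f : E → ℂ) (x + w • v)) =ᶠ[𝓝 w]
        fun u => ((dd H v ^ p) f : E → ℂ) (x + u • v) := hopen.mono ih
    rw [iteratedDeriv_succ, hev.deriv_eq, pow_succ', Module.End.mul_apply, dd_apply _ _ hw]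
    have h4 : HasDerivAt (fun ζ : ℂ => x + ζ • v) v w := by
      simpa using ((hasDerivAt_id w).smul_const v).const_add x
    exact ((differentiableAt_hol _ hw).hasFDerivAt.comp_hasDerivAt w h4).deriv

/-- Chain rule for a linear embedding. It allows all differentiations on the sublattice to be done
on the ambient half-space, with restriction as the last step. -/
theorem partialDeriv_embed {H : Opens (ι → ℂ)} (f : hol H) {G : (κ → ℂ) → ℂ}
    (hG : ∀ u, embed e u ∈ H → G u = (f : (ι → ℂ) → ℂ) (embed e u)) (i : κ) {u : κ → ℂ}
    (hu : embed e u ∈ H) :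
    partialDeriv i G u = (dd H (ofInt ℂ (e i)) f : (ι → ℂ) → ℂ) (embed e u) := by
  have hev : G =ᶠ[𝓝 u] fun u => (f : (ι → ℂ) → ℂ) (embedCLM e u) := by
    have h1 : ∀ᶠ v in 𝓝 u, embedCLM e v ∈ H :=
      (embedCLM e).continuous.continuousAt.preimage_mem_nhds (H.isOpen.mem_nhds hu)
    exact h1.mono fun v hv => hG v hv
  have h2 : fderiv ℂ ((f : (ι → ℂ) → ℂ) ∘ embedCLM e) u = _ :=
    ((differentiableAt_hol f hu).hasFDerivAt.comp u (embedCLM e).hasFDerivAt).fderiv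
  rw [partialDeriv, hev.fderiv_eq]
  change fderiv ℂ ((f : (ι → ℂ) → ℂ) ∘ embedCLM e) u _ = _
  rw [h2, dd_apply _ _ hu, ContinuousLinearMap.comp_apply,
    embedCLM_apply, embed_single]

/-- The Laplace operator of the sublattice on the functions of the ambient space. -/
def subLapl (S : Matrix ι ι ℤ) (e : κ → ι → ℤ) (H : Opens (ι → ℂ)) : Module.End ℂ (hol H) :=
  lapl ((gramOf S e).map (Int.cast : ℤ → ℂ))⁻¹ fun i => dd H (ofInt ℂ (e i))

theorem laplacian_embed {H : Opens (ι → ℂ)} (f : hol H) {G : (κ → ℂ) → ℂ}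
    (hG : ∀ u, embed e u ∈ H → G u = (f : (ι → ℂ) → ℂ) (embed e u)) {u : κ → ℂ}
    (hu : embed e u ∈ H) :
    laplacian (gramOf S e) G u = (subLapl S e H f : (ι → ℂ) → ℂ) (embed e u) := by
  rw [laplacian, subLapl, lapl_apply]
  simp only [Submodule.coe_smul, Pi.smul_apply, smul_eq_mul, AddSubmonoidClass.coe_finsetSum,
    Finset.sum_apply]
  congr 1
  refine Finset.sum_congr rfl fun i _ => Finset.sum_congr rfl fun j _ => ?_
  rw [partialDeriv_embed (dd H (ofInt ℂ (e j)) f)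
    (fun v hv => partialDeriv_embed f hG j hv) i hu]

theorem laplacian_iterate_embed {H : Opens (ι → ℂ)} (f : hol H) {G : (κ → ℂ) → ℂ}
    (hG : ∀ u, embed e u ∈ H → G u = (f : (ι → ℂ) → ℂ) (embed e u)) (n : ℕ) :
    ∀ u, embed e u ∈ H → (laplacian (gramOf S e))^[n] G u =
      ((subLapl S e H ^ n) f : (ι → ℂ) → ℂ) (embed e u) := by
  induction n with
  | zero => exact hG
  | succ n ih =>
    intro u hu
    rw [Function.iterate_succ_apply', pow_succ', Module.End.mul_apply]
    exact laplacian_embed _ ih hu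

/-- The differential operator whose restriction to the sublattice is the pullback. -/
def pullOp (S : Matrix ι ι ℤ) (e : κ → ι → ℤ) (k : ℤ) (N : ℕ) (lam : ι → ℤ)
    (H : Opens (ι → ℂ)) : Module.End ℂ (hol H) :=
  gegOp N (k + (1 - (Fintype.card ι : ℂ)) / 2) (-quad S (ofInt ℂ lam)) (subLapl S e H)
    (dd H (ofInt ℂ lam))

/-- Since differentiation in `w` is differentiation along `lam`, the pullback is an operator on the
fixed module `hol H` followed by restriction, and the operator identities above apply. -/
theorem pullback_eq (S : Matrix ι ι ℤ) (e : κ → ι → ℤ) (k : ℤ) (N : ℕ) (lam : ι → ℤ)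
    {H : Opens (ι → ℂ)} {F : (ι → ℂ) → ℂ} (hF : DifferentiableOn ℂ F H) {z : κ → ℂ}
    (hz : embed e z ∈ H) :
    pullback S e k N F lam z = ((2 * Real.pi * Complex.I) ^ N)⁻¹ *
      (pullOp S e k N lam H (cut H F hF) : (ι → ℂ) → ℂ) (embed e z) := by
  rw [pullback, pullOp, gegOp_apply]
  simp only [Submodule.coe_smul, Pi.smul_apply, smul_eq_mul, AddSubmonoidClass.coe_finsetSum,
    Finset.sum_apply]
  congr 1
  refine Finset.sum_congr rfl fun j _ => ?_
  congr 1
  refine laplacian_iterate_embed _ (fun u hu => ?_) j z hz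
  have h0 : embed e u + (0 : ℂ) • ofInt ℂ lam ∈ H := by simpa using hu
  have h1 := iteratedDeriv_line (cut H F hF) (ofInt ℂ lam) (embed e u) (N - 2 * j) 0 h0
  rw [zero_smul, add_zero] at h1
  rw [← h1]
  refine Filter.EventuallyEq.iteratedDeriv_eq _ ?_
  have hc : Continuous fun w : ℂ => embed e u + w • ofInt ℂ lam := by fun_prop
  have h2 : ∀ᶠ w : ℂ in 𝓝 0, embed e u + w • ofInt ℂ lam ∈ H :=
    hc.continuousAt.preimage_mem_nhds (H.isOpen.mem_nhds h0)
  exact h2.mono fun w hw => (cut_apply hF hw).symm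

theorem pullback_congr {k : ℤ} {N : ℕ} {H : Opens (ι → ℂ)} {F G : (ι → ℂ) → ℂ}
    (hF : DifferentiableOn ℂ F H) (hG : DifferentiableOn ℂ G H) (hFG : ∀ u ∈ H, F u = G u)
    {z : κ → ℂ} (hz : embed e z ∈ H) :
    pullback S e k N F lam z = pullback S e k N G lam z := by
  have h1 : cut H F hF = cut H G hG :=
    hol.ext_on fun u hu => by rw [cut_apply _ hu, cut_apply _ hu, hFG u hu]
  rw [pullback_eq S e k N lam hF hz, pullback_eq S e k N lam hG hz, h1]

theorem differentiableOn_pullback (hP : IsOpen P) (k : ℤ) (N : ℕ) {F : (ι → ℂ) → ℂ}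
    (hF : DifferentiableOn ℂ F (upperHalfSpace P)) :
    DifferentiableOn ℂ (pullback S e k N F lam) (upperHalfSpace (subCone e P)) := by
  have h1 : DifferentiableOn ℂ (fun z => ((2 * Real.pi * Complex.I) ^ N)⁻¹ *
      (pullOp S e k N lam (halfSpace P hP) (cut (halfSpace P hP) F hF) : (ι → ℂ) → ℂ)
        (embedCLM e z)) (upperHalfSpace (subCone e P)) :=
    ((Subtype.prop (pullOp S e k N lam (halfSpace P hP) (cut (halfSpace P hP) F hF))).1.comp
      (embedCLM e).differentiable.differentiableOn
      fun z hz => embed_mem_upperHalfSpace.2 hz).const_mul _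
  exact h1.congr fun z hz => pullback_eq S e k N lam (H := halfSpace P hP) hF
    (embed_mem_upperHalfSpace.2 hz)

theorem quad_zsmul (S : Matrix ι ι ℤ) (a : ℤ) (lam : ι → ℤ) :
    quad S (ofInt ℂ (a • lam)) = (a : ℂ) ^ 2 * quad S (ofInt ℂ lam) := by
  have h1 : ofInt ℂ (a • lam) = (a : ℂ) • ofInt ℂ lam := by funext i; simp [ofInt]
  rw [h1, quad, bilin_smul_left, bilin_smul_right, quad]
  ring

/-- In the `j`-th term the norm contributes `a ^ (2j)` and the derivatives along `lam` contribute `a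
^ (N - 2j)`. -/
theorem pullback_zsmul (hP : IsOpen P) (k : ℤ) (N : ℕ) {F : (ι → ℂ) → ℂ}
    (hF : DifferentiableOn ℂ F (upperHalfSpace P)) (a : ℤ) {z : κ → ℂ}
    (hz : z ∈ upperHalfSpace (subCone e P)) :
    pullback S e k N F (a • lam) z = (a : ℂ) ^ N * pullback S e k N F lam z := by
  rw [pullback_eq S e k N _ (H := halfSpace P hP) hF (embed_mem_upperHalfSpace.2 hz),
    pullback_eq S e k N _ (H := halfSpace P hP) hF (embed_mem_upperHalfSpace.2 hz), mul_left_comm]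
  congr 1
  have h1 : ofInt ℂ (a • lam) = (a : ℂ) • ofInt ℂ lam := by funext i; simp [ofInt]
  simp only [pullOp, gegOp_apply, Submodule.coe_smul, Pi.smul_apply, smul_eq_mul,
    AddSubmonoidClass.coe_finsetSum, Finset.sum_apply, quad_zsmul, Finset.mul_sum]
  refine Finset.sum_congr rfl fun j hj => ?_
  have hj' : 2 * j ≤ N := by
    have := Finset.mem_range.1 hj
    omega
  rw [h1, map_smul, smul_pow, LinearMap.smul_apply, map_smul, Submodule.coe_smul, Pi.smul_apply,
    smul_eq_mul, ← mul_neg, mul_pow, ← pow_mul]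
  have h2 : (a : ℂ) ^ N = (a : ℂ) ^ (2 * j) * (a : ℂ) ^ (N - 2 * j) := by
    rw [← pow_add]; congr 1; omega
  rw [h2]
  ring

theorem differentiable_lift (S : Matrix ι ι ℤ) : Differentiable ℂ (lift S) := by
  refine differentiable_pi.2 fun j => ?_
  rcases j with j | j | j
  · change Differentiable ℂ fun z => -quad S z
    unfold quad bilin dotProduct mulVec dotProduct
    fun_prop
  · exact differentiable_apply j
  · exact differentiable_const 1

theorem differentiable_mulVec_lift (S : Matrix ι ι ℤ)
    (M : Matrix (Unit ⊕ ι ⊕ Unit) (Unit ⊕ ι ⊕ Unit) ℝ) (j : Unit ⊕ ι ⊕ Unit) :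
    Differentiable ℂ fun z => (M.map (algebraMap ℝ ℂ) *ᵥ lift S z) j := by
  have h1 : ∀ i, Differentiable ℂ fun z => lift S z i := fun i =>
    (differentiable_pi.1 (differentiable_lift S)) i
  unfold mulVec dotProduct
  fun_prop

theorem differentiableOn_slash (hS : IsEvenLorentzian S) (hP : IsPositiveCone S P) (k : ℤ)
    {F : (ι → ℂ) → ℂ} (hF : DifferentiableOn ℂ F (upperHalfSpace P))
    {M : Matrix (Unit ⊕ ι ⊕ Unit) (Unit ⊕ ι ⊕ Unit) ℝ} (hM : M ∈ SOPlus S) :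
    DifferentiableOn ℂ (slash S k F M) (upperHalfSpace P) := by
  have hne : ∀ z ∈ upperHalfSpace P, autFactor S M z ≠ 0 := fun z hz =>
    (mulVec_lift hS (SOPlus_subset _ hM) (hP.quad_pos hz)).1
  have hj : Differentiable ℂ (autFactor S M) := differentiable_mulVec_lift S M _
  refine DifferentiableOn.mul (fun z hz => ?_) (hF.comp ?_ fun z hz => moebius_mem hS hP hM hz)
  · exact ((hj z).zpow (Or.inl (hne z hz))).differentiableWithinAt
  · refine differentiableOn_pi.2 fun i => ?_
    simp only [moebius, div_eq_mul_inv]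
    exact (differentiable_mulVec_lift S M _).differentiableOn.mul (hj.differentiableOn.inv hne)

theorem lift_mem_coneOver {H : Opens (ι → ℂ)} {z : ι → ℂ} (hz : z ∈ H) :
    lift S z ∈ coneOver H := by
  refine mem_coneOver.2 ⟨one_ne_zero, ?_⟩
  change (1 : ℂ)⁻¹ • z ∈ H
  simpa using hz

theorem amb_lift (k : ℤ) {H : Opens (ι → ℂ)} (F : hol H) {z : ι → ℂ} (hz : z ∈ H) :
    (amb k F : (Unit ⊕ ι ⊕ Unit → ℂ) → ℂ) (lift S z) = (F : (ι → ℂ) → ℂ) z := by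
  rw [amb_apply _ _ (lift_mem_coneOver hz)]
  change (1 : ℂ) ^ (-k) * (F : (ι → ℂ) → ℂ) ((1 : ℂ)⁻¹ • z) = _
  simp

/-- Isotropy determines the first coordinate from the others, so on the cone every homogeneous
function is known from its values on lifts. -/
theorem eq_smul_lift_of_isotropic {X : Unit ⊕ ι ⊕ Unit → ℂ} (hX : bilin (bigGram S) X X = 0)
    (hl : last X ≠ 0) : X = last X • lift S ((last X)⁻¹ • mid X) := by
  rw [lift_eq_vec, vec_smul, smul_smul, mul_inv_cancel₀ hl, one_smul, mul_one]
  nth_rw 1 [← vec_eta X]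
  rw [← vec_eta X, bilin_bigGram] at hX
  congr 1
  rw [quad, bilin_smul_left, bilin_smul_right]
  field_simp
  linear_combination hX

/-- The pullback commutes with the slash operators. -/
theorem slash_pullback (h : IsOrthBasis S e lam m) (hS : IsEvenLorentzian S)
    (hP : IsPositiveCone S P) (k : ℤ) (N : ℕ) {F : (ι → ℂ) → ℂ}
    (hF : DifferentiableOn ℂ F (upperHalfSpace P))
    {M : Matrix (Unit ⊕ κ ⊕ Unit) (Unit ⊕ κ ⊕ Unit) ℝ} (hM : M ∈ SOPlus (gramOf S e))
    {z : κ → ℂ} (hz : z ∈ upperHalfSpace (subCone e P)) :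
    slash (gramOf S e) (k + N) (pullback S e k N F lam) M z =
      pullback S e k N (slash S k F (extMat S e M)) lam z := by
  have hPo := hP.isOpen hS
  have hE := extMat_mem_SOPlus h hM
  have hG := differentiableOn_slash hS hP k hF hE
  set H := halfSpace P hPo
  set Mc := (extMat S e M).map (algebraMap ℝ ℂ) with hMc
  let A : (Unit ⊕ ι ⊕ Unit → ℂ) →L[ℂ] (Unit ⊕ ι ⊕ Unit → ℂ) := Mc.mulVecLin.toContinuousLinearMap
  have hlift : ∀ z ∈ H, autFactor S (extMat S e M) z ≠ 0 ∧
      A (lift S z) = autFactor S (extMat S e M) z • lift S (moebius S (extMat S e M) z) := by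
    intro z hz
    obtain ⟨h1, h2, -⟩ := mulVec_lift hS (SOPlus_subset _ hE) (hP.quad_pos hz)
    exact ⟨h1, h2⟩
  have hmoeb : ∀ z ∈ H, moebius S (extMat S e M) z ∈ H := fun z hz => moebius_mem hS hP hE hz
  have hx : embed e z ∈ H := embed_mem_upperHalfSpace.2 hz
  replace hF : DifferentiableOn ℂ F (H : Set (ι → ℂ)) := hF
  replace hG : DifferentiableOn ℂ (slash S k F (extMat S e M)) (H : Set (ι → ℂ)) := hG
  obtain ⟨hj, hml⟩ := extMat_lift h M z
  have hmx : embed e (moebius (gramOf S e) M z) ∈ H := by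
    rw [← hml]; exact hmoeb _ hx
  obtain ⟨hj0, hA0⟩ := hlift _ hx
  -- The Laplace operator is built from the inverse Gram matrix, so `Mᵀ G M = G` is turned into `M
  -- G⁻¹ Mᵀ = G⁻¹`.
  have hMx : M.map (algebraMap ℝ ℂ) * hyp ((gramOf S e).map (Int.cast : ℤ → ℂ))⁻¹ *
      (M.map (algebraMap ℝ ℂ))ᵀ = hyp ((gramOf S e).map (Int.cast : ℤ → ℂ))⁻¹ := by
    have h1 : (bigGram (gramOf S e)).map (Int.cast : ℤ → ℂ) =
        ((bigGram (gramOf S e)).map (Int.cast : ℤ → ℝ)).map (algebraMap ℝ ℂ) := by ext i j; simp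
    have h2 : Mᵀ * (bigGram (gramOf S e)).map (Int.cast : ℤ → ℝ) * M =
        (bigGram (gramOf S e)).map (Int.cast : ℤ → ℝ) := SOPlus_subset _ hM
    have h3 : (M.map (algebraMap ℝ ℂ))ᵀ * hyp ((gramOf S e).map (Int.cast : ℤ → ℂ)) *
        M.map (algebraMap ℝ ℂ) = hyp ((gramOf S e).map (Int.cast : ℤ → ℂ)) := by
      rw [← bigGram_map, h1, ← transpose_map, ← Matrix.map_mul, ← Matrix.map_mul, h2]
    have h4 := hyp_mul_hyp (nonsing_inv_mul _ (h.isUnit_det_gram (K := ℂ)))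
    have h5 := hyp_mul_hyp (mul_nonsing_inv _ (h.isUnit_det_gram (K := ℂ)))
    generalize hyp ((gramOf S e).map (Int.cast : ℤ → ℂ)) = GK at *
    generalize hyp ((gramOf S e).map (Int.cast : ℤ → ℂ))⁻¹ = T at *
    generalize M.map (algebraMap ℝ ℂ) = X at *
    have h6 : (T * Xᵀ * GK) * X = 1 := by
      rw [Matrix.mul_assoc T, Matrix.mul_assoc T, h3, h4]
    have h7 : X * (T * Xᵀ * GK) = 1 := mul_eq_one_comm.1 h6
    calc X * T * Xᵀ = X * (T * Xᵀ * GK) * T := by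
          rw [Matrix.mul_assoc X (T * Xᵀ * GK), Matrix.mul_assoc (T * Xᵀ), h5, Matrix.mul_one,
            Matrix.mul_assoc]
      _ = T := by rw [h7, Matrix.one_mul]
  have hbl : bilin (bigGram S) (vec 0 (ofInt ℂ lam) 0) (lift S (embed e z)) = 0 := by
    rw [lift_eq_vec, bilin_bigGram, bilin_comm h.symm, h.bilin_embed_lam]
    simp
  have hfin := gegOp_covariant h rfl (cut H F hF) (cut H (slash S k F (extMat S e M)) hG) A
    (Mx := M.map (algebraMap ℝ ℂ)) (extMat_bigBasis h M) hMx (extMat_mulVec_lam_complex h M)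
    -- On the cone `X` is a multiple of a lift, and there homogeneity and the factor of automorphy
    -- identify the two functions; this is the definition of the slash operator.
    (fun X hX hAX hQ => by
      obtain ⟨hl, hXH⟩ := mem_coneOver.1 hX
      obtain ⟨h1, h2⟩ := hlift _ hXH
      have hL := lift_mem_coneOver (S := S) hXH
      have hL' := lift_mem_coneOver (S := S) (hmoeb _ hXH)
      rw [eq_smul_lift_of_isotropic hQ hl, map_smul, h2, smul_smul,
        amb_smul_apply k _ hL' (mul_ne_zero hl h1), amb_smul_apply k _ hL hl, amb_lift k _ hXH,
        amb_lift k _ (hmoeb _ hXH), cut_apply _ (hmoeb _ hXH), cut_apply _ hXH, slash, mul_zpow,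
        mul_assoc])
    (lift_mem_coneOver hx)
    (by
      rw [hA0]
      exact (smul_mem_coneOver (lift_mem_coneOver (hmoeb _ hx)) hj0).1)
    (bilin_lift_self _) hbl N
  have hm : (m : ℂ) = -quad S (ofInt ℂ lam) := by
    rw [quad, h.bilin_lam_lam]; ring
  rw [hA0, amb_smul_apply _ _ (lift_mem_coneOver (hmoeb _ hx)) hj0, amb_lift _ _ hx,
    amb_lift _ _ (hmoeb _ hx), hm, hml, hj] at hfin
  rw [slash, pullback_eq S e k N lam (H := H) hF hmx, pullback_eq S e k N lam (H := H) hG hx,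
    mul_left_comm]
  congr 1

/-- The slash operator moves inside the pullback, where it becomes the slash by an element of the
larger modular group, which fixes `F`. -/
theorem slash_pullback_modularGroup (h : IsOrthBasis S e lam m) (hS : IsEvenLorentzian S)
    (hP : IsPositiveCone S P) {k : ℤ} (N : ℕ) {F : (ι → ℂ) → ℂ} (hF : IsModularForm S P k F)
    {M : Matrix (Unit ⊕ κ ⊕ Unit) (Unit ⊕ κ ⊕ Unit) ℝ} (hM : M ∈ modularGroup (gramOf S e))
    {z : κ → ℂ} (hz : z ∈ upperHalfSpace (subCone e P)) :
    slash (gramOf S e) (k + N) (pullback S e k N F lam) M z = pullback S e k N F lam z := by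
  have hE := extMat_mem_modularGroup h hM
  have hPo := hP.isOpen hS
  have hx : embed e z ∈ halfSpace P hPo := embed_mem_upperHalfSpace.2 hz
  rw [slash_pullback h hS hP k N hF.holomorphic hM.1 hz]
  exact pullback_congr (differentiableOn_slash hS hP k hF.holomorphic hE.1) hF.holomorphic
    (H := halfSpace P hPo) (fun u hu => hF.slash_eq _ hE u hu) hx

end PullbackOperator

/-! ### Fourier coefficients on the torus -/

section Torus

open MeasureTheory UnitAddTorus

variable {J : Type*} [Fintype J]

/-- The projection onto the torus. -/
def toTorus (x : J → ℝ) : UnitAddTorus J := fun i => (x i : UnitAddCircle)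

/-- A half-open unit box. -/
def unitBox (a : J → ℝ) : Set (J → ℝ) := {x | ∀ i, x i ∈ Set.Ioc (a i) (a i + 1)}

theorem unitBox_eq (a : J → ℝ) :
    unitBox a = Set.univ.pi fun i => Set.Ioc (a i) (a i + 1) := by
  ext x; simp [unitBox]

theorem volume_unitBox (a : J → ℝ) : volume (unitBox a) = 1 := by
  rw [unitBox_eq, Real.volume_pi_Ioc]
  simp

theorem unitBox_ae_eq (a : J → ℝ) :
    unitBox a =ᵐ[volume] Set.Icc a fun i => a i + 1 := by
  rw [unitBox_eq]
  exact Measure.univ_pi_Ioc_ae_eq_Icc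

theorem mFourierCoeff_toTorus (f : UnitAddTorus J → ℂ) (n : J → ℤ) (a : J → ℝ) :
    mFourierCoeff f n = ∫ x in unitBox a, mFourier (-n) (toTorus x) * f (toTorus x) :=
  mFourierCoeff_eq_integral f n a

theorem continuous_toTorus : Continuous (toTorus (J := J)) :=
  continuous_pi fun i => (AddCircle.continuous_mk' (1 : ℝ)).comp (continuous_apply i)

theorem isOpenQuotientMap_toTorus : IsOpenQuotientMap (toTorus (J := J)) :=
  IsOpenQuotientMap.piMap fun _ => QuotientAddGroup.isOpenQuotientMap_mk

theorem toTorus_eq_iff {x y : J → ℝ} :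
    toTorus x = toTorus y ↔ ∃ n : J → ℤ, y = x + fun i => (n i : ℝ) := by
  have h1 : ∀ i, ((x i : ℝ) : UnitAddCircle) = (y i : ℝ) ↔ ∃ n : ℤ, y i = x i + n := by
    intro i
    rw [eq_comm, ← sub_eq_zero, ← AddCircle.coe_sub, AddCircle.coe_eq_zero_iff]
    refine exists_congr fun n => ?_
    rw [zsmul_eq_mul, mul_one]
    constructor <;> intro h <;> linarith
  rw [funext_iff]
  simp only [toTorus, h1]
  rw [Classical.skolem]
  exact exists_congr fun n => by rw [funext_iff]; rfl

theorem mFourier_toTorus (n : J → ℤ) (x : J → ℝ) :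
    mFourier n (toTorus x) = Complex.exp (2 * Real.pi * Complex.I * ∑ i, n i * (x i : ℂ)) := by
  simp only [mFourier, ContinuousMap.coe_mk, toTorus, fourier_coe_apply]
  rw [← Complex.exp_sum, Finset.mul_sum]
  congr 1
  refine Finset.sum_congr rfl fun i _ => ?_
  push_cast
  ring

theorem norm_mFourier_apply (n : J → ℤ) (x : UnitAddTorus J) : ‖mFourier n x‖ = 1 := by
  simp only [mFourier, fourier_apply, ContinuousMap.coe_mk, norm_prod, Circle.norm_coe,
    Finset.prod_const_one]

/-- Periodic continuous functions descend to the torus. -/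
theorem exists_toTorus {h : (J → ℝ) → ℂ} (hc : Continuous h)
    (hp : ∀ (x : J → ℝ) (n : J → ℤ), h (x + fun i => (n i : ℝ)) = h x) :
    ∃ φ : C(UnitAddTorus J, ℂ), ∀ x, φ (toTorus x) = h x := by
  have hq := isOpenQuotientMap_toTorus (J := J)
  let φ : UnitAddTorus J → ℂ := fun t => h (Function.surjInv hq.surjective t)
  have hφ : ∀ x, φ (toTorus x) = h x := by
    intro x
    obtain ⟨n, hn⟩ := toTorus_eq_iff.1 (Function.surjInv_eq hq.surjective (toTorus x))
    change h (Function.surjInv hq.surjective (toTorus x)) = h x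
    rw [hn, hp]
    congr 1
    rw [← hn]
  refine ⟨⟨φ, ?_⟩, hφ⟩
  rw [hq.isQuotientMap.continuous_iff]
  have : φ ∘ toTorus = h := funext hφ
  rwa [this]

theorem norm_mFourierCoeff_le {f : UnitAddTorus J → ℂ} {B : ℝ} (hB : ∀ x, ‖f (toTorus x)‖ ≤ B)
    (n : J → ℤ) : ‖mFourierCoeff f n‖ ≤ B := by
  rw [mFourierCoeff_toTorus f n 0]
  have h1 := norm_setIntegral_le_of_norm_le_const (μ := volume) (s := unitBox (0 : J → ℝ))
    (f := fun x => mFourier (-n) (toTorus x) * f (toTorus x)) (C := B)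
    (by rw [volume_unitBox]; exact ENNReal.one_lt_top)
    (fun x _ => by rw [norm_mul, norm_mFourier_apply, one_mul]; exact hB x)
  simpa [Measure.real, volume_unitBox] using h1

open Classical in
theorem mFourierCoeff_mFourier (m n : J → ℤ) :
    mFourierCoeff (mFourier m) n = if m = n then 1 else 0 := by
  have h1 := mFourierBasis_repr (mFourierLp 2 m) n
  rw [mFourierCoeff_toLp, ← coe_mFourierBasis, HilbertBasis.repr_self, lp.single_apply,
    Pi.single_apply] at h1
  rw [← h1]
  simp only [eq_comm]

open Classical in
-- Absolute convergence permits termwise integration, and the characters are orthonormal.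
theorem mFourierCoeff_of_hasSum {I : Type*} {a : I → ℂ} {n : I → J → ℤ}
    (hn : Function.Injective n) (ha : Summable a) {g : UnitAddTorus J → ℂ}
    (hg : ∀ x, HasSum (fun p => a p * mFourier (n p) (toTorus x)) (g (toTorus x))) (p : I) :
    mFourierCoeff g (n p) = a p := by
  have : Countable I := hn.countable
  have hfin : IsFiniteMeasure (volume.restrict (unitBox (0 : J → ℝ))) :=
    ⟨by simp [volume_unitBox]⟩
  have hnorm : ∀ q x, ‖mFourier (-n p) (toTorus x) * (a q * mFourier (n q) (toTorus x))‖ =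
      ‖a q‖ := by
    intro q x
    rw [norm_mul, norm_mul, norm_mFourier_apply, norm_mFourier_apply, one_mul, mul_one]
  have h1 := hasSum_integral_of_summable_integral_norm
    (μ := volume.restrict (unitBox (0 : J → ℝ)))
    (F := fun q x => mFourier (-n p) (toTorus x) * (a q * mFourier (n q) (toTorus x)))
    (fun q => by
      refine Integrable.of_bound (C := ‖a q‖) ?_ (ae_of_all _ fun x => (hnorm q x).le)
      have hc := continuous_toTorus (J := J)
      exact Continuous.aestronglyMeasurable (by fun_prop))
    (by
      simp only [hnorm]
      simpa [Measure.real, volume_unitBox] using ha.norm)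
  have h2 : ∀ x, ∑' q, mFourier (-n p) (toTorus x) * (a q * mFourier (n q) (toTorus x)) =
      mFourier (-n p) (toTorus x) * g (toTorus x) := fun x =>
    ((hg x).mul_left _).tsum_eq
  have h3 : ∀ q, ∫ x in unitBox (0 : J → ℝ),
      mFourier (-n p) (toTorus x) * (a q * mFourier (n q) (toTorus x)) =
        if q = p then a p else 0 := by
    intro q
    have h4 : ∀ x : J → ℝ, mFourier (-n p) (toTorus x) * (a q * mFourier (n q) (toTorus x)) =
      a q * (mFourier (-n p) (toTorus x) * mFourier (n q) (toTorus x)) := fun x => by ring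
    simp only [h4]
    rw [integral_const_mul, ← mFourierCoeff_toTorus, mFourierCoeff_mFourier]
    by_cases hqp : q = p
    · simp [hqp]
    · simp [hqp, hn.ne hqp]
  simp only [h2, h3, ← mFourierCoeff_toTorus] at h1
  exact h1.unique (hasSum_ite_eq p (a p))

/-- The coefficients of an absolutely convergent trigonometric series are bounded by its values. -/
theorem norm_coeff_le {I : Type*} {a : I → ℂ} {n : I → J → ℤ}
    (hn : Function.Injective n) {g : (J → ℝ) → ℂ} {B : ℝ} (hB : ∀ x, ‖g x‖ ≤ B)
    (hg : ∀ x, HasSum (fun p => a p *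
      Complex.exp (2 * Real.pi * Complex.I * ∑ i, n p i * (x i : ℂ))) (g x)) (p : I) :
    ‖a p‖ ≤ B := by
  have ha : Summable a := by
    have := (hg 0).summable
    simpa using this
  have hq := isOpenQuotientMap_toTorus (J := J)
  have hg' : ∀ x : J → ℝ, HasSum (fun p => a p * mFourier (n p) (toTorus x)) (g x) := fun x => by
    simpa only [mFourier_toTorus] using hg x
  -- The function `g` is arbitrary, but its periodicity follows from that of the series representing
  -- it.
  have hgx : ∀ x, g (Function.surjInv hq.surjective (toTorus x)) = g x := by
    intro x
    have h1 := hg' (Function.surjInv hq.surjective (toTorus x))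
    rw [Function.surjInv_eq hq.surjective] at h1
    exact h1.unique (hg' x)
  rw [← mFourierCoeff_of_hasSum hn ha
    (g := fun t => g (Function.surjInv hq.surjective t)) (fun x => by rw [hgx]; exact hg' x) p]
  exact norm_mFourierCoeff_le (fun x => hB _) _

/-- Both integrals are the zeroth Fourier coefficient, which may be computed over any unit box. -/
theorem integral_unitBox_eq {h : (J → ℝ) → ℂ} (hc : Continuous h)
    (hp : ∀ (x : J → ℝ) (n : J → ℤ), h (x + fun i => (n i : ℝ)) = h x) (t : J → ℝ) :
    ∫ x in unitBox 0, h (x + t) = ∫ x in unitBox 0, h x := by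
  obtain ⟨φ, hφ⟩ := exists_toTorus hc hp
  have h1 : ∀ a, mFourierCoeff φ 0 = ∫ x in unitBox a, h x := by
    intro a
    rw [mFourierCoeff_toTorus φ 0 a]
    simp [mFourier_zero, hφ]
  have h2 := (measurePreserving_add_right volume t).setIntegral_preimage_emb
    (measurableEmbedding_addRight t) h (unitBox t)
  rw [← h1 0, h1 t, ← h2]
  congr 2
  ext x
  simp only [unitBox, Set.mem_preimage, Set.mem_ofPred_eq, Set.mem_Ioc, Pi.add_apply, Pi.zero_apply]
  refine forall_congr' fun i => ?_
  constructor <;> rintro ⟨h1, h2⟩ <;> constructor <;> linarith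

end Torus

/-! ### Fourier expansion on tube domains -/

section Tube

open MeasureTheory UnitAddTorus

variable {J : Type*} [Fintype J]

/-- A finite set of indices lies in a product of finite sets, over which the sum factors into
geometric series. -/
theorem summable_exp_neg_sum_abs {ε : ℝ} (hε : 0 < ε) :
    Summable fun n : J → ℤ => Real.exp (-(ε * ∑ i, |(n i : ℝ)|)) := by
  classical
  have h1 : Summable fun k : ℤ => Real.exp (-(ε * |(k : ℝ)|)) := by
    have hs : Summable fun k : ℕ => Real.exp (-(ε * (k : ℝ))) := by
      have := Real.summable_exp_nat_mul_iff.2 (neg_lt_zero.2 hε)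
      refine this.congr fun k => ?_
      ring_nf
    refine Summable.of_nat_of_neg ?_ ?_ <;> simpa using hs
  refine summable_of_sum_le (c := ∏ _i : J, ∑' k : ℤ, Real.exp (-(ε * |(k : ℝ)|)))
    (fun n => (Real.exp_pos _).le) fun u => ?_
  have hprod : ∀ n : J → ℤ, Real.exp (-(ε * ∑ i, |(n i : ℝ)|)) =
      ∏ i, Real.exp (-(ε * |(n i : ℝ)|)) := by
    intro n
    rw [← Real.exp_sum, Finset.mul_sum, Finset.sum_neg_distrib]
  have hsub : u ⊆ Fintype.piFinset fun i => u.image fun n : J → ℤ => n i := by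
    intro n hn
    exact Fintype.mem_piFinset.2 fun i => Finset.mem_image_of_mem _ hn
  calc ∑ n ∈ u, Real.exp (-(ε * ∑ i, |(n i : ℝ)|))
      ≤ ∑ n ∈ Fintype.piFinset fun i => u.image fun n : J → ℤ => n i,
          ∏ i, Real.exp (-(ε * |((n i : ℤ) : ℝ)|)) := by
        simp only [hprod]
        exact Finset.sum_le_sum_of_subset_of_nonneg hsub fun n _ _ =>
          Finset.prod_nonneg fun i _ => (Real.exp_pos _).le
    _ = ∏ i, ∑ k ∈ u.image fun n : J → ℤ => n i, Real.exp (-(ε * |(k : ℝ)|)) :=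
        (Finset.prod_univ_sum _ fun _ (k : ℤ) => Real.exp (-(ε * |(k : ℝ)|))).symm
    _ ≤ _ := Finset.prod_le_prod (fun i _ => Finset.sum_nonneg fun k _ => (Real.exp_pos _).le)
        fun i _ => h1.sum_le_tsum _ fun k _ => (Real.exp_pos _).le

/-- The complexification of a real vector. -/
def ofRealVec (x : J → ℝ) : J → ℂ := fun i => (x i : ℂ)

theorem add_ofRealVec_mem {P : Set (J → ℝ)} {z : J → ℂ} (x : J → ℝ) :
    z + ofRealVec x ∈ upperHalfSpace P ↔ z ∈ upperHalfSpace P := by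
  simp [upperHalfSpace, ofRealVec]

theorem convex_upperHalfSpace {P : Set (J → ℝ)} (hP : Convex ℝ P) :
    Convex ℝ (upperHalfSpace P) := by
  intro z hz w hw a b ha hb hab
  have h1 := hP hz hw ha hb hab
  refine (congrArg (· ∈ P) ?_).mp h1
  funext i
  simp

theorem I_smul_mem {P : Set (J → ℝ)} {y : J → ℝ} :
    Complex.I • ofRealVec y ∈ upperHalfSpace P ↔ y ∈ P := by
  simp [upperHalfSpace, ofRealVec]

theorem exists_box_bound {P : Set (J → ℝ)} {f : (J → ℂ) → ℂ}
    (hf : ContinuousOn f (upperHalfSpace P))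
    (hper : ∀ z ∈ upperHalfSpace P, ∀ n : J → ℤ, f (z + ofRealVec fun i => (n i : ℝ)) = f z)
    {K : Set (J → ℝ)} (hK : IsCompact K) (hKP : K ⊆ P) :
    ∃ B, ∀ y ∈ K, ∀ x : J → ℝ, ‖f (Complex.I • ofRealVec y + ofRealVec x)‖ ≤ B := by
  have hc : Continuous fun p : (J → ℝ) × (J → ℝ) =>
      Complex.I • ofRealVec p.2 + ofRealVec p.1 := by
    unfold ofRealVec
    fun_prop
  have h1 : ContinuousOn (fun p : (J → ℝ) × (J → ℝ) =>
      f (Complex.I • ofRealVec p.2 + ofRealVec p.1))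
      (Set.Icc (0 : J → ℝ) 1 ×ˢ K) :=
    hf.comp hc.continuousOn fun p hp => (add_ofRealVec_mem _).2 (I_smul_mem.2 (hKP hp.2))
  obtain ⟨B, hB⟩ := (isCompact_Icc.prod hK).exists_bound_of_continuousOn h1
  refine ⟨B, fun y hy x => ?_⟩
  have h2 : x = (fun i => Int.fract (x i)) + fun i => ((⌊x i⌋ : ℤ) : ℝ) := by
    funext i
    exact (Int.fract_add_floor _).symm
  have h3 : Complex.I • ofRealVec y + ofRealVec x =
      (Complex.I • ofRealVec y + ofRealVec fun i => Int.fract (x i)) +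
        ofRealVec fun i => ((⌊x i⌋ : ℤ) : ℝ) := by
    rw [add_assoc]
    congr 1
    funext i
    have h4 := congrFun h2 i
    simp only [Pi.add_apply] at h4
    simp only [ofRealVec, Pi.add_apply]
    rw [h4]
    push_cast
    rw [← h4]
  rw [h3, hper _ ((add_ofRealVec_mem _).2 (I_smul_mem.2 (hKP hy)))]
  exact hB (fun i => Int.fract (x i), y)
    ⟨⟨fun i => Int.fract_nonneg _, fun i => (Int.fract_lt_one _).le⟩, hy⟩

/-- A holomorphic function on a tube that is invariant under integral translations has constant
mean values. -/
theorem exists_mean {P : Set (J → ℝ)} (hPo : IsOpen P) (hPc : Convex ℝ P) {h : (J → ℂ) → ℂ}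
    (hh : DifferentiableOn ℂ h (upperHalfSpace P))
    (hper : ∀ z ∈ upperHalfSpace P, ∀ n : J → ℤ, h (z + ofRealVec fun i => (n i : ℝ)) = h z) :
    ∃ c, ∀ z ∈ upperHalfSpace P, ∫ x in unitBox 0, h (z + ofRealVec x) = c := by
  classical
  have hcr : Continuous (ofRealVec (J := J)) := by
    unfold ofRealVec
    fun_prop
  have hopen := isOpen_upperHalfSpace hPo
  have hd : DifferentiableOn ℂ (fun z => ∫ x in unitBox 0, h (z + ofRealVec x))
      (upperHalfSpace P) := by
    have h1 : ∀ z, ∫ x in unitBox 0, h (z + ofRealVec x) =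
        ∫ x in Set.Icc (0 : J → ℝ) fun i => (0 : J → ℝ) i + 1, h (z + ofRealVec x) := fun z =>
      setIntegral_congr_set (unitBox_ae_eq 0)
    simp only [h1]
    refine differentiableOn_setIntegral volume isCompact_Icc measurableSet_Icc hopen ?_ ?_
    · exact hh.continuousOn.comp (f := fun p : (J → ℝ) × (J → ℂ) => p.2 + ofRealVec p.1)
        (by fun_prop) fun p hp => (add_ofRealVec_mem _).2 hp.2
    · intro x _
      exact hh.comp (f := fun z => z + ofRealVec x) (by fun_prop)
        fun z hz => (add_ofRealVec_mem _).2 hz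
  have hinv : ∀ z ∈ upperHalfSpace P, ∀ t : J → ℝ,
      ∫ x in unitBox 0, h (z + ofRealVec t + ofRealVec x) =
        ∫ x in unitBox 0, h (z + ofRealVec x) := by
    intro z hz t
    have hadd : ∀ x y : J → ℝ, ofRealVec (x + y) = ofRealVec x + ofRealVec y := fun x y => by
      funext i; simp [ofRealVec]
    rw [← integral_unitBox_eq (h := fun x => h (z + ofRealVec x)) ?_ ?_ t]
    · simp only [hadd]
      congr 1
      funext x
      congr 1
      rw [add_assoc, add_comm (ofRealVec t)]
    · rw [← continuousOn_univ]
      exact hh.continuousOn.comp (f := fun x => z + ofRealVec x) (by fun_prop)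
        fun x _ => (add_ofRealVec_mem _).2 hz
    · intro x n
      rw [hadd, ← add_assoc]
      exact hper _ ((add_ofRealVec_mem _).2 hz) n
  -- The mean value is invariant under real translations, so its derivative vanishes on real vectors
  -- and hence, being complex linear, on all vectors.
  refine IsOpen.exists_is_const_of_fderiv_eq_zero (𝕜 := ℂ) hopen
    (convex_upperHalfSpace hPc).isPreconnected hd fun z hz => ?_
  have hda := hd.differentiableAt (hopen.mem_nhds hz)
  have hreal : ∀ t : J → ℝ,
      fderiv ℂ (fun z => ∫ x in unitBox 0, h (z + ofRealVec x)) z (ofRealVec t) = 0 := by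
    intro t
    set G := fun z => ∫ x in unitBox 0, h (z + ofRealVec x) with hG
    have h4 : HasDerivAt (fun ζ : ℂ => z + ζ • ofRealVec t) (ofRealVec t) ((0 : ℝ) : ℂ) := by
      simpa using ((hasDerivAt_id ((0 : ℝ) : ℂ)).smul_const (ofRealVec t)).const_add z
    have h5 : HasFDerivAt G (fderiv ℂ G z) (z + ((0 : ℝ) : ℂ) • ofRealVec t) := by
      simpa using hda.hasFDerivAt
    have h6 := (h5.comp_hasDerivAt _ h4).comp_ofReal
    have h7 : ∀ s : ℝ, G (z + (s : ℂ) • ofRealVec t) = G z := by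
      intro s
      have h8 : (s : ℂ) • ofRealVec t = ofRealVec (s • t) := by
        funext i; simp [ofRealVec]
      rw [h8]
      exact hinv z hz _
    simp only [Function.comp_apply, h7] at h6
    exact h6.unique (hasDerivAt_const 0 (G z))
  ext v
  have hv : v = ∑ i, v i • ofRealVec (Pi.single i 1) := by
    funext j
    simp [ofRealVec, Pi.single_apply, apply_ite]
  rw [hv, map_sum]
  simp [hreal]

/-- The pairing of integral and complex vectors. -/
def pair (n : J → ℤ) (z : J → ℂ) : ℂ := ∑ i, (n i : ℂ) * z i

theorem pair_add (n : J → ℤ) (z w : J → ℂ) : pair n (z + w) = pair n z + pair n w := by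
  simp [pair, mul_add, Finset.sum_add_distrib]

theorem pair_smul (n : J → ℤ) (a : ℂ) (z : J → ℂ) : pair n (a • z) = a * pair n z := by
  simp only [pair, Pi.smul_apply, smul_eq_mul, Finset.mul_sum]
  exact Finset.sum_congr rfl fun i _ => by ring

theorem pair_neg (n : J → ℤ) (z : J → ℂ) : pair (-n) z = -pair n z := by
  simp [pair]

theorem pair_ofRealVec (n : J → ℤ) (x : J → ℝ) :
    pair n (ofRealVec x) = ((∑ i, (n i : ℝ) * x i : ℝ) : ℂ) := by
  simp [pair, ofRealVec]

theorem differentiable_pair (n : J → ℤ) : Differentiable ℂ (pair n) := by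
  unfold pair
  fun_prop

theorem mFourier_eq_pair (n : J → ℤ) (x : J → ℝ) :
    mFourier n (toTorus x) = Complex.exp (2 * Real.pi * Complex.I * pair n (ofRealVec x)) :=
  mFourier_toTorus n x

section Expansion

variable {P : Set (J → ℝ)} {f : (J → ℂ) → ℂ}

/-- Multiplication by an integral character keeps a function holomorphic and periodic, so
`exists_mean` applies. It follows that the Fourier coefficient does not depend on the imaginary
part. -/
theorem exists_mean_coeff (hPo : IsOpen P) (hPc : Convex ℝ P)
    (hf : DifferentiableOn ℂ f (upperHalfSpace P))
    (hper : ∀ z ∈ upperHalfSpace P, ∀ n : J → ℤ, f (z + ofRealVec fun i => (n i : ℝ)) = f z)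
    (n : J → ℤ) : ∃ c, ∀ z ∈ upperHalfSpace P, ∫ x in unitBox 0, f (z + ofRealVec x) *
      Complex.exp (-(2 * Real.pi * Complex.I * pair n (z + ofRealVec x))) = c := by
  refine exists_mean (h := fun z => f z * Complex.exp (-(2 * Real.pi * Complex.I * pair n z)))
    hPo hPc (hf.mul ?_) fun z hz l => ?_
  · exact (((differentiable_pair n).const_mul _).neg.cexp).differentiableOn
  · rw [hper z hz l]
    congr 1
    rw [Complex.exp_eq_exp_iff_exists_int]
    refine ⟨-∑ i, n i * l i, ?_⟩
    rw [pair_add, pair_ofRealVec]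
    push_cast
    ring

theorem exists_torus_coeff (hf : DifferentiableOn ℂ f (upperHalfSpace P))
    (hper : ∀ z ∈ upperHalfSpace P, ∀ n : J → ℤ, f (z + ofRealVec fun i => (n i : ℝ)) = f z)
    {c : (J → ℤ) → ℂ}
    (hc : ∀ n, ∀ z ∈ upperHalfSpace P, ∫ x in unitBox 0, f (z + ofRealVec x) *
      Complex.exp (-(2 * Real.pi * Complex.I * pair n (z + ofRealVec x))) = c n)
    {y : J → ℝ} (hy : y ∈ P) :
    ∃ φ : C(UnitAddTorus J, ℂ),
      (∀ x, φ (toTorus x) = f (Complex.I • ofRealVec y + ofRealVec x)) ∧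
      ∀ n, mFourierCoeff φ n = c n * Real.exp (-(2 * Real.pi * ∑ i, (n i : ℝ) * y i)) := by
  have hcr : Continuous (ofRealVec (J := J)) := by
    unfold ofRealVec
    fun_prop
  have hmem := fun x => (add_ofRealVec_mem (z := Complex.I • ofRealVec y) x).2 (I_smul_mem.2 hy)
  obtain ⟨φ, hφ⟩ := exists_toTorus (h := fun x => f (Complex.I • ofRealVec y + ofRealVec x))
    (by
      rw [← continuousOn_univ]
      exact hf.continuousOn.comp (f := fun x => Complex.I • ofRealVec y + ofRealVec x)
        (by fun_prop) fun x _ => hmem x)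
    (fun x n => by
      rw [← hper _ (hmem x) n, add_assoc]
      congr 2
      funext i
      simp [ofRealVec])
  refine ⟨φ, hφ, fun n => ?_⟩
  rw [mFourierCoeff_toTorus _ n 0, ← hc n _ (I_smul_mem.2 hy), ← integral_mul_const]
  congr 1
  funext x
  have h1 : Complex.exp (2 * Real.pi * Complex.I * pair (-n) (ofRealVec x)) =
      Complex.exp (-(2 * Real.pi * Complex.I * pair n (Complex.I • ofRealVec y + ofRealVec x))) *
        (Real.exp (-(2 * Real.pi * ∑ i, (n i : ℝ) * y i)) : ℂ) := by
    rw [Complex.ofReal_exp, ← Complex.exp_add]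
    congr 1
    rw [pair_neg, pair_add, pair_smul, Complex.ofReal_neg, Complex.ofReal_mul,
      ← pair_ofRealVec n y]
    push_cast
    linear_combination (2 * (Real.pi : ℂ) * pair n (ofRealVec y)) * Complex.I_mul_I
  rw [hφ, mFourier_eq_pair, h1]
  ring

/-- Because the coefficients are common to all slices, they can be estimated at a point shifted from
`y` by `ε` in the directions given by the signs of `n`; this gains exponential decay in the sum of
the `|n i|`. -/
theorem norm_coeff_mul_exp_le (hf : DifferentiableOn ℂ f (upperHalfSpace P))
    (hper : ∀ z ∈ upperHalfSpace P, ∀ n : J → ℤ, f (z + ofRealVec fun i => (n i : ℝ)) = f z)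
    {c : (J → ℤ) → ℂ}
    (hc : ∀ n, ∀ z ∈ upperHalfSpace P, ∫ x in unitBox 0, f (z + ofRealVec x) *
      Complex.exp (-(2 * Real.pi * Complex.I * pair n (z + ofRealVec x))) = c n)
    {y : J → ℝ} {ε : ℝ} (hε : 0 < ε) (hεP : Metric.closedBall y ε ⊆ P) :
    ∃ B, ∀ n, ‖c n‖ * Real.exp (-(2 * Real.pi * ∑ i, (n i : ℝ) * y i)) ≤
      B * Real.exp (-((2 * Real.pi * ε) * ∑ i, |(n i : ℝ)|)) := by
  obtain ⟨B, hB⟩ := exists_box_bound hf.continuousOn hper (isCompact_closedBall y ε) hεP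
  refine ⟨B, fun n => ?_⟩
  have hy' : (fun i => y i - ε * SignType.sign (n i : ℝ)) ∈ Metric.closedBall y ε := by
    rw [Metric.mem_closedBall, dist_pi_le_iff hε.le]
    intro i
    rw [Real.dist_eq, sub_sub_cancel_left, abs_neg, abs_mul, abs_of_pos hε]
    refine mul_le_of_le_one_right hε.le ?_
    rcases SignType.sign (n i : ℝ) with _ | _ | _ <;> simp
  obtain ⟨ψ, hψ, hψc⟩ := exists_torus_coeff hf hper hc (hεP hy')
  have h1 := norm_mFourierCoeff_le (f := ψ) (fun x => by rw [hψ]; exact hB _ hy' x) n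
  rw [hψc, norm_mul, Complex.norm_real, Real.norm_of_nonneg (Real.exp_pos _).le] at h1
  have h2 : ∑ i, (n i : ℝ) * (y i - ε * SignType.sign (n i : ℝ)) =
      ∑ i, (n i : ℝ) * y i - ε * ∑ i, |(n i : ℝ)| := by
    rw [Finset.mul_sum, ← Finset.sum_sub_distrib]
    refine Finset.sum_congr rfl fun i _ => ?_
    rw [← self_mul_sign]
    ring
  calc ‖c n‖ * Real.exp (-(2 * Real.pi * ∑ i, (n i : ℝ) * y i))
      = ‖c n‖ * Real.exp (-(2 * Real.pi * ∑ i, (n i : ℝ) * (y i - ε * SignType.sign (n i : ℝ)))) *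
          Real.exp (-((2 * Real.pi * ε) * ∑ i, |(n i : ℝ)|)) := by
        rw [mul_assoc ‖c n‖, ← Real.exp_add, h2]
        congr 2
        ring
    _ ≤ _ := mul_le_mul_of_nonneg_right h1 (Real.exp_pos _).le

/-- The Fourier expansion of a periodic holomorphic function on a tube. -/
theorem exists_fourier_expansion (hPo : IsOpen P) (hPc : Convex ℝ P)
    (hf : DifferentiableOn ℂ f (upperHalfSpace P))
    (hper : ∀ z ∈ upperHalfSpace P, ∀ n : J → ℤ, f (z + ofRealVec fun i => (n i : ℝ)) = f z) :
    ∃ c : (J → ℤ) → ℂ, ∀ z ∈ upperHalfSpace P,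
      HasSum (fun n => c n * Complex.exp (2 * Real.pi * Complex.I * pair n z)) (f z) := by
  choose c hc using exists_mean_coeff hPo hPc hf hper
  refine ⟨c, fun z hz => ?_⟩
  set y : J → ℝ := fun i => (z i).im with hy
  have hyP : y ∈ P := hz
  obtain ⟨ε, hε, hεP⟩ := Metric.nhds_basis_closedBall.mem_iff.1 (hPo.mem_nhds hyP)
  obtain ⟨φ, hφ, hφc⟩ := exists_torus_coeff hf hper hc hyP
  obtain ⟨B, hB⟩ := norm_coeff_mul_exp_le hf hper hc hε hεP
  have hsum : Summable (mFourierCoeff φ) := by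
    refine Summable.of_norm_bounded ((summable_exp_neg_sum_abs (ε := 2 * Real.pi * ε)
      (by positivity)).mul_left B)
      fun n => ?_
    rw [hφc, norm_mul, Complex.norm_real, Real.norm_of_nonneg (Real.exp_pos _).le]
    exact hB n
  have hz' : Complex.I • ofRealVec y + ofRealVec (fun i => (z i).re) = z := by
    funext i
    simp only [ofRealVec, Pi.add_apply, Pi.smul_apply, smul_eq_mul, hy]
    rw [add_comm, mul_comm]
    exact Complex.re_add_im _
  have h3 := hasSum_mFourier_series_apply_of_summable hsum (toTorus fun i => (z i).re)
  rw [hφ, hz'] at h3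
  convert h3 using 2 with n
  rw [hφc, mFourier_eq_pair, smul_eq_mul, mul_assoc (c n), Complex.ofReal_exp,
    ← Complex.exp_add]
  congr 2
  nth_rw 1 [← hz']
  rw [pair_add, pair_smul, Complex.ofReal_neg, Complex.ofReal_mul, ← pair_ofRealVec n y]
  push_cast
  linear_combination (2 * (Real.pi : ℂ) * pair n (ofRealVec y)) * Complex.I_mul_I

end Expansion

end Tube

/-! ### Termwise action of the operators on expansions -/

section Expansion

open TopologicalSpace

variable {S : Matrix ι ι ℤ} {e : κ → ι → ℤ} {lam : ι → ℤ} {m : ℤ} {P : Set (ι → ℝ)}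

theorem bilin_ofRealVec (S : Matrix ι ι ℤ) (x y : ι → ℝ) :
    bilin S (ofRealVec x) (ofRealVec y) = ((bilin S x y : ℝ) : ℂ) := by
  simp [bilin, ofRealVec, dotProduct, mulVec]

theorem qExp_eq (S : Matrix ι ι ℤ) (r : ι → ℝ) (z : ι → ℂ) :
    qExp S r z = Complex.exp (2 * Real.pi * Complex.I * bilin S (ofRealVec r) z) := rfl

theorem re_add_im_vec (z : ι → ℂ) :
    z = ofRealVec (fun i => (z i).re) + Complex.I • ofRealVec fun i => (z i).im := by
  funext i
  simp only [ofRealVec, Pi.add_apply, Pi.smul_apply, smul_eq_mul, mul_comm Complex.I]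
  exact (Complex.re_add_im _).symm

theorem norm_qExp (S : Matrix ι ι ℤ) (r : ι → ℝ) (z : ι → ℂ) :
    ‖qExp S r z‖ = Real.exp (-(2 * Real.pi * bilin S r fun i => (z i).im)) := by
  rw [qExp_eq, Complex.norm_exp]
  congr 1
  conv_lhs => rw [re_add_im_vec z, bilin_add_right, bilin_smul_right, bilin_ofRealVec,
    bilin_ofRealVec]
  simp

theorem rayPoint_eq (x v : ι → ℝ) (t : ℝ) :
    rayPoint x v t = ofRealVec x + Complex.I • ofRealVec (t • v) := rfl

theorem im_rayPoint (x v : ι → ℝ) (t : ℝ) : (fun i => (rayPoint x v t i).im) = t • v := by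
  funext i
  simp [rayPoint]

theorem rayPoint_mem (hS : IsEvenLorentzian S) (hP : IsPositiveCone S P) (x : ι → ℝ) {v : ι → ℝ}
    (hv : v ∈ P) {t : ℝ} (ht : 0 < t) : rayPoint x v t ∈ upperHalfSpace P := by
  change (fun i => (rayPoint x v t i).im) ∈ P
  rw [im_rayPoint]
  exact hP.smul_mem hS hv ht

/-- The function `f` has on the upper half-space the absolutely convergent expansion with exponents
`ρ` and coefficients `c`. -/
def HasExp {I : Type*} (S : Matrix ι ι ℤ) (P : Set (ι → ℝ)) (ρ : I → ι → ℝ) (c : I → ℂ)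
    (f : (ι → ℂ) → ℂ) : Prop :=
  ∀ z ∈ upperHalfSpace P, HasSum (fun p => c p * qExp S (ρ p) z) (f z)

variable {I : Type*} {ρ : I → ι → ℝ} {c : I → ℂ}

theorem qExp_add_smul (S : Matrix ι ι ℤ) (r v : ι → ℝ) (z : ι → ℂ) (ζ : ℂ) :
    qExp S r (z + ζ • ofRealVec v) =
      qExp S r z * Complex.exp (2 * Real.pi * Complex.I * bilin S r v * ζ) := by
  rw [qExp_eq, qExp_eq, ← Complex.exp_add, bilin_add_right, bilin_smul_right, bilin_ofRealVec]
  congr 1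
  ring

theorem norm_exp_le_of_abs_le {R a b : ℝ} (hb : |b| ≤ R) :
    Real.exp (a * b) ≤ Real.exp (a * R) + Real.exp (a * -R) := by
  have h1 : a * b ≤ |a| * R := (le_abs_self _).trans (by
    rw [abs_mul]; exact mul_le_mul_of_nonneg_left hb (abs_nonneg _))
  rcases le_total 0 a with h | h
  · rw [abs_of_nonneg h] at h1
    linarith [Real.exp_le_exp.2 h1, Real.exp_pos (a * -R)]
  · rw [abs_of_nonpos h, neg_mul, ← mul_neg] at h1
    linarith [Real.exp_le_exp.2 h1, Real.exp_pos (a * R)]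

/-- Expansions may be differentiated term by term. -/
theorem HasExp.dd (hPo : IsOpen P) {f : hol (halfSpace P hPo)} (hf : HasExp S P ρ c f)
    (v : ι → ℝ) :
    HasExp S P ρ (fun p => c p * (2 * Real.pi * Complex.I * bilin S (ρ p) v))
      (dd (halfSpace P hPo) (ofRealVec v) f) := by
  intro z hz
  have hcont : Continuous fun ζ : ℂ => z + ζ • ofRealVec v := by fun_prop
  have hopen := isOpen_upperHalfSpace hPo
  obtain ⟨R, hR, hRH⟩ := Metric.nhds_basis_closedBall.mem_iff.1
    (hcont.continuousAt.preimage_mem_nhds (x := 0) (by simpa using hopen.mem_nhds hz))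
  have hmem : ∀ ζ ∈ Metric.ball (0 : ℂ) R, z + ζ • ofRealVec v ∈ upperHalfSpace P :=
    fun ζ hζ => hRH (Metric.ball_subset_closedBall hζ)
  have hRI : ∀ b : ℝ, |b| ≤ R → z + (b * Complex.I : ℂ) • ofRealVec v ∈ upperHalfSpace P := by
    intro b hb
    exact hRH (by simpa using hb)
  set F : I → ℂ → ℂ := fun p ζ => c p * qExp S (ρ p) (z + ζ • ofRealVec v) with hF
  have hnorm : ∀ p ζ, ‖F p ζ‖ = ‖c p * qExp S (ρ p) z‖ *
      Real.exp (-(2 * Real.pi * bilin S (ρ p) v) * ζ.im) := by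
    intro p ζ
    rw [hF]
    dsimp only
    rw [qExp_add_smul, ← mul_assoc, norm_mul, Complex.norm_exp]
    congr 2
    simp
  -- The modulus of each term is exponential in `Im ζ`, so on the disc it is at most the sum of its
  -- values at `± R i`; at both points the expansion converges absolutely.
  have hs1 := (hf _ (hRI R (abs_of_pos hR).le)).summable.norm
  have hs2 := (hf _ (hRI (-R) (by rw [abs_neg, abs_of_pos hR]))).summable.norm
  have hu := hs1.add hs2
  have h1 := Complex.hasSum_deriv_of_summable_norm (F := F) (z := 0) hu
    (fun p => by
      have : Differentiable ℂ (F p) := by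
        simp only [hF, qExp_add_smul]
        fun_prop
      exact this.differentiableOn) Metric.isOpen_ball
    (fun p ζ hζ => by
      have h2 := hnorm p (R * Complex.I)
      have h3 := hnorm p ((-R : ℝ) * Complex.I)
      simp only [hF] at h2 h3
      rw [h2, h3, hnorm, ← mul_add]
      refine mul_le_mul_of_nonneg_left ?_ (norm_nonneg _)
      have h4 : |ζ.im| ≤ R := (Complex.abs_im_le_norm ζ).trans
        (by simpa using (Metric.ball_subset_closedBall hζ))
      simpa using norm_exp_le_of_abs_le (a := -(2 * Real.pi * bilin S (ρ p) v)) h4)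
    (Metric.mem_ball_self hR)
  have h2 : deriv (fun ζ => ∑' p, F p ζ) 0 = (HigherPullback.dd (halfSpace P hPo) (ofRealVec v) f :
      (ι → ℂ) → ℂ) z := by
    rw [dd_apply _ _ hz, fderiv_apply_eq_deriv (differentiableAt_hol f hz)]
    refine Filter.EventuallyEq.deriv_eq ?_
    filter_upwards [Metric.ball_mem_nhds (0 : ℂ) hR] with ζ hζ
    exact (hf _ (hmem ζ hζ)).tsum_eq
  rw [h2] at h1
  refine h1.congr_fun fun p => ?_
  have h3 : HasDerivAt (fun ζ : ℂ => c p * (qExp S (ρ p) z *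
      Complex.exp (2 * Real.pi * Complex.I * bilin S (ρ p) v * ζ)))
      (c p * (qExp S (ρ p) z * (Complex.exp (2 * Real.pi * Complex.I * bilin S (ρ p) v * 0) *
        (2 * Real.pi * Complex.I * bilin S (ρ p) v * 1)))) 0 :=
    ((((hasDerivAt_id (0 : ℂ)).const_mul _).cexp).const_mul _).const_mul _
  simp only [hF, qExp_add_smul]
  rw [h3.deriv]
  simp only [mul_zero, Complex.exp_zero]
  ring

theorem HasExp.smul {f : (ι → ℂ) → ℂ} (hf : HasExp S P ρ c f) (a : ℂ) :
    HasExp S P ρ (fun p => a * c p) (a • f) := fun z hz => by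
  simpa [mul_assoc] using (hf z hz).mul_left a

theorem HasExp.sum {A : Type*} (s : Finset A) {c : A → I → ℂ} {f : A → (ι → ℂ) → ℂ}
    (hf : ∀ a ∈ s, HasExp S P ρ (c a) (f a)) :
    HasExp S P ρ (fun p => ∑ a ∈ s, c a p) (∑ a ∈ s, f a) := fun z hz => by
  have := hasSum_sum fun a ha => hf a ha z hz
  simpa [Finset.sum_mul] using this

theorem HasExp.pow {H : Opens (ι → ℂ)} {A : Module.End ℂ (hol H)} {a : I → ℂ}
    (hA : ∀ (c : I → ℂ) (f : hol H), HasExp S P ρ c f → HasExp S P ρ (fun p => c p * a p) (A f))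
    {f : hol H} (hf : HasExp S P ρ c f) (n : ℕ) :
    HasExp S P ρ (fun p => c p * a p ^ n) ((A ^ n) f) := by
  induction n with
  | zero => simpa using hf
  | succ n ih =>
    rw [pow_succ', Module.End.mul_apply]
    have := hA _ _ ih
    simpa only [mul_assoc, ← pow_succ] using this

theorem ofRealVec_ofInt (x : ι → ℤ) : ofRealVec (ofInt ℝ x) = ofInt ℂ x := by
  funext i
  simp [ofRealVec, ofInt]

theorem bilin_gram_projL {K : Type*} [Field K] [CharZero K] (h : IsOrthBasis S e lam m)
    (x : ι → K) (z : κ → K) :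
    bilin (gramOf S e) (projL S e x) z = bilin S x (embed e z) := by
  rw [← h.bilin_embed_embed, bilin_comm h.symm, bilin_embed_left, bilin_comm h.symm,
    bilin_embed_left]
  simp only [h.bilin_ofInt_embed_projL]

theorem ofRealVec_projL (h : IsOrthBasis S e lam m) (x : ι → ℝ) :
    ofRealVec (projL S e x) = projL S e (ofRealVec x) := by
  have h1 : Function.Injective ((gramOf S e).map (Int.cast : ℤ → ℂ)).mulVec :=
    mulVec_injective_of_isUnit ((isUnit_iff_isUnit_det _).2 h.isUnit_det_gram)
  refine h1 (funext fun k => ?_)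
  have h2 : ∀ y : κ → ℂ, ((gramOf S e).map (Int.cast : ℤ → ℂ) *ᵥ y) k =
      bilin (gramOf S e) y (ofRealVec (Pi.single k 1)) := by
    intro y
    rw [bilin_comm h.symm_gram, bilin]
    have : ofRealVec (Pi.single k (1 : ℝ)) = Pi.single k (1 : ℂ) := by
      funext i
      simp [ofRealVec, Pi.single_apply, apply_ite]
    rw [this, single_dotProduct, one_mul]
  have h3 : embed e (ofRealVec (Pi.single k (1 : ℝ))) = ofRealVec (embed e (Pi.single k 1)) := by
    funext i
    simp [embed, ofRealVec, ofInt]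
  rw [h2, h2, bilin_ofRealVec, bilin_gram_projL h, bilin_gram_projL h, h3, bilin_ofRealVec]

theorem sum_inv_gram (h : IsOrthBasis S e lam m) (x : ι → ℂ) :
    ∑ i, ∑ j, ((gramOf S e).map (Int.cast : ℤ → ℂ))⁻¹ i j * bilin S x (ofInt ℂ (e i)) *
      bilin S x (ofInt ℂ (e j)) = bilin (gramOf S e) (projL S e x) (projL S e x) := by
  rw [bilin_gram_projL h, bilin_comm h.symm, bilin_embed_left]
  simp only [projL, mulVec, dotProduct, Finset.sum_mul]
  refine Finset.sum_congr rfl fun i _ => Finset.sum_congr rfl fun j _ => ?_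
  rw [bilin_comm h.symm x, bilin_comm h.symm x]
  ring

/-- By `sum_inv_gram`, contracting the pairings of an exponent with the inverse Gram matrix gives
the norm of its projection. -/
theorem HasExp.subLapl (h : IsOrthBasis S e lam m) (hPo : IsOpen P) {f : hol (halfSpace P hPo)}
    (hf : HasExp S P ρ c f) :
    HasExp S P ρ (fun p => c p * ((2 * Real.pi * Complex.I) ^ 2 *
      (quad (gramOf S e) (projL S e (ρ p)) : ℝ))) (subLapl S e (halfSpace P hPo) f) := by
  rw [HigherPullback.subLapl, lapl_apply]
  have hdd : ∀ i (c : I → ℂ) (f : hol (halfSpace P hPo)), HasExp S P ρ c f → HasExp S P ρ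
      (fun p => c p * (2 * Real.pi * Complex.I * bilin S (ρ p) (ofInt ℝ (e i))))
      (HigherPullback.dd (halfSpace P hPo) (ofInt ℂ (e i)) f) := by
    intro i c f hf
    rw [← ofRealVec_ofInt]
    exact hf.dd hPo _
  have h1 := (HasExp.sum Finset.univ fun i _ => HasExp.sum Finset.univ fun j _ =>
    (hdd i _ _ (hdd j _ _ hf)).smul
      (((gramOf S e).map (Int.cast : ℤ → ℂ))⁻¹ i j)).smul (1 / 2 : ℂ)
  convert h1 using 1
  · funext p
    have h2 := sum_inv_gram h (ofRealVec (ρ p))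
    rw [← ofRealVec_projL h, bilin_ofRealVec] at h2
    rw [quad, Complex.ofReal_div, ← h2]
    push_cast
    simp only [← ofRealVec_ofInt, bilin_ofRealVec, Finset.mul_sum, Finset.sum_div]
    refine Finset.sum_congr rfl fun i _ => Finset.sum_congr rfl fun j _ => ?_
    ring
  · funext z
    simp

theorem coe_pullOp (S : Matrix ι ι ℤ) (e : κ → ι → ℤ) (k : ℤ) (N : ℕ) (lam : ι → ℤ)
    {H : Opens (ι → ℂ)} (f : hol H) :
    (pullOp S e k N lam H f : (ι → ℂ) → ℂ) = ∑ j ∈ Finset.range (N / 2 + 1),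
      (gegenbauerCoeff N (k + (1 - (Fintype.card ι : ℂ)) / 2) j * (-quad S (ofInt ℂ lam)) ^ j) •
        ((HigherPullback.subLapl S e H ^ j) ((HigherPullback.dd H (ofInt ℂ lam) ^ (N - 2 * j)) f) :
          (ι → ℂ) → ℂ) := by
  rw [pullOp, gegOp_apply]
  simp only [AddSubmonoidClass.coe_finsetSum, Submodule.coe_smul]

/-- The expansion of the pullback. -/
theorem HasExp.pullback (h : IsOrthBasis S e lam m) (hPo : IsOpen P) {f : (ι → ℂ) → ℂ}
    (hd : DifferentiableOn ℂ f (upperHalfSpace P)) (hf : HasExp S P ρ c f) (k : ℤ) (N : ℕ) :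
    HasExp (gramOf S e) (subCone e P) (fun p => projL S e (ρ p))
      (fun p => c p * gegenbauer N (k + (1 - (Fintype.card ι : ℂ)) / 2)
        (bilin S (ρ p) (ofInt ℝ lam) : ℝ)
        (m * (quad (gramOf S e) (projL S e (ρ p)) : ℝ)))
      (pullback S e k N f lam) := by
  intro z hz
  have hx : embed e z ∈ halfSpace P hPo := embed_mem_upperHalfSpace.2 hz
  have hcut : HasExp S P ρ c (cut (halfSpace P hPo) f hd) := fun z hz => by
    rw [cut_apply hd hz]
    exact hf z hz
  have hdd : ∀ (c : I → ℂ) (f : hol (halfSpace P hPo)), HasExp S P ρ c f → HasExp S P ρ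
      (fun p => c p * (2 * Real.pi * Complex.I * bilin S (ρ p) (ofInt ℝ lam)))
      (HigherPullback.dd (halfSpace P hPo) (ofInt ℂ lam) f) := by
    intro c f hf
    rw [← ofRealVec_ofInt]
    exact hf.dd hPo _
  have hterm := fun j => HasExp.pow (fun c f hf => HasExp.subLapl h hPo hf)
    (HasExp.pow hdd hcut (N - 2 * j)) j
  have h1 := HasExp.sum (Finset.range (N / 2 + 1)) fun j _ => (hterm j).smul
    (gegenbauerCoeff N (k + (1 - (Fintype.card ι : ℂ)) / 2) j * (-quad S (ofInt ℂ lam)) ^ j)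
  have h2 := (h1 _ hx).mul_left ((2 * Real.pi * Complex.I) ^ N)⁻¹
  rw [pullback_eq S e k N lam (H := halfSpace P hPo) hd hx]
  have hm : -quad S (ofInt ℂ lam) = m := by
    rw [quad, h.bilin_lam_lam]; ring
  rw [coe_pullOp]
  refine h2.congr_fun fun p => ?_
  dsimp only
  · have hq : qExp (gramOf S e) (projL S e (ρ p)) z = qExp S (ρ p) (embed e z) := by
      rw [qExp_eq, qExp_eq, ofRealVec_projL h, bilin_gram_projL h]
    rw [hq, ← mul_assoc]
    congr 1
    rw [gegenbauer, Finset.mul_sum, Finset.mul_sum, hm]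
    refine Finset.sum_congr rfl fun j hj => ?_
    have hj' : N = (N - 2 * j) + 2 * j := by
      have := Finset.mem_range.1 hj
      omega
    -- Derivatives along `lam` give `N - 2j` factors `2πi` and the Laplace operators give `2j`, so
    -- the normalization cancels in every term.
    have h3 : (2 * Real.pi * Complex.I) ^ N = (2 * Real.pi * Complex.I) ^ (N - 2 * j) *
        ((2 * Real.pi * Complex.I) ^ 2) ^ j := by
      rw [← pow_mul, ← pow_add, ← hj']
    rw [eq_inv_mul_iff_mul_eq₀ (pow_ne_zero _ Complex.two_pi_I_ne_zero), h3, mul_pow, mul_pow,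
      mul_pow]
    ring

end Expansion

/-! ### Bounded growth confines the exponents -/

section Positivity

variable {S : Matrix ι ι ℤ} {P : Set (ι → ℝ)} {I : Type*} {ρ : I → ι → ℝ} {c : I → ℂ}

/-- The exponents of an expansion of a function of bounded growth lie in the dual cone. -/
theorem HasExp.bilin_nonneg (hS : IsEvenLorentzian S) (hP : IsPositiveCone S P)
    {f : (ι → ℂ) → ℂ} (hf : HasExp S P ρ c f) {J : Type*} [Fintype J] {b : J → ι → ℝ}
    {n : I → J → ℤ} (hn : Function.Injective n) (hb : ∀ p j, bilin S (ρ p) (b j) = n p j)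
    {v : ι → ℝ} (hv : v ∈ P)
    (hbd : ∃ B : ℝ, ∀ᶠ t : ℝ in atTop, ∀ x : ι → ℝ, ‖f (rayPoint x v t)‖ ≤ B)
    {p : I} (hp : c p ≠ 0) : 0 ≤ bilin S (ρ p) v := by
  obtain ⟨B, hB⟩ := hbd
  by_contra hneg
  push Not at hneg
  have h1 : ∀ᶠ t : ℝ in atTop,
      ‖c p‖ * Real.exp (t * (-(2 * Real.pi * bilin S (ρ p) v))) ≤ B := by
    filter_upwards [hB, eventually_gt_atTop 0] with t ht ht0
    -- The real part runs through the span of `b`, on which the exponents have distinct integral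
    -- coordinates; each term at height `t v` is then bounded by the supremum of `f` at that height.
    have h2 := norm_coeff_le (a := fun p => c p * qExp S (ρ p) (rayPoint 0 v t)) hn
      (g := fun x => f (rayPoint (∑ j, x j • b j) v t)) (B := B) (fun x => ht _)
      (fun x => by
        convert hf _ (rayPoint_mem hS hP (∑ j, x j • b j) hv ht0) using 2 with q
        rw [mul_assoc]
        congr 1
        rw [qExp_eq, qExp_eq, ← Complex.exp_add]
        congr 1
        rw [rayPoint_eq, rayPoint_eq, bilin_add_right, bilin_add_right, bilin_ofRealVec S _ 0,
          bilin_ofRealVec S _ (∑ j, x j • b j)]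
        have h3 : bilin S (ρ q) (∑ j, x j • b j) = ∑ j, n q j * x j := by
          rw [bilin, mulVec_sum, dotProduct_sum]
          refine Finset.sum_congr rfl fun j _ => ?_
          rw [mulVec_smul, dotProduct_smul, smul_eq_mul, mul_comm]
          congr 1
          exact hb q j
        have h4 : bilin S (ρ q) 0 = 0 := by simp [bilin]
        rw [h3, h4]
        push_cast
        ring) p
    rw [norm_mul, norm_qExp, im_rayPoint, bilin_smul_right] at h2
    refine le_trans (le_of_eq ?_) h2
    congr 2
    ring
  have h2 : Tendsto (fun t : ℝ => ‖c p‖ * Real.exp (t * (-(2 * Real.pi * bilin S (ρ p) v))))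
      atTop atTop := by
    refine Tendsto.const_mul_atTop (norm_pos_iff.2 hp) (Real.tendsto_exp_atTop.comp ?_)
    refine tendsto_id.atTop_mul_const ?_
    have := mul_neg_of_pos_of_neg (mul_pos two_pos Real.pi_pos) hneg
    linarith
  obtain ⟨t, ht1, ht2⟩ := (h1.and (h2.eventually_gt_atTop B)).exists
  exact absurd ht1 (not_le.2 ht2)

end Positivity

/-! ### Expansion with respect to the sublattice and `lam` -/

section ThetaExpansion

variable {S : Matrix ι ι ℤ} {e : κ → ι → ℤ} {lam : ι → ℤ} {m : ℤ} {P : Set (ι → ℝ)}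

theorem one_mem_SOPlusRat (S : Matrix ι ι ℤ) : 1 ∈ SOPlusRat S :=
  ⟨one_mem_SOPlus S, IsRat.one⟩

theorem slash_one (S : Matrix ι ι ℤ) (k : ℤ) (F : (ι → ℂ) → ℂ) : slash S k F 1 = F := by
  funext z
  have h1 : autFactor S 1 z = 1 := by
    simp [autFactor, lift]
  rw [slash, moebius_one, h1, _root_.one_zpow, one_mul]

theorem ofInt_eq_embed (e : κ → ι → ℤ) (k : κ) :
    ofInt ℝ (e k) = embed e (ofInt ℝ (Pi.single k 1)) := by
  have h1 : ofInt ℝ (Pi.single k (1 : ℤ)) = Pi.single k (1 : ℝ) := by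
    funext i
    simp [ofInt, Pi.single_apply, apply_ite]
  rw [h1]
  simp [embed, Pi.single_apply]

theorem bilin_sub_smul_left (h : IsOrthBasis S e lam m) (r : κ → ℝ) (μ : ℝ) :
    (∀ k, bilin S (embed e r - μ • ofInt ℝ lam) (ofInt ℝ (e k)) =
        bilin (gramOf S e) r (ofInt ℝ (Pi.single k 1))) ∧
      bilin S (embed e r - μ • ofInt ℝ lam) (ofInt ℝ lam) = 2 * m * μ := by
  rw [sub_eq_add_neg, ← neg_smul]
  refine ⟨fun k => ?_, ?_⟩
  · rw [bilin_add_left, bilin_smul_left, ofInt_eq_embed, h.bilin_embed_embed, bilin_comm h.symm,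
      h.bilin_embed_lam]
    ring
  · rw [bilin_add_left, bilin_smul_left, h.bilin_embed_lam, h.bilin_lam_lam]
    ring

theorem projL_sub_smul (h : IsOrthBasis S e lam m) (r : κ → ℝ) (μ : ℝ) :
    projL S e (embed e r - μ • ofInt ℝ lam) = r := by
  have h1 : (fun k => bilin S (ofInt ℝ (e k)) (embed e r - μ • ofInt ℝ lam)) =
      (gramOf S e).map (Int.cast : ℤ → ℝ) *ᵥ r := by
    funext k
    rw [bilin_comm h.symm, (bilin_sub_smul_left h r μ).1 k, bilin_comm h.symm_gram, bilin]
    have : ofInt ℝ (Pi.single k (1 : ℤ)) = Pi.single k (1 : ℝ) := by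
      funext i
      simp [ofInt, Pi.single_apply, apply_ite]
    rw [this, single_dotProduct, one_mul]
  rw [projL, h1, mulVec_mulVec, nonsing_inv_mul _ h.isUnit_det_gram, one_mulVec]

theorem quad_sub_smul (h : IsOrthBasis S e lam m) (r : κ → ℝ) (μ : ℝ) :
    quad S (embed e r - μ • ofInt ℝ lam) = quad (gramOf S e) r - m * μ ^ 2 := by
  rw [sub_eq_add_neg, ← neg_smul, quad, bilin_add_right, bilin_add_left, bilin_add_left,
    bilin_smul_left, bilin_smul_left, bilin_smul_right, bilin_smul_right, h.bilin_embed_embed,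
    h.bilin_embed_lam, bilin_comm h.symm, h.bilin_embed_lam, h.bilin_lam_lam, quad]
  ring

theorem finite_fracInt_of_sq_le {m : ℤ} (hm : 0 < m) (C : ℝ) :
    {μ : fracInt m | m * (μ : ℝ) ^ 2 ≤ C}.Finite := by
  have hm' : (0 : ℝ) < m := by exact_mod_cast hm
  have h1 : {n : ℤ | (n : ℝ) ^ 2 ≤ 4 * m * C}.Finite := by
    refine (Set.finite_Icc (-⌈4 * m * C⌉) ⌈4 * m * C⌉).subset fun n hn => ?_
    have h2 : (n ^ 2 : ℤ) ≤ ⌈4 * m * C⌉ := by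
      have h3 : ((n ^ 2 : ℤ) : ℝ) ≤ (⌈4 * m * C⌉ : ℤ) := by
        push_cast
        exact le_trans hn (Int.le_ceil _)
      exact_mod_cast h3
    have h4 : |n| ≤ n ^ 2 := by
      rw [← sq_abs]
      nlinarith [abs_nonneg n, Int.one_le_abs (z := n), abs_eq_zero (a := n),
        eq_or_ne n 0, Int.le_self_sq |n|]
    exact abs_le.1 (h4.trans h2)
  refine Set.Finite.of_finite_image (f := Subtype.val) ?_ Subtype.val_injective.injOn
  refine (h1.image fun n : ℤ => (n : ℝ) / (2 * m)).subset ?_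
  rintro _ ⟨⟨μ, n, rfl⟩, hμ, rfl⟩
  refine ⟨n, ?_, rfl⟩
  have h5 : m * ((n : ℝ) / (2 * m)) ^ 2 ≤ C := hμ
  have h6 : (n : ℝ) ^ 2 = 4 * m * (m * ((n : ℝ) / (2 * m)) ^ 2) := by field_simp; ring
  change (n : ℝ) ^ 2 ≤ 4 * m * C
  rw [h6]
  exact mul_le_mul_of_nonneg_left h5 (by positivity)

/-- Every point is `z + w λ`, and pairing `-μ λ` with `w λ` gives `2mμw`, so the pair `(r, μ)`
stands for the exponent `r - μ λ`. -/
theorem hasExp_of_theta (h : IsOrthBasis S e lam m) {F : (ι → ℂ) → ℂ}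
    {c : dualLattice (gramOf S e) → fracInt m → ℂ}
    (hc : ∀ (z : κ → ℂ) (w : ℂ), embed e z + w • ofInt ℂ lam ∈ upperHalfSpace P →
      HasSum (fun p : dualLattice (gramOf S e) × fracInt m =>
          c p.1 p.2 * qExp (gramOf S e) p.1 z *
            Complex.exp (2 * Real.pi * Complex.I * (2 * m) * w * ((p.2 : ℝ) : ℂ)))
        (F (embed e z + w • ofInt ℂ lam))) :
    HasExp S P (fun p : dualLattice (gramOf S e) × fracInt m =>
      embed e (p.1 : κ → ℝ) - (p.2 : ℝ) • ofInt ℝ lam) (fun p => c p.1 p.2) F := by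
  intro z hz
  have hdec : z = embed e (projL S e z) +
      (-(1 / (2 * m) * bilin S (ofInt ℂ lam) z)) • ofInt ℂ lam := by
    rw [h.decomp, neg_smul, add_neg_cancel_right]
  generalize projL S e z = z', -(1 / (2 * m) * bilin S (ofInt ℂ lam) z) = w at hdec
  subst hdec
  refine (hc z' w hz).congr_fun fun p => ?_
  dsimp only
  rw [mul_assoc]
  congr 1
  rw [qExp_eq, qExp_eq, ← Complex.exp_add]
  congr 1
  have h1 : ofRealVec (embed e (p.1 : κ → ℝ) - (p.2 : ℝ) • ofInt ℝ lam) =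
      embed e (ofRealVec (p.1 : κ → ℝ)) + (-(p.2 : ℝ) : ℂ) • ofInt ℂ lam := by
    funext i
    simp [ofRealVec, embed, ofInt]
    ring
  rw [h1, bilin_add_left, bilin_add_right, bilin_add_right, bilin_smul_left, bilin_smul_right,
    bilin_smul_left, bilin_smul_right, h.bilin_embed_embed, h.bilin_embed_lam, bilin_comm h.symm,
    h.bilin_embed_lam, h.bilin_lam_lam]
  ring

/-- The expansion of the pullback in terms of the theta decomposition. -/
theorem pullback_expansion (h : IsOrthBasis S e lam m) (hS : IsEvenLorentzian S)
    (hP : IsPositiveCone S P) {k : ℤ} {F : (ι → ℂ) → ℂ} (hF : IsModularForm S P k F) (N : ℕ)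
    {c : dualLattice (gramOf S e) → fracInt m → ℂ}
    (hc : ∀ (z : κ → ℂ) (w : ℂ), embed e z + w • ofInt ℂ lam ∈ upperHalfSpace P →
      HasSum (fun p : dualLattice (gramOf S e) × fracInt m =>
          c p.1 p.2 * qExp (gramOf S e) p.1 z *
            Complex.exp (2 * Real.pi * Complex.I * (2 * m) * w * ((p.2 : ℝ) : ℂ)))
        (F (embed e z + w • ofInt ℂ lam))) :
    (∀ r, (Function.support (c r)).Finite) ∧
      ∀ z ∈ upperHalfSpace (subCone e P),
        HasSum (fun r : dualLattice (gramOf S e) =>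
            (∑ᶠ μ : fracInt m, c r μ *
              gegenbauer N (k + (1 - (Fintype.card ι : ℂ)) / 2) (2 * m * ((μ : ℝ) : ℂ))
                (m * ((quad (gramOf S e) (r : κ → ℝ) : ℝ) : ℂ))) *
              qExp (gramOf S e) r z)
          (pullback S e k N F lam z) := by
  have hexp := hasExp_of_theta h hc
  -- Exponents pair nonnegatively with the cone, hence have nonnegative norm, and the norm of `r - μ
  -- λ` is `Q(r) - m μ²`.
  have hpos : ∀ r μ, c r μ ≠ 0 → m * (μ : ℝ) ^ 2 ≤ quad (gramOf S e) (r : κ → ℝ) := by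
    intro r μ hcr
    choose n hn using fun p : dualLattice (gramOf S e) => fun k => p.2 (Pi.single k 1)
    choose l hl using fun μ : fracInt m => μ.2
    have hm := h.m_ne_zero (K := ℝ)
    have hl' : ∀ μ : fracInt m, 2 * m * (μ : ℝ) = l μ := by
      intro μ
      nth_rw 1 [hl μ]
      field_simp
    have hinj : Function.Injective fun p : dualLattice (gramOf S e) × fracInt m =>
        (Sum.elim (n p.1) fun _ : Unit => l p.2 : κ ⊕ Unit → ℤ) := by
      intro p q hpq
      have h1 : n p.1 = n q.1 := funext fun k => congrFun hpq (Sum.inl k)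
      have h2 : l p.2 = l q.2 := congrFun hpq (Sum.inr ())
      refine Prod.ext (Subtype.ext ?_) (Subtype.ext ?_)
      · rw [← projL_sub_smul h (p.1 : κ → ℝ) 0, ← projL_sub_smul h (q.1 : κ → ℝ) 0, projL, projL]
        congr 1
        funext k
        rw [bilin_comm h.symm, (bilin_sub_smul_left h _ 0).1 k, bilin_comm h.symm,
          (bilin_sub_smul_left h _ 0).1 k, hn, hn, h1]
      · rw [hl p.2, hl q.2, h2]
    have hdual : ∀ v ∈ P, 0 ≤ bilin S (embed e (r : κ → ℝ) - (μ : ℝ) • ofInt ℝ lam) v := by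
      intro v hv
      refine hexp.bilin_nonneg hS hP hinj
        (b := Sum.elim (fun k => ofInt ℝ (e k)) fun _ => ofInt ℝ lam) (fun p j => ?_) hv ?_
        (p := (r, μ)) hcr
      · rcases j with j | j
        · exact ((bilin_sub_smul_left h _ _).1 j).trans (hn p.1 j)
        · exact ((bilin_sub_smul_left h _ _).2).trans (hl' p.2)
      · obtain ⟨B, hB⟩ := hF.bounded 1 (one_mem_SOPlusRat S) v hv
        rw [slash_one] at hB
        exact ⟨B, hB⟩
    have h3 := hP.quad_nonneg_of_dual hS hdual
    rw [quad_sub_smul h] at h3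
    linarith
  have hfin : ∀ r, (Function.support (c r)).Finite := fun r =>
    (finite_fracInt_of_sq_le h.pos (quad (gramOf S e) (r : κ → ℝ))).subset fun μ hμ => hpos r μ hμ
  refine ⟨hfin, fun z hz => ?_⟩
  have h1 := HasExp.pullback h (hP.isOpen hS) hF.holomorphic hexp k N z hz
  -- The projection of `r - μ λ` is `r`, so terms with the same `r` share an exponential and form a
  -- finite sum.
  refine h1.prod_fiberwise fun r => ?_
  have h2 : (Function.support fun μ : fracInt m => c r μ *
      gegenbauer N (k + (1 - (Fintype.card ι : ℂ)) / 2) (2 * m * ((μ : ℝ) : ℂ))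
        (m * ((quad (gramOf S e) (r : κ → ℝ) : ℝ) : ℂ))).Finite :=
    (hfin r).subset fun μ hμ => left_ne_zero_of_mul hμ
  have h3 := (hasSum_sum_of_ne_finset_zero (s := h2.toFinset) fun μ hμ => by
    by_contra h0; exact hμ (h2.mem_toFinset.2 h0) : HasSum (fun μ : fracInt m => c r μ *
      gegenbauer N (k + (1 - (Fintype.card ι : ℂ)) / 2) (2 * m * ((μ : ℝ) : ℂ))
        (m * ((quad (gramOf S e) (r : κ → ℝ) : ℝ) : ℂ))) _)
  rw [← finsum_eq_sum _ h2] at h3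
  refine (h3.mul_right (qExp (gramOf S e) r z)).congr_fun fun μ => ?_
  dsimp only
  rw [projL_sub_smul h, (bilin_sub_smul_left h _ _).2]
  push_cast
  rfl

end ThetaExpansion

/-! ### Translations in the orthogonal group -/

section Translation

variable {S : Matrix ι ι ℤ} {P : Set (ι → ℝ)}

/-- The translation by `v`, minus the identity. -/
def transNil {R : Type*} [CommRing R] (T : Matrix ι ι R) (v : ι → R) (q : R) :
    Matrix (Unit ⊕ ι ⊕ Unit) (Unit ⊕ ι ⊕ Unit) R :=
  fromBlocks 0 (fromCols (of fun _ i => -(T *ᵥ v) i) (of fun _ _ => -q)) 0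
    (fromBlocks 0 (of fun i _ => v i) 0 0)

theorem transNil_mulVec {K : Type*} [Field K] (T : Matrix ι ι K) (v : ι → K) (q a : K)
    (y : ι → K) (c : K) :
    transNil T v q *ᵥ vec a y c = vec (-((T *ᵥ v) ⬝ᵥ y) - q * c) (c • v) 0 := by
  funext j
  rcases j with j | j | j
  · simp [transNil, vec, mulVec, dotProduct, sub_eq_add_neg]
  · simp [transNil, vec, mulVec, dotProduct, mul_comm]
  · simp [transNil, vec, mulVec, dotProduct]

/-- The translation by `v` in the orthogonal group. -/
def transMat (S : Matrix ι ι ℤ) (v : ι → ℝ) :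
    Matrix (Unit ⊕ ι ⊕ Unit) (Unit ⊕ ι ⊕ Unit) ℝ :=
  1 + transNil (S.map (Int.cast : ℤ → ℝ)) v (quad S v)

theorem transMat_mulVec (hS : S.IsSymm) (v : ι → ℝ) (a : ℝ) (y : ι → ℝ) (c : ℝ) :
    transMat S v *ᵥ vec a y c = vec (a - bilin S v y - quad S v * c) (y + c • v) c := by
  have h1 : (S.map (Int.cast : ℤ → ℝ) *ᵥ v) ⬝ᵥ y = bilin S v y := by
    rw [bilin_comm hS, bilin, dotProduct_comm]
  rw [transMat, add_mulVec, one_mulVec, transNil_mulVec, vec_add, h1]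
  congr 1 <;> ring

theorem transMat_mem_orthogonalSet (hS : S.IsSymm) (v : ι → ℝ) :
    transMat S v ∈ orthogonalSet S := by
  have h1 : ∀ X Y : Unit ⊕ ι ⊕ Unit → ℝ,
      bilin (bigGram S) (transMat S v *ᵥ X) (transMat S v *ᵥ Y) = bilin (bigGram S) X Y := by
    intro X Y
    rw [← vec_eta X, ← vec_eta Y, transMat_mulVec hS, transMat_mulVec hS, bilin_bigGram,
      bilin_bigGram, bilin_add_left, bilin_add_right, bilin_add_right, bilin_smul_left,
      bilin_smul_left, bilin_smul_right, bilin_smul_right, quad, bilin_comm hS (mid X) v]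
    ring
  change (transMat S v)ᵀ * (bigGram S).map (Int.cast : ℤ → ℝ) * transMat S v =
    (bigGram S).map (Int.cast : ℤ → ℝ)
  ext i j
  have h2 := h1 (Pi.single i 1) (Pi.single j 1)
  rw [bilin, dotProduct_mulVec_mulVec, bilin] at h2
  simpa using h2

theorem map_transMat_lift (hS : S.IsSymm) (v : ι → ℝ) (z : ι → ℂ) :
    (transMat S v).map (algebraMap ℝ ℂ) *ᵥ lift S z = lift S (z + ofRealVec v) := by
  have h1 : (transMat S v).map (algebraMap ℝ ℂ) =
      1 + transNil (S.map (Int.cast : ℤ → ℂ)) (ofRealVec v) (quad S v : ℝ) := by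
    have h2 : ∀ i, (algebraMap ℝ ℂ) ((S.map (Int.cast : ℤ → ℝ) *ᵥ v) i) =
        (S.map (Int.cast : ℤ → ℂ) *ᵥ ofRealVec v) i := by
      intro i
      simp [mulVec, dotProduct, ofRealVec]
    rw [transMat, ← RingHom.mapMatrix_apply, map_add, map_one, RingHom.mapMatrix_apply]
    congr 1
    ext i j
    rcases i with i | i | i <;> rcases j with j | j | j <;>
      simp [transNil, ofRealVec, ← h2]
  have h2 : (S.map (Int.cast : ℤ → ℂ) *ᵥ ofRealVec v) ⬝ᵥ z = bilin S (ofRealVec v) z := by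
    rw [bilin_comm hS, bilin, dotProduct_comm]
  have h3 : ((quad S v : ℝ) : ℂ) = quad S (ofRealVec v) := by
    rw [quad, quad, bilin_ofRealVec]
    push_cast
    rfl
  rw [h1, lift_eq_vec, add_mulVec, one_mulVec, transNil_mulVec, vec_add, h2, h3, lift_eq_vec]
  congr 1
  · simp only [quad, bilin_add_left, bilin_add_right, bilin_comm hS z]
    ring
  · rw [one_smul]
  · ring

/-- A translation sends lifts to lifts, so its factor of automorphy is `1`. -/
theorem slash_transMat (hS : S.IsSymm) (k : ℤ) (F : (ι → ℂ) → ℂ) (v : ι → ℝ) (z : ι → ℂ) :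
    slash S k F (transMat S v) z = F (z + ofRealVec v) := by
  have h1 : autFactor S (transMat S v) z = 1 := by
    rw [autFactor, map_transMat_lift hS]
    rfl
  have h2 : moebius S (transMat S v) z = z + ofRealVec v := by
    funext i
    rw [moebius, map_transMat_lift hS, h1, div_one]
    rfl
  rw [slash, h1, h2, _root_.one_zpow, one_mul]

theorem continuous_transMat (S : Matrix ι ι ℤ) (v : ι → ℝ) :
    Continuous fun s : ℝ => transMat S (s • v) := by
  have hq : Continuous fun s : ℝ => quad S (s • v) :=
    (continuous_quad S).comp (by fun_prop)
  refine continuous_matrix fun i j => ?_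
  rcases i with i | i | i <;> rcases j with j | j | j <;>
    simp only [transMat, transNil, Matrix.add_apply, fromBlocks_apply₁₁, fromBlocks_apply₁₂,
      fromBlocks_apply₂₁, fromBlocks_apply₂₂, fromCols_apply_inl, fromCols_apply_inr, of_apply,
      mulVec_smul, Pi.smul_apply, smul_eq_mul] <;> fun_prop

/-- Common denominators of a rational matrix. -/
theorem IsRat.exists_denom {α β : Type*} [Fintype α] [Fintype β] {A : Matrix α β ℝ}
    (hA : IsRat A) : ∃ D : ℕ, 0 < D ∧ ∃ Z : Matrix α β ℤ, (D : ℝ) • A = Z.map Int.cast := by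
  choose q hq using hA
  refine ⟨∏ i, ∏ j, (q i j).den, Finset.prod_pos fun i _ => Finset.prod_pos fun j _ => (q i j).pos,
    of fun i j => ((∏ i, ∏ j, (q i j).den : ℕ) / (q i j).den : ℕ) * (q i j).num, ?_⟩
  ext i j
  have h1 : (q i j).den ∣ ∏ i, ∏ j, (q i j).den :=
    (Finset.dvd_prod_of_mem (fun j => (q i j).den) (Finset.mem_univ j)).trans
      (Finset.dvd_prod_of_mem (fun i => ∏ j, (q i j).den) (Finset.mem_univ i))
  obtain ⟨l, hl⟩ := h1
  have h2 : ((q i j).den : ℝ) ≠ 0 := by exact_mod_cast (q i j).pos.ne'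
  have h3 : ((q i j : ℚ) : ℝ) = (q i j).num / (q i j).den := by
    exact_mod_cast (Rat.num_div_den (q i j)).symm
  simp only [Matrix.smul_apply, map_apply, of_apply, smul_eq_mul]
  rw [hq, hl, Nat.mul_div_cancel_left _ (q i j).pos, h3]
  push_cast
  field_simp

end Translation

/-! ### Periodicity at every rational cusp -/

section Periodicity

variable {S : Matrix ι ι ℤ} {P : Set (ι → ℝ)}

/-- The inverse of an orthogonal matrix. -/
def orthInv (S : Matrix ι ι ℤ) (M : Matrix (Unit ⊕ ι ⊕ Unit) (Unit ⊕ ι ⊕ Unit) ℝ) :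
    Matrix (Unit ⊕ ι ⊕ Unit) (Unit ⊕ ι ⊕ Unit) ℝ :=
  hyp (S.map (Int.cast : ℤ → ℝ))⁻¹ * Mᵀ * (bigGram S).map (Int.cast : ℤ → ℝ)

theorem isUnit_det_real (hS : IsEvenLorentzian S) : IsUnit (S.map (Int.cast : ℤ → ℝ)).det :=
  isUnit_iff_ne_zero.2 (IsOrthBasis.det_map_ne_zero hS.det_ne_zero)

theorem orthInv_mul (hS : IsEvenLorentzian S)
    {M : Matrix (Unit ⊕ ι ⊕ Unit) (Unit ⊕ ι ⊕ Unit) ℝ} (hM : M ∈ orthogonalSet S) :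
    orthInv S M * M = 1 := by
  have hM' : Mᵀ * (bigGram S).map (Int.cast : ℤ → ℝ) * M =
    (bigGram S).map (Int.cast : ℤ → ℝ) := hM
  rw [orthInv, Matrix.mul_assoc (hyp _), Matrix.mul_assoc (hyp _), hM', bigGram_map,
    hyp_mul_hyp (nonsing_inv_mul _ (isUnit_det_real hS))]

theorem mul_orthInv (hS : IsEvenLorentzian S)
    {M : Matrix (Unit ⊕ ι ⊕ Unit) (Unit ⊕ ι ⊕ Unit) ℝ} (hM : M ∈ orthogonalSet S) :
    M * orthInv S M = 1 := mul_eq_one_comm.1 (orthInv_mul hS hM)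

theorem orthInv_mem (hS : IsEvenLorentzian S)
    {M : Matrix (Unit ⊕ ι ⊕ Unit) (Unit ⊕ ι ⊕ Unit) ℝ} (hM : M ∈ orthogonalSet S) :
    orthInv S M ∈ orthogonalSet S := by
  have hM' : Mᵀ * (bigGram S).map (Int.cast : ℤ → ℝ) * M =
    (bigGram S).map (Int.cast : ℤ → ℝ) := hM
  have h1 := mul_orthInv hS hM
  have h2 := congrArg transpose h1
  rw [transpose_mul, transpose_one] at h2
  change (orthInv S M)ᵀ * (bigGram S).map (Int.cast : ℤ → ℝ) * orthInv S M = _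
  calc _ = (orthInv S M)ᵀ * (Mᵀ * (bigGram S).map (Int.cast : ℤ → ℝ) * M) * orthInv S M := by
        rw [hM']
    _ = ((orthInv S M)ᵀ * Mᵀ) * (bigGram S).map (Int.cast : ℤ → ℝ) * (M * orthInv S M) := by
        simp only [Matrix.mul_assoc]
    _ = _ := by rw [h1, h2, Matrix.one_mul, Matrix.mul_one]

/-- Scaling `v` by a real parameter gives a path to the identity, whatever component `M` itself lies
in. -/
theorem conj_transMat_mem_SOPlus (hS : IsEvenLorentzian S)
    {M : Matrix (Unit ⊕ ι ⊕ Unit) (Unit ⊕ ι ⊕ Unit) ℝ} (hM : M ∈ orthogonalSet S) (v : ι → ℝ) :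
    M * transMat S v * orthInv S M ∈ SOPlus S := by
  have hc := continuous_transMat S v
  have hpre : IsPreconnected (Set.range fun s : ℝ => M * transMat S (s • v) * orthInv S M) :=
    isPreconnected_range (by fun_prop)
  have h0 : transMat S 0 = 1 := by
    ext i j
    rcases i with i | i | i <;> rcases j with j | j | j <;>
      simp [transMat, transNil, quad, bilin]
  refine hpre.subset_connectedComponentIn ⟨0, ?_⟩ ?_ ⟨1, by simp⟩
  · simp only [zero_smul, h0, Matrix.mul_one]
    exact mul_orthInv hS hM
  · rintro _ ⟨s, rfl⟩
    exact mul_mem_orthogonalSet (mul_mem_orthogonalSet hM (transMat_mem_orthogonalSet hS.symm _))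
      (orthInv_mem hS hM)

/-- Conjugates of sufficiently divisible translations lie in the modular group. -/
theorem exists_conj_transMat_mem_modularGroup (hS : IsEvenLorentzian S)
    {M : Matrix (Unit ⊕ ι ⊕ Unit) (Unit ⊕ ι ⊕ Unit) ℝ} (hM : M ∈ SOPlusRat S) :
    ∃ d : ℕ, 0 < d ∧ ∀ n : ι → ℤ,
      M * transMat S ((d : ℝ) • ofInt ℝ n) * orthInv S M ∈ modularGroup S := by
  have hMo := SOPlus_subset _ hM.1
  have hMr : IsRat M := hM.2
  have hSinv : IsRat (hyp (S.map (Int.cast : ℤ → ℝ))⁻¹) :=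
    ((IsRat.intCast S).inv (isUnit_det_real hS)).hyp
  obtain ⟨D₁, hD₁, Z₁, hZ₁⟩ := hMr.exists_denom
  obtain ⟨D₂, hD₂, Z₂, hZ₂⟩ := (((hSinv.mul hMr.transpose).mul (IsRat.intCast _)).mul
    hSinv : IsRat (orthInv S M * hyp (S.map (Int.cast : ℤ → ℝ))⁻¹)).exists_denom
  -- A dual vector is `G⁻¹ u` with `u` integral. `D₁` clears the denominators of `M`, `D₂` those of
  -- `M⁻¹ G⁻¹`, and the `2` absorbs the half in `Q`, so that the translation minus `1` is divisible
  -- by the whole number.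
  refine ⟨2 * (D₁ * D₂), by positivity, fun n => ⟨conj_transMat_mem_SOPlus hS hMo _, ?_⟩⟩
  intro x hx
  choose u hu using fun j : Unit ⊕ ι ⊕ Unit => hx (Pi.single j 1)
  have hGx : (bigGram S).map (Int.cast : ℤ → ℝ) *ᵥ x = ofInt ℝ u := by
    funext j
    have h1 := hu j
    have h2 : ofInt ℝ (Pi.single j (1 : ℤ)) = Pi.single j (1 : ℝ) := by
      funext i
      simp [ofInt, Pi.single_apply, apply_ite]
    rw [bilin_comm (isSymm_bigGram hS.symm), bilin, h2, single_dotProduct, one_mul] at h1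
    exact h1
  have hx' : x = hyp (S.map (Int.cast : ℤ → ℝ))⁻¹ *ᵥ ofInt ℝ u := by
    rw [← hGx, mulVec_mulVec, bigGram_map,
      hyp_mul_hyp (nonsing_inv_mul _ (isUnit_det_real hS)), one_mulVec]
  set A : Matrix (Unit ⊕ ι ⊕ Unit) (Unit ⊕ ι ⊕ Unit) ℤ :=
    transNil S n ((D₁ * D₂ : ℕ) * (n ⬝ᵥ S *ᵥ n)) with hA
  have hT : transMat S (((2 * (D₁ * D₂) : ℕ) : ℝ) • ofInt ℝ n) =
      1 + ((2 * (D₁ * D₂) : ℕ) : ℝ) • A.map (Int.cast : ℤ → ℝ) := by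
    rw [transMat]
    congr 1
    have h3 : ∀ i, (S.map (Int.cast : ℤ → ℝ) *ᵥ ofInt ℝ n) i = ((S *ᵥ n) i : ℤ) := by
      intro i
      simp [mulVec, dotProduct, ofInt]
    have h4 : quad S (((2 * (D₁ * D₂) : ℕ) : ℝ) • ofInt ℝ n) =
        ((2 * (D₁ * D₂) : ℕ) : ℝ) * (((D₁ * D₂ : ℕ) : ℝ) * ((n ⬝ᵥ S *ᵥ n : ℤ) : ℝ)) := by
      rw [quad, bilin_smul_left, bilin_smul_right, bilin_ofInt]
      push_cast
      ring
    rw [h4, hA]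
    ext i j
    rcases i with i | i | i <;> rcases j with j | j | j <;>
      simp [transNil, mulVec_smul, h3, ofInt]
  refine ⟨(2 : ℤ) • (Z₁ *ᵥ (A *ᵥ (Z₂ *ᵥ u))), ?_⟩
  have hcast : ∀ (Z : Matrix (Unit ⊕ ι ⊕ Unit) (Unit ⊕ ι ⊕ Unit) ℤ) (w : Unit ⊕ ι ⊕ Unit → ℤ),
      ofInt ℝ (Z *ᵥ w) = Z.map (Int.cast : ℤ → ℝ) *ᵥ ofInt ℝ w := by
    intro Z w
    funext i
    simp [mulVec, dotProduct, ofInt]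
  have h5 : ofInt ℝ ((2 : ℤ) • (Z₁ *ᵥ (A *ᵥ (Z₂ *ᵥ u)))) =
      (2 : ℝ) • ofInt ℝ (Z₁ *ᵥ (A *ᵥ (Z₂ *ᵥ u))) := by
    funext i
    simp [ofInt]
  rw [h5, hcast, hcast, hcast, ← hZ₁, ← hZ₂, hT, Matrix.mul_add, Matrix.add_mul, Matrix.mul_one,
    mul_orthInv hS hMo, add_mulVec, one_mulVec, add_sub_cancel_left]
  nth_rw 1 [hx']
  simp only [mul_smul_comm, smul_mul_assoc, smul_mulVec, mulVec_smul, smul_smul, mulVec_mulVec]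
  congr 1
  · push_cast
    ring
  · simp only [orthInv, Matrix.mul_assoc]

/-- With `T` the translation, `M T = (M T M⁻¹) M`, and the conjugate lies in the modular group,
which fixes `F`. -/
theorem exists_period (hS : IsEvenLorentzian S) (hP : IsPositiveCone S P) {k : ℤ}
    {F : (ι → ℂ) → ℂ} (hF : IsModularForm S P k F)
    {M : Matrix (Unit ⊕ ι ⊕ Unit) (Unit ⊕ ι ⊕ Unit) ℝ} (hM : M ∈ SOPlusRat S) :
    ∃ d : ℕ, 0 < d ∧ ∀ z ∈ upperHalfSpace P, ∀ n : ι → ℤ,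
      slash S k F M (z + ofRealVec ((d : ℝ) • ofInt ℝ n)) = slash S k F M z := by
  obtain ⟨d, hd, h1⟩ := exists_conj_transMat_mem_modularGroup hS hM
  refine ⟨d, hd, fun z hz n => ?_⟩
  have hMo := SOPlus_subset _ hM.1
  have hz' := hP.quad_pos hz
  set T := transMat S ((d : ℝ) • ofInt ℝ n)
  have hT : T ∈ orthogonalSet S := transMat_mem_orthogonalSet hS.symm _
  have h2 : M * T = M * T * orthInv S M * M := by
    rw [Matrix.mul_assoc (M * T), orthInv_mul hS hMo, Matrix.mul_one]
  rw [← slash_transMat hS.symm k (slash S k F M), ← slash_mul hS k F hT hz', h2,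
    slash_mul hS k F hMo hz', slash, hF.slash_eq _ (h1 n) _ (moebius_mem hS hP hM.1 hz)]
  rfl

end Periodicity

/-! ### Behaviour of the pullback at the cusps -/

section Cusps

variable {S : Matrix ι ι ℤ} {e : κ → ι → ℤ} {lam : ι → ℤ} {m : ℤ} {P : Set (ι → ℝ)}

theorem bilin_ofRealVec_left (S : Matrix ι ι ℤ) (r : ι → ℝ) (z : ι → ℂ) :
    bilin S (ofRealVec r) z = ∑ i, (bilin S r (Pi.single i 1) : ℝ) * z i := by
  have h1 : ∀ i, ((bilin S r (Pi.single i 1) : ℝ) : ℂ) =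
      bilin S (ofRealVec r) (Pi.single i 1) := by
    intro i
    have : (Pi.single i 1 : ι → ℂ) = ofRealVec (Pi.single i 1) := by
      funext j
      simp [ofRealVec, Pi.single_apply, apply_ite]
    rw [this, bilin_ofRealVec]
  simp only [h1]
  conv_lhs => rw [← Finset.univ_sum_single z, bilin, mulVec_sum, dotProduct_sum]
  refine Finset.sum_congr rfl fun i _ => ?_
  have h2 : (Pi.single i (z i) : ι → ℂ) = z i • Pi.single i 1 := by
    rw [← Pi.single_smul, smul_eq_mul, mul_one]
  rw [h2, mulVec_smul, dotProduct_smul, smul_eq_mul, mul_comm]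
  rfl

/-- The element of the dual lattice with given pairings with the basis. -/
def dualVec (S : Matrix ι ι ℤ) (n : ι → ℤ) : ι → ℝ := (S.map (Int.cast : ℤ → ℝ))⁻¹ *ᵥ ofInt ℝ n

theorem bilin_dualVec (hS : IsEvenLorentzian S) (n : ι → ℤ) (x : ι → ℝ) :
    bilin S (dualVec S n) x = ∑ i, (n i : ℝ) * x i := by
  rw [bilin_comm hS.symm, bilin, dualVec, mulVec_mulVec,
    mul_nonsing_inv _ (isUnit_det_real hS), one_mulVec, dotProduct_comm]
  rfl

theorem projL_dualVec_mem (h : IsOrthBasis S e lam m) (hS : IsEvenLorentzian S) (n : ι → ℤ) :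
    projL S e (dualVec S n) ∈ dualLattice (gramOf S e) := by
  intro y
  refine ⟨∑ i, n i * ∑ k, y k * e k i, ?_⟩
  rw [bilin_gram_projL h, bilin_dualVec hS]
  push_cast
  simp [embed, ofInt]

theorem projL_smul (S : Matrix ι ι ℤ) (e : κ → ι → ℤ) (a : ℝ) (x : ι → ℝ) :
    projL S e (a • x) = a • projL S e x := by
  simp only [projL, bilin_smul_right]
  exact mulVec_smul _ a fun k => bilin S (ofInt ℝ (e k)) x

/-- The complement of the projection is a multiple of `lam`, whose norm is `-m`. For `x` of
nonnegative norm, the projection is therefore isotropic only if `x` is isotropic and orthogonal to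
`lam`. -/
theorem quad_embed_projL (h : IsOrthBasis S e lam m) (x : ι → ℝ) :
    quad (gramOf S e) (projL S e x) = quad S x + bilin S x (ofInt ℝ lam) ^ 2 / (4 * m) ∧
      bilin S (embed e (projL S e x)) x = 2 * quad (gramOf S e) (projL S e x) := by
  have hm := h.m_ne_zero (K := ℝ)
  have h1 : bilin S (embed e (projL S e x)) x = 2 * quad (gramOf S e) (projL S e x) := by
    rw [← bilin_self, bilin_gram_projL h, bilin_comm h.symm]
  refine ⟨?_, h1⟩
  have h2 : 2 * quad (gramOf S e) (projL S e x) = bilin S x x +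
      1 / (2 * m) * bilin S (ofInt ℝ lam) x * bilin S (ofInt ℝ lam) x := by
    rw [← h1, h.decomp, bilin_add_left, bilin_smul_left]
  rw [bilin_self, bilin_comm h.symm (ofInt ℝ lam)] at h2
  have h3 : bilin S x (ofInt ℝ lam) ^ 2 / (4 * m) =
      1 / 2 * (1 / (2 * m) * bilin S x (ofInt ℝ lam) * bilin S x (ofInt ℝ lam)) := by
    field_simp
    norm_num
  linarith

/-- The projection of an element of the dual cone lies in the cone, unless it is isotropic. -/
theorem embed_projL_mem (h : IsOrthBasis S e lam m) (hS : IsEvenLorentzian S)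
    (hP : IsPositiveCone S P) {x : ι → ℝ} (hx : ∀ v ∈ P, 0 ≤ bilin S x v)
    (hq : 0 < quad (gramOf S e) (projL S e x)) : embed e (projL S e x) ∈ P := by
  obtain ⟨v, hv⟩ := hP.nonempty
  set r := embed e (projL S e x) with hr
  -- The vector `x` may lie on the boundary of the cone. It is moved into the interior by `ε • v`,
  -- with `ε` so small that the pairing with `r`, which is `2Q(r) > 0` at `x`, stays positive.
  have h1 : bilin S r x = 2 * quad (gramOf S e) (projL S e x) := (quad_embed_projL h x).2
  have hqr : 0 < quad S r := by rwa [hr, h.quad_embed]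
  obtain ⟨ε, hε, hpos⟩ : ∃ ε : ℝ, 0 < ε ∧ 0 < bilin S r x + ε * bilin S r v := by
    have h2 : 0 < bilin S r x := by linarith
    refine ⟨bilin S r x / (2 * (|bilin S r v| + 1)), by positivity, ?_⟩
    have h3 : bilin S r x / (2 * (|bilin S r v| + 1)) * (|bilin S r v| + 1) = bilin S r x / 2 := by
      field_simp
    nlinarith [neg_abs_le (bilin S r v),
      div_pos h2 (show 0 < 2 * (|bilin S r v| + 1) by positivity)]
  have hw : x + ε • v ∈ P := by
    refine (hP.mem_iff hS hv).2 ⟨?_, ?_⟩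
    · have h2 := quad_add_smul hS.symm 1 ε x v
      rw [one_smul] at h2
      rw [h2]
      have h3 := hP.quad_nonneg_of_dual hS hx
      have h4 := hx v hv
      have h5 := hP.quad_pos hv
      positivity
    · rw [bilin_add_right, bilin_smul_right, bilin_self, bilin_comm hS.symm]
      have h4 := hx v hv
      have h5 := hP.quad_pos hv
      positivity
  refine (hP.mem_iff hS hw).2 ⟨hqr, ?_⟩
  rw [bilin_comm hS.symm, bilin_add_right, bilin_smul_right]
  exact hpos

theorem gegenbauer_zero {N : ℕ} (hN : 1 ≤ N) (s : ℂ) : gegenbauer N s 0 0 = 0 := by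
  rw [gegenbauer]
  refine Finset.sum_eq_zero fun j _ => ?_
  rcases Nat.eq_zero_or_pos j with rfl | hj
  · rw [zero_pow (by omega), mul_zero, zero_mul]
  · rw [zero_pow (M₀ := ℂ) hj.ne', mul_zero]

/-- The Fourier expansion at the cusps. -/
theorem exists_slash_expansion (hS : IsEvenLorentzian S) (hP : IsPositiveCone S P) {k : ℤ}
    {F : (ι → ℂ) → ℂ} (hF : IsModularForm S P k F)
    {M : Matrix (Unit ⊕ ι ⊕ Unit) (Unit ⊕ ι ⊕ Unit) ℝ} (hM : M ∈ SOPlusRat S) :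
    ∃ d : ℕ, 0 < d ∧ ∃ c : (ι → ℤ) → ℂ,
      HasExp S P (fun n => (d : ℝ)⁻¹ • dualVec S n) c (slash S k F M) ∧
      ∀ n, c n ≠ 0 → ∀ v ∈ P, 0 ≤ bilin S ((d : ℝ)⁻¹ • dualVec S n) v := by
  obtain ⟨d, hd, hper⟩ := exists_period hS hP hF hM
  have hd' : (0 : ℝ) < d := by exact_mod_cast hd
  have hdc : (d : ℂ) ≠ 0 := by exact_mod_cast hd.ne'
  have hsm : ∀ a : ℝ, 0 < a → ∀ z ∈ upperHalfSpace P, (a : ℂ) • z ∈ upperHalfSpace P := by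
    intro a ha z hz
    have := hP.smul_mem hS (x := fun i => (z i).im) hz ha
    refine (congrArg (· ∈ P) ?_).mp this
    funext i
    simp
  have hdiff := differentiableOn_slash hS hP k hF.holomorphic hM.1
  -- Rescaling by `d` turns the period lattice into the standard one; scaling back puts the factor
  -- `d⁻¹` on the exponents.
  obtain ⟨c, hc⟩ := exists_fourier_expansion (hP.isOpen hS) (hP.convex hS)
    (f := fun z => slash S k F M (((d : ℝ) : ℂ) • z))
    (hdiff.comp (by fun_prop) fun z hz => hsm d hd' z hz)
    (fun z hz n => by
      rw [← hper _ (hsm d hd' z hz) n, smul_add]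
      congr 2
      funext i
      simp [ofRealVec, ofInt])
  have hexp : HasExp S P (fun n => (d : ℝ)⁻¹ • dualVec S n) c (slash S k F M) := by
    intro z hz
    have h1 := hc _ (hsm (d : ℝ)⁻¹ (inv_pos.2 hd') z hz)
    have h2 : ((d : ℝ) : ℂ) • (((d : ℝ)⁻¹ : ℝ) : ℂ) • z = z := by
      rw [smul_smul, Complex.ofReal_inv, Complex.ofReal_natCast, mul_inv_cancel₀ hdc, one_smul]
    rw [h2] at h1
    refine h1.congr_fun fun n => ?_
    dsimp only
    rw [qExp_eq, pair_smul, bilin_ofRealVec_left]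
    congr 3
    rw [pair, Finset.mul_sum]
    refine Finset.sum_congr rfl fun i _ => ?_
    rw [bilin_smul_left, bilin_dualVec hS]
    simp [Pi.single_apply]
    ring
  refine ⟨d, hd, c, hexp, fun n hn v hv => ?_⟩
  refine hexp.bilin_nonneg hS hP Function.injective_id (b := fun j => (d : ℝ) • Pi.single j 1)
    (fun n j => ?_) hv (hF.bounded M hM v hv) hn
  rw [bilin_smul_left, bilin_smul_right, bilin_dualVec hS, inv_mul_cancel_left₀ hd'.ne']
  simp [Pi.single_apply]

/-- The Fourier expansion of the pullback at the cusps. -/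
theorem exists_slash_pullback_expansion (h : IsOrthBasis S e lam m) (hS : IsEvenLorentzian S)
    (hP : IsPositiveCone S P) {k : ℤ} {F : (ι → ℂ) → ℂ} (hF : IsModularForm S P k F) (N : ℕ)
    {M : Matrix (Unit ⊕ κ ⊕ Unit) (Unit ⊕ κ ⊕ Unit) ℝ} (hM : M ∈ SOPlusRat (gramOf S e)) :
    ∃ d : ℕ, 0 < d ∧ ∃ (a : (ι → ℤ) → ℂ) (R : (ι → ℤ) → dualLattice (gramOf S e)),
      HasExp (gramOf S e) (subCone e P) (fun n => (d : ℝ)⁻¹ • (R n : κ → ℝ)) a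
        (slash (gramOf S e) (k + N) (pullback S e k N F lam) M) ∧
      (∀ n, a n ≠ 0 → ∀ v ∈ subCone e P, 0 ≤ bilin (gramOf S e) (R n : κ → ℝ) v) ∧
      (1 ≤ N → ∀ n, a n ≠ 0 → (R n : κ → ℝ) ∈ subCone e P) := by
  have hE : extMat S e M ∈ SOPlusRat S :=
    ⟨extMat_mem_SOPlus h hM.1, extMat_rational h hM.2⟩
  obtain ⟨d, hd, c, hexp, hpos⟩ := exists_slash_expansion hS hP hF hE
  have hd' : (0 : ℝ) < d := by exact_mod_cast hd
  have hmpos : (0 : ℝ) < m := by exact_mod_cast h.pos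
  have h1 := HasExp.pullback h (hP.isOpen hS)
    (differentiableOn_slash hS hP k hF.holomorphic hE.1) hexp k N
  refine ⟨d, hd, fun n => c n * gegenbauer N (k + (1 - (Fintype.card ι : ℂ)) / 2)
      ((bilin S ((d : ℝ)⁻¹ • dualVec S n) (ofInt ℝ lam) : ℝ) : ℂ)
      (m * ((quad (gramOf S e) (projL S e ((d : ℝ)⁻¹ • dualVec S n)) : ℝ) : ℂ)),
    fun n => ⟨projL S e (dualVec S n), projL_dualVec_mem h hS n⟩,
    fun z hz => ?_, fun n hn v hv => ?_, fun hN n hn => ?_⟩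
  rotate_left
  · have h2 := hpos n (left_ne_zero_of_mul hn) _ hv
    rw [bilin_smul_left] at h2
    rw [bilin_gram_projL h]
    exact nonneg_of_mul_nonneg_right h2 (inv_pos.2 hd')
  · have h2 := hpos n (left_ne_zero_of_mul hn)
    have h3 := hP.quad_nonneg_of_dual hS h2
    have h4 := (quad_embed_projL h ((d : ℝ)⁻¹ • dualVec S n)).1
    have hq : 0 < quad (gramOf S e) (projL S e ((d : ℝ)⁻¹ • dualVec S n)) := by
      -- If the projection were isotropic, both arguments of the Gegenbauer polynomial would vanish,
      -- and with them the coefficient, as the polynomial has no constant term for `N ≥ 1`.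
      refine lt_of_le_of_ne (by rw [h4]; positivity) fun h0 => hn ?_
      have h5 : bilin S ((d : ℝ)⁻¹ • dualVec S n) (ofInt ℝ lam) = 0 := by
        have h6 : bilin S ((d : ℝ)⁻¹ • dualVec S n) (ofInt ℝ lam) ^ 2 / (4 * m) = 0 := by
          have : 0 ≤ bilin S ((d : ℝ)⁻¹ • dualVec S n) (ofInt ℝ lam) ^ 2 / (4 * m) := by positivity
          linarith
        rcases div_eq_zero_iff.1 h6 with h7 | h7
        · exact pow_eq_zero_iff two_ne_zero |>.1 h7
        · linarith
      dsimp only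
      rw [h5, ← h0, Complex.ofReal_zero, mul_zero, gegenbauer_zero hN, mul_zero]
    have h8 := hP.smul_mem hS (embed_projL_mem h hS hP h2 hq) hd'
    rw [projL_smul, embed_smul, smul_smul, mul_inv_cancel₀ hd'.ne', one_smul] at h8
    exact h8
  · rw [slash_pullback h hS hP k N hF.holomorphic hM.1 hz]
    refine (h1 z hz).congr_fun fun n => ?_
    dsimp only
    rw [projL_smul]

theorem rayPoint_mem_subCone (hS : IsEvenLorentzian S) (hP : IsPositiveCone S P) (x : κ → ℝ)
    {v : κ → ℝ} (hv : v ∈ subCone e P) {t : ℝ} (ht : 0 < t) :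
    rayPoint x v t ∈ upperHalfSpace (subCone e P) := by
  change embed e (fun i => (rayPoint x v t i).im) ∈ P
  rw [im_rayPoint, embed_smul]
  exact hP.smul_mem hS hv ht

/-- When the exponent pairs nonnegatively with `v`, the term decreases along the ray, and its
modulus ignores the real part. This yields one summable majorant, uniform in `x` and `t ≥ 1`, for
boundedness and for dominated convergence. -/
theorem norm_term_le {T : Matrix κ κ ℤ} {r v : κ → ℝ} {a : ℂ} (hr : a ≠ 0 → 0 ≤ bilin T r v)
    (x : κ → ℝ) {t : ℝ} (ht : 1 ≤ t) :
    ‖a * qExp T r (rayPoint x v t)‖ ≤ ‖a * qExp T r (rayPoint 0 v 1)‖ := by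
  by_cases ha : a = 0
  · simp [ha]
  · rw [norm_mul, norm_mul, norm_qExp, norm_qExp, im_rayPoint, im_rayPoint, bilin_smul_right,
      bilin_smul_right]
    refine mul_le_mul_of_nonneg_left (Real.exp_le_exp.2 (neg_le_neg ?_)) (norm_nonneg _)
    exact mul_le_mul_of_nonneg_left (mul_le_mul_of_nonneg_right ht (hr ha)) (by positivity)

theorem isModularForm_pullback (h : IsOrthBasis S e lam m) (hS : IsEvenLorentzian S)
    (hP : IsPositiveCone S P) {k : ℤ} {F : (ι → ℂ) → ℂ} (hF : IsModularForm S P k F) (N : ℕ) :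
    IsModularForm (gramOf S e) (subCone e P) (k + N) (pullback S e k N F lam) where
  holomorphic := differentiableOn_pullback (hP.isOpen hS) k N hF.holomorphic
  slash_eq M hM z hz := slash_pullback_modularGroup h hS hP N hF hM hz
  bounded M hM v hv := by
    obtain ⟨d, hd, a, R, hexp, hpos, -⟩ := exists_slash_pullback_expansion h hS hP hF N hM
    have hs := (hexp _ (rayPoint_mem_subCone hS hP 0 hv one_pos)).summable.norm
    refine ⟨∑' n, ‖a n * qExp (gramOf S e) ((d : ℝ)⁻¹ • (R n : κ → ℝ)) (rayPoint 0 v 1)‖,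
      (eventually_ge_atTop 1).mono fun t ht x => ?_⟩
    rw [← (hexp _ (rayPoint_mem_subCone hS hP x hv (one_pos.trans_le ht))).tsum_eq]
    refine tsum_of_norm_bounded hs.hasSum fun n => norm_term_le (fun hn => ?_) x ht
    rw [bilin_smul_left]
    exact mul_nonneg (inv_nonneg.2 (Nat.cast_nonneg d)) (hpos n hn v hv)

theorem isCuspForm_pullback (h : IsOrthBasis S e lam m) (hS : IsEvenLorentzian S)
    (hP : IsPositiveCone S P) {k : ℤ} {F : (ι → ℂ) → ℂ} (hF : IsModularForm S P k F) {N : ℕ}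
    (hN : 1 ≤ N) :
    IsCuspForm (gramOf S e) (subCone e P) (k + N) (pullback S e k N F lam) where
  isModularForm := isModularForm_pullback h hS hP hF N
  tendsto_zero M hM v hv x := by
    obtain ⟨d, hd, a, R, hexp, hpos, hcone⟩ := exists_slash_pullback_expansion h hS hP hF N hM
    have hd' : (0 : ℝ) < d := by exact_mod_cast hd
    have hs := (hexp _ (rayPoint_mem_subCone hS hP 0 hv one_pos)).summable.norm
    have hlim := tendsto_tsum_of_dominated_convergence (𝓕 := atTop)
      (f := fun t n => a n * qExp (gramOf S e) ((d : ℝ)⁻¹ • (R n : κ → ℝ)) (rayPoint x v t))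
      (g := fun _ => 0) hs (fun n => by
        by_cases hn : a n = 0
        · simp [hn]
        · have hb : 0 < bilin (gramOf S e) ((d : ℝ)⁻¹ • (R n : κ → ℝ)) v := by
            rw [bilin_smul_left, ← h.bilin_embed_embed]
            exact mul_pos (inv_pos.2 hd') (hP.bilin_pos hS (hcone hN n hn) hv)
          rw [tendsto_zero_iff_norm_tendsto_zero]
          simp only [norm_mul, norm_qExp, im_rayPoint, bilin_smul_right]
          have h1 : Tendsto (fun t : ℝ => 2 * Real.pi *
              (t * bilin (gramOf S e) ((d : ℝ)⁻¹ • (R n : κ → ℝ)) v)) atTop atTop :=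
            (tendsto_id.atTop_mul_const hb).const_mul_atTop (by positivity)
          simpa using (Real.tendsto_exp_neg_atTop_nhds_zero.comp h1).const_mul ‖a n‖)
      ((eventually_ge_atTop 1).mono fun t ht n => norm_term_le (fun hn => by
        rw [bilin_smul_left]
        exact mul_nonneg (inv_nonneg.2 hd'.le) (hpos n hn v hv)) x ht)
    rw [tsum_zero] at hlim
    refine hlim.congr' ((eventually_gt_atTop 0).mono fun t ht => ?_)
    exact (hexp _ (rayPoint_mem_subCone hS hP x hv ht)).tsum_eq
  support M hM := by
    obtain ⟨d, hd, a, R, hexp, -, hcone⟩ := exists_slash_pullback_expansion h hS hP hF N hM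
    -- Different exponents of `F` may have the same projection, so the coefficient at `r` is the sum
    -- over the fibre of `R`.
    refine ⟨d, hd, fun r => ∑' n : R ⁻¹' {r}, a n, fun r hr => ?_, fun z hz => ?_⟩
    · obtain ⟨⟨n, hn⟩, hna⟩ : ∃ n : R ⁻¹' {r}, a n ≠ 0 := by
        by_contra hcon
        push Not at hcon
        exact hr (by simp [hcon])
      have h1 : R n = r := hn
      rw [← h1]
      exact hcone hN n hna
    · refine ((hexp z hz).tsum_fiberwise R).congr_fun fun r => ?_
      dsimp only
      rw [← tsum_mul_right]
      refine tsum_congr fun n => ?_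
      have h1 : R n = r := n.2
      rw [h1]

end Cusps

end

end HigherPullback

theorem corollary3p6 {ℓ : ℕ} (S : Matrix (Fin ℓ) (Fin ℓ) ℤ) (hS : IsEvenLorentzian S)
    (P : Set (Fin ℓ → ℝ)) (hP : IsPositiveCone S P)
    (lam : Fin ℓ → ℤ) (m : ℤ) (hm : 0 < m) (hlam : quad S (ofInt ℝ lam) = -(m : ℝ))
    -- `e` is a `ℤ`-basis of the lattice `L = λ^⊥`
    (e : Fin (ℓ - 1) → Fin ℓ → ℤ) (he : LinearIndependent ℤ e)
    (hspan : Submodule.span ℤ (Set.range e) = orthLattice S lam)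
    (k : ℤ) (F : (Fin ℓ → ℂ) → ℂ) (hF : IsModularForm S P k F) (N : ℕ) :
    IsModularForm (gramOf S e) (subCone e P) (k + N) (pullback S e k N F lam) ∧
    (1 ≤ N → IsCuspForm (gramOf S e) (subCone e P) (k + N) (pullback S e k N F lam)) ∧
    (∀ c : dualLattice (gramOf S e) → fracInt m → ℂ,
      (∀ (z : Fin (ℓ - 1) → ℂ) (w : ℂ), embed e z + w • ofInt ℂ lam ∈ upperHalfSpace P →
        HasSum (fun p : dualLattice (gramOf S e) × fracInt m =>
            c p.1 p.2 * qExp (gramOf S e) p.1 z *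
              Complex.exp (2 * Real.pi * Complex.I * (2 * m) * w * ((p.2 : ℝ) : ℂ)))
          (F (embed e z + w • ofInt ℂ lam))) →
      (∀ r, (Function.support (c r)).Finite) ∧
      ∀ z ∈ upperHalfSpace (subCone e P),
        HasSum (fun r : dualLattice (gramOf S e) =>
            (∑ᶠ μ : fracInt m, c r μ *
              gegenbauer N (k + (1 - (ℓ : ℂ)) / 2) (2 * m * ((μ : ℝ) : ℂ))
                (m * ((quad (gramOf S e) (r : Fin (ℓ - 1) → ℝ) : ℝ) : ℂ))) *
              qExp (gramOf S e) r z)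
          (pullback S e k N F lam z)) ∧
    (∀ a : ℤ, ∀ z ∈ upperHalfSpace (subCone e P),
      pullback S e k N F (a • lam) z = (a : ℂ) ^ N * pullback S e k N F lam z) := by
  -- The rank `ℓ - 1` is a truncated subtraction; `ℓ = 0` is excluded because `lam` has nonzero
  -- norm.
  have hℓ : ℓ ≠ 0 := by
    rintro rfl
    have h1 : quad S (ofInt ℝ lam) = 0 := by simp [quad, bilin]
    rw [h1, eq_comm, neg_eq_zero] at hlam
    exact hm.ne' (by exact_mod_cast hlam)
  have h : IsOrthBasis S e lam m :=
    { symm := hS.symm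
      det_ne_zero := hS.det_ne_zero
      orth := fun i => by
        have h1 : e i ∈ orthLattice S lam :=
          hspan ▸ Submodule.subset_span (Set.mem_range_self i)
        exact h1
      norm := by
        rw [quad, bilin_ofInt] at hlam
        have h1 : ((lam ⬝ᵥ S.mulVec lam : ℤ) : ℝ) = -(2 * m) := by linarith
        exact_mod_cast h1
      pos := hm
      card := by
        simp only [Fintype.card_fin]
        omega
      linearIndependent := he }
  refine ⟨isModularForm_pullback h hS hP hF N, fun hN => isCuspForm_pullback h hS hP hF hN,
    fun c hc => ?_, fun a z hz => pullback_zsmul (hP.isOpen hS) k N hF.holomorphic a hz⟩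
  have h1 := pullback_expansion h hS hP hF N hc
  rw [Fintype.card_fin] at h1
  exact h1
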